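/- **Theorem 3.** Let $\Omega=S\times(-L,L)\subset\mathbb{R}^3$ with $L>0$ and $S\subset\mathbb{R}^2$ a bounded open set with Lipschitz boundary, and let $\omega,\mu,\lambda>0$. Let $Y=[0,1]^3$ and $\Sigma_0=\{y\in Y: y_3=0\}$. Let $\varepsilon(x,y)$, for $x\in\Omega$ and $y\in\mathbb{R}^3$, be a measurable complex function that is $1$-periodic in each $y_i$, and let $\sigma(x,y)$, for $x\in\Omega$ and $y\in\mathbb{R}^2\cong\{y_3=0\}$, be a Lipschitz continuous complex function that is $1$-periodic in $y_1,y_2$. Assume that, for some constants $0<c\le C$ and all $x,y$, $$c\le\operatorname{Im}\varepsilon(x,y),\quad |\varepsilon(x,y)|\le C,\quad c\le\operatorname{Re}\sigma(x,y),\quad |\sigma(x,y)|\le C .$$ Let $H=\{u\in H^1_\#(Y;\mathbb{C}) : (\nabla_y u)_T\in L^2(\Sigma_0;\mathbb{C}^3)\}$, where $H^1_\#(Y;\mathbb{C})$ is the $H^1(Y)$-closure of the smooth $Y$-periodic functions and $(\nabla_y u)_T$ is the gradient along $\Sigma_0$ of the trace of $u$ on $\Sigma_0$. For a vector $a$ at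 a point of $\Sigma_0$, $a_T=P_Ta$ with $P_T=\mathrm{diag}(1,1,0)$. The effective permittivity $\varepsilon^{\mathrm{eff}}(x)\in\mathbb{C}^{3\times3}$ is defined for a.e. $x\in\Omega$ by $$\varepsilon^{\mathrm{eff}}_{ij}(x)=\int_Y\varepsilon(x,y)\,(e_j+\nabla_y\chi_j(x,y))\cdot e_i\,dy-\frac1{i\omega}\int_{\Sigma_0}\sigma(x,y)\,(e_j+\nabla_y\chi_j(x,y))_T\cdot e_i\,do_y ,$$ where the corrector $\chi_j(x,\cdot)\in H$ solves the cell problem $$\int_Y i\omega\,\varepsilon(x,y)\,(e_j+\nabla_y\chi_j)\cdot\nabla_y\overline v\,dy=\int_{\Sigma_0}\sigma(x,y)\,(e_j+\nabla_y\chi_j)_T\cdot(\nabla_y\overline v)_T\,do_y\qquad\forall v\in H .$$ Let $X^0=\{u\in H(\mathrm{curl};\Omega): u_T\in L^2(\partial\Omega;\mathbb{C}^3)\}$, where on $\partial\Omega$, with outer unit normal $\nu$, $u_T=(\nu\times u)\times\nu$ is the tangential trace, and for $u,v\in X^0$ let $$a^0(u,v)=\int_\Omega\frac1\mu(\nabla\times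 u)\cdot(\nabla\times\overline v)\,dx-\int_\Omega\omega^2\,\varepsilon^{\mathrm{eff}}u\cdot\overline v\,dx-\int_{\partial\Omega}i\omega\lambda\,u_T\cdot\overline v_T\,do_x .$$ Then $\varepsilon^{\mathrm{eff}}$ is well defined: such correctors exist for a.e. $x\in\Omega$, and $\varepsilon^{\mathrm{eff}}$ is determined up to null sets and is (a.e. equal to) a bounded measurable matrix field. It satisfies $$\operatorname{Im}\big(\varepsilon^{\mathrm{eff}}(x)\,\xi\cdot\overline\xi\big)\ge c\,|\xi|^2\qquad\text{for a.e. }x\in\Omega\text{ and all }\xi\in\mathbb{C}^3 .$$ Moreover, for every $J_a\in L^2(\Omega;\mathbb{C}^3)$ there is a unique $\mathcal{E}\in X^0$ such that $$a^0(\mathcal{E},\Psi)=\int_\Omega i\omega\,J_a\cdot\overline\Psi\,dx\qquad\forall\,\Psi\in X^0 .$$ -/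

import Mathlib

open MeasureTheory Filter Topology
open scoped NNReal

noncomputable section

namespace PlasmonicMaxwell

/-- Points of the plane. -/
abbrev E2 : Type := EuclideanSpace ℝ (Fin 2)

/-- Points of space. -/
abbrev E3 : Type := EuclideanSpace ℝ (Fin 3)

/-- Complex vectors with two components (tangential vectors of a horizontal sheet). -/
abbrev C2 : Type := EuclideanSpace ℂ (Fin 2)

/-- Complex vectors with three components (values of vector fields). -/
abbrev C3 : Type := EuclideanSpace ℂ (Fin 3)

/-! ### Vector algebra and classical differential operators -/

/-- The product `a · b̄`, linear in `a` and conjugate linear in `b`. -/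
def dotc (a b : C3) : ℂ := ∑ i, a i * starRingEnd ℂ (b i)

/-- The cross product `a × n` of a complex vector with a real vector. -/
def crossReal (a : C3) (n : E3) : C3 :=
  !₂[a 1 * (n 2 : ℂ) - a 2 * (n 1 : ℂ),
     a 2 * (n 0 : ℂ) - a 0 * (n 2 : ℂ),
     a 0 * (n 1 : ℂ) - a 1 * (n 0 : ℂ)]

/-- The product of a `3 × 3` matrix with a vector. -/
def matVec (A : Matrix (Fin 3) (Fin 3) ℂ) (a : C3) : C3 :=
  WithLp.toLp 2 (fun i => ∑ j, A i j * a j)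

/-- Infinitely differentiable functions. -/
def IsSmooth {n : ℕ} {F : Type*} [NormedAddCommGroup F] [NormedSpace ℝ F]
    (f : EuclideanSpace ℝ (Fin n) → F) : Prop :=
  ContDiff ℝ ((⊤ : ℕ∞) : WithTop ℕ∞) f

/-- The `i`-th classical partial derivative. -/
def partialD {n : ℕ} {F : Type*} [NormedAddCommGroup F] [NormedSpace ℝ F]
    (i : Fin n) (f : EuclideanSpace ℝ (Fin n) → F) (x : EuclideanSpace ℝ (Fin n)) : F :=
  fderiv ℝ f x (EuclideanSpace.single i 1)

/-- The classical gradient of a complex valued function on space. -/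
def gradC (f : E3 → ℂ) (x : E3) : C3 :=
  WithLp.toLp 2 (fun i => partialD i f x)

/-- The classical curl of a complex vector field on space. -/
def curlC (φ : E3 → C3) (x : E3) : C3 :=
  !₂[partialD 1 φ x 2 - partialD 2 φ x 1,
     partialD 2 φ x 0 - partialD 0 φ x 2,
     partialD 0 φ x 1 - partialD 1 φ x 0]

/-! ### The domain, its boundary measure and its outer unit normal -/

/-- An open set `S` of the plane has a Lipschitz boundary: near every boundary point, in suitable
orthonormal coordinates `(s, t)`, it is the set above the graph of a Lipschitz function. -/
def HasLipschitzBoundary (S : Set E2) : Prop :=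
  ∀ p ∈ frontier S, ∃ (e n : E2) (f : ℝ → ℝ) (K : ℝ≥0) (r h : ℝ),
    Orthonormal ℝ ![e, n] ∧ LipschitzWith K f ∧ 0 < r ∧ 0 < h ∧
      ∀ s t : ℝ, |s| < r → |t| < h → (p + s • e + t • n ∈ S ↔ f s < t)

/-- The cylinder `S × (-L, L)`. -/
def layerDomain (S : Set E2) (L : ℝ) : Set E3 :=
  {x | (!₂[x 0, x 1] : E2) ∈ S ∧ x 2 ∈ Set.Ioo (-L) L}

/-- The surface measure on the boundary of `Ω`. -/
def surfaceMeasure (Ω : Set E3) : Measure E3 :=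
  (μHE[2] : Measure E3).restrict (frontier Ω)

/-- `n` is the outer unit normal of `Ω` at the point `x`: asymptotically at `x`, the set `Ω`
coincides with the half space `⟨y - x, n⟩ < 0`. Such an `n` is unique for `x` in the boundary. -/
def IsOuterNormalAt (Ω : Set E3) (x n : E3) : Prop :=
  ‖n‖ = 1 ∧ ∀ δ : ℝ, 0 < δ → ∀ᶠ y in 𝓝 x,
    (inner ℝ (y - x) n < -(δ * ‖y - x‖) → y ∈ Ω) ∧
    (δ * ‖y - x‖ < inner ℝ (y - x) n → y ∉ Ω)

open Classical in
/-- The outer unit normal field `ν` (zero where there is no normal). -/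
def outerNormal (Ω : Set E3) (x : E3) : E3 :=
  if h : ∃ n, IsOuterNormalAt Ω x n then h.choose else 0

/-! ### `H(curl; Ω)`, tangential traces and the space `X⁰` -/

/-- The space `L²(Ω; ℂ³)`. -/
abbrev L2Field (Ω : Set E3) : Type := Lp C3 2 (volume.restrict Ω)

/-- The space `L²(∂Ω; ℂ³)`. -/
abbrev L2Boundary (Ω : Set E3) : Type := Lp C3 2 (surfaceMeasure Ω)

/-- `w` is the curl of `u` in the sense of distributions in `Ω`. -/
def IsWeakCurl (Ω : Set E3) (u w : L2Field Ω) : Prop :=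
  ∀ φ : E3 → C3, IsSmooth φ → HasCompactSupport φ → tsupport φ ⊆ Ω →
    ∫ x in Ω, dotc (w x) (φ x) = ∫ x in Ω, dotc (u x) (curlC φ x)

/-- The space `H(curl; Ω)`. -/
def Hcurl (Ω : Set E3) : Set (L2Field Ω) := {u | ∃ w, IsWeakCurl Ω u w}

open Classical in
/-- The weak curl of a field in `H(curl; Ω)` (zero for other fields). -/
def weakCurl (Ω : Set E3) (u : L2Field Ω) : L2Field Ω :=
  if h : ∃ w, IsWeakCurl Ω u w then h.choose else 0

/-- The square integrable field `t` on `∂Ω` is the tangential trace `u_T = (ν × u) × ν` of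
`u ∈ H(curl; Ω)`: it is tangential, and it satisfies Green's formula
`∫_Ω (∇ × u) · φ̄ - u · (∇ × φ̄) = ∫_∂Ω u_T · (φ̄ × ν)` for all smooth `φ`. -/
def IsTangentialTrace (Ω : Set E3) (u : L2Field Ω) (t : L2Boundary Ω) : Prop :=
  (∀ᵐ x ∂(surfaceMeasure Ω), ∑ i, t x i * (outerNormal Ω x i : ℂ) = 0) ∧
  ∀ φ : E3 → C3, IsSmooth φ → HasCompactSupport φ →
    ∫ x in Ω, (dotc (weakCurl Ω u x) (φ x) - dotc (u x) (curlC φ x)) =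
      ∫ x, dotc (t x) (crossReal (φ x) (outerNormal Ω x)) ∂(surfaceMeasure Ω)

open Classical in
/-- The tangential trace `u_T` as an element of `L²(∂Ω; ℂ³)` (zero if there is none). -/
def tangentialTrace (Ω : Set E3) (u : L2Field Ω) : L2Boundary Ω :=
  if h : ∃ t, IsTangentialTrace Ω u t then h.choose else 0

/-- The space `X⁰ = {u ∈ H(curl; Ω) ; u_T ∈ L²(∂Ω; ℂ³)}`. -/
def X0 (Ω : Set E3) : Set (L2Field Ω) :=
  {u | u ∈ Hcurl Ω ∧ ∃ t, IsTangentialTrace Ω u t}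

/-- The sesquilinear form of the homogenized problem, for the permittivity matrix `εeff`. -/
def a0 (Ω : Set E3) (ω mu lam : ℝ) (εeff : E3 → Matrix (Fin 3) (Fin 3) ℂ)
    (u v : L2Field Ω) : ℂ :=
  (∫ x in Ω, (1 / (mu : ℂ)) * dotc (weakCurl Ω u x) (weakCurl Ω v x))
    - (∫ x in Ω, (ω : ℂ) ^ 2 * dotc (matVec (εeff x) (u x)) (v x))
    - ∫ x, Complex.I * ω * lam * dotc (tangentialTrace Ω u x) (tangentialTrace Ω v x)
        ∂(surfaceMeasure Ω)

/-! ### Periodic functions and the function space of the cell problem -/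

/-- Periodicity with period `1` in every coordinate. -/
def IsPeriodic {n : ℕ} {F : Type*} (f : EuclideanSpace ℝ (Fin n) → F) : Prop :=
  ∀ (i : Fin n) (y : EuclideanSpace ℝ (Fin n)), f (y + EuclideanSpace.single i 1) = f y

/-- The closed unit cube `[0, 1]ⁿ`; for `n = 3` this is the cell `Y`, and for `n = 2` it
parametrizes the sheet `Σ₀ = {y ∈ Y ; y₃ = 0}`. -/
def unitCube (n : ℕ) : Set (EuclideanSpace ℝ (Fin n)) := {y | ∀ i, y i ∈ Set.Icc (0 : ℝ) 1}

/-- The Lebesgue measure on the unit cube. -/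
def cubeMeasure (n : ℕ) : Measure (EuclideanSpace ℝ (Fin n)) := volume.restrict (unitCube n)

/-- The point `(y', 0)` of the sheet. -/
def onSheet (y : E2) : E3 := !₂[y 0, y 1, 0]

/-- The smooth periodic functions `φ k` converge to `u` in `H¹(Y)`, where `G` is the limit of their
gradients. -/
def ConvergesInH1 (φ : ℕ → E3 → ℂ) (u : Lp ℂ 2 (cubeMeasure 3)) (G : Lp C3 2 (cubeMeasure 3)) :
    Prop :=
  (∀ k, IsSmooth (φ k) ∧ IsPeriodic (φ k)) ∧
  Tendsto (fun k => eLpNorm (fun y => φ k y - u y) 2 (cubeMeasure 3)) atTop (𝓝 0) ∧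
  Tendsto (fun k => eLpNorm (fun y => gradC (φ k) y - G y) 2 (cubeMeasure 3)) atTop (𝓝 0)

/-- `u ∈ H¹_#(Y)` (the closure of the smooth periodic functions in `H¹(Y)`) has the gradient `G`
and its trace on the sheet is `τ`. -/
def HasGradientAndTrace (u : Lp ℂ 2 (cubeMeasure 3)) (G : Lp C3 2 (cubeMeasure 3))
    (τ : Lp ℂ 2 (cubeMeasure 2)) : Prop :=
  ∃ φ : ℕ → E3 → ℂ, ConvergesInH1 φ u G ∧
    Tendsto (fun k => eLpNorm (fun y => φ k (onSheet y) - τ y) 2 (cubeMeasure 2)) atTop (𝓝 0)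

/-- `t` is the weak gradient on the (periodic) sheet of the function `τ`. -/
def IsSheetGradient (τ : Lp ℂ 2 (cubeMeasure 2)) (t : Lp C2 2 (cubeMeasure 2)) : Prop :=
  ∀ ψ : E2 → ℂ, IsSmooth ψ → IsPeriodic ψ → ∀ i : Fin 2,
    ∫ y, τ y * partialD i ψ y ∂(cubeMeasure 2) = -∫ y, t y i * ψ y ∂(cubeMeasure 2)

/-- The elements of `H = {u ∈ H¹_#(Y; ℂ) ; (∇u)_T ∈ L²(Σ₀)}`. The last three functions are
determined by the first one. -/
structure CellFunction where
  /-- the function itself -/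
  val : Lp ℂ 2 (cubeMeasure 3)
  /-- its gradient -/
  grad : Lp C3 2 (cubeMeasure 3)
  /-- its trace on the sheet -/
  trace : Lp ℂ 2 (cubeMeasure 2)
  /-- the tangential part of its gradient on the sheet -/
  tgrad : Lp C2 2 (cubeMeasure 2)
  hasGradientAndTrace : HasGradientAndTrace val grad trace
  isSheetGradient : IsSheetGradient trace tgrad

/-- The unit vector `e_j`. -/
def unitVec (j : Fin 3) : C3 := EuclideanSpace.single j 1

/-- The tangential projection `P_T = diag(1, 1, 0)`. -/
def projT (a : C3) : C3 := !₂[a 0, a 1, 0]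

/-- A tangential vector of the sheet as a vector in space. -/
def tangVec (a : C2) : C3 := !₂[a 0, a 1, 0]

/-- The field `e_j + ∇χ` in the cell. -/
def cellField (j : Fin 3) (χ : CellFunction) (y : E3) : C3 := unitVec j + χ.grad y

/-- The field `(e_j + ∇χ)_T` on the sheet. -/
def sheetField (j : Fin 3) (χ : CellFunction) (y : E2) : C3 :=
  projT (unitVec j) + tangVec (χ.tgrad y)

/-- `χ` is a weak solution of the `j`-th cell problem, with permittivity `ε` on the cell and surface
conductivity `σ` on the sheet. -/
def IsCorrector (ω : ℝ) (ε : E3 → ℂ) (σ : E2 → ℂ) (j : Fin 3) (χ : CellFunction) : Prop :=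
  ∀ v : CellFunction,
    ∫ y, Complex.I * ω * ε y * dotc (cellField j χ y) (v.grad y) ∂(cubeMeasure 3) =
      ∫ y, σ y * dotc (sheetField j χ y) (tangVec (v.tgrad y)) ∂(cubeMeasure 2)

/-- The `j`-th column of the effective permittivity, computed from the `j`-th corrector. -/
def effectiveColumn (ω : ℝ) (ε : E3 → ℂ) (σ : E2 → ℂ) (j : Fin 3) (χ : CellFunction)
    (i : Fin 3) : ℂ :=
  (∫ y, ε y * cellField j χ y i ∂(cubeMeasure 3))
    - (1 / (Complex.I * ω)) * ∫ y, σ y * sheetField j χ y i ∂(cubeMeasure 2)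

/-- The matrix field `εeff` is the effective permittivity in `Ω`: at almost every `x ∈ Ω`, its
columns are given by correctors that solve the cell problems at `x`. -/
def IsEffectivePermittivity (Ω : Set E3) (ω : ℝ) (ε : E3 → E3 → ℂ) (σ : E3 → E2 → ℂ)
    (εeff : E3 → Matrix (Fin 3) (Fin 3) ℂ) : Prop :=
  ∀ᵐ x ∂(volume.restrict Ω), ∀ j : Fin 3, ∃ χ : CellFunction,
    IsCorrector ω (ε x) (σ x) j χ ∧ ∀ i, εeff x i j = effectiveColumn ω (ε x) (σ x) j χ i

end PlasmonicMaxwell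

end

open PlasmonicMaxwell

namespace PlasmonicMaxwell

/-! ### Coercive variational problems in Hilbert spaces -/

section Variational

variable {H : Type*} [NormedAddCommGroup H] [InnerProductSpace ℂ H]

/-! Both the cell problem and the homogenized problem are coercive after multiplication by a
suitable complex number, so the Lax-Milgram argument on a closed subspace of an `L²` product settles
each; no compactness is needed.

Cell problem: brought to one side, it has the multipliers `-iωε` in the cell and `σ` on the sheet,
with real parts `ω Im ε ≥ ωc` and `Re σ ≥ c`. This is coercive on pairs (gradient, tangential
gradient). The pairs that come from cell functions form a closed space (`isClosed_cellGradients`),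
because Poincaré and trace inequalities control a function of mean zero and its trace by the
gradient. The solution is the limit of a contraction iteration whose iterates are measurable in `x`,
hence measurable itself (`exists_measurable_variational_solution`).

Lower bound: for `ξ`, let `p` be the gradient pair of `∑ ξ_j χ_j` and `B` the cell operator. Then
`ε^eff ξ · ξ̄ = (i/ω)⟪ξ, B(p + ξ)⟫`, and the cell problem allows `ξ` on the left to be replaced by
`p + ξ`. The imaginary part is therefore at least `c‖∇χ_ξ + ξ‖²`, with `∇χ_ξ` the cell component of
`p`; periodic gradients are orthogonal to constants, so this is at least `c|ξ|²`
(`effective_coercive`).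

Maxwell problem: `X⁰` is identified with a closed space of triples `(u, curl u, u_T)`
(`exists_maxwellSpace`). Multiplying `a⁰` by `δ + i` with small `δ > 0` makes its real part control
all three components: `i` turns the absorption in `ε^eff` and the impedance term positive, and `δ`
recovers the curl (`existsUnique_maxwell`). The curl and the trace are single valued by density of
test fields and because the boundary of the cylinder has finite area and a measurable unit normal
almost everywhere, which follows from Lipschitz charts and Rademacher's theorem on the line. -/

/-- The fixed point iteration for `⟪v, B u⟫ = ⟪v, f⟫`, `v ∈ V`. -/
noncomputable def variationalStep (V : Submodule ℂ H) [V.HasOrthogonalProjection] (B : H →L[ℂ] H)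
    (f : H) (ρ : ℝ) (u : H) : H :=
  V.starProjection (u - (ρ : ℂ) • (B u - f))

/-- Expanding the square with step `ρ` gives the factor `1 - 2ρα + ρ²M²`, and `ρ = α / M²` minimises
it. -/
theorem norm_sub_smul_sq_le (B : H →L[ℂ] H) {α M : ℝ} (hα : 0 < α) (hM : 0 < M)
    (hcoer : ∀ u, α * ‖u‖ ^ 2 ≤ (inner ℂ u (B u)).re) (hbd : ∀ u, ‖B u‖ ≤ M * ‖u‖) (u : H) :
    ‖u - ((α / M ^ 2 : ℝ) : ℂ) • B u‖ ^ 2 ≤ (1 - α ^ 2 / M ^ 2) * ‖u‖ ^ 2 := by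
  have h := norm_sub_sq (𝕜 := ℂ) u (((α / M ^ 2 : ℝ) : ℂ) • B u)
  rw [h, inner_smul_right, norm_smul]
  have h1 := hcoer u
  have h2 : ‖B u‖ ^ 2 ≤ M ^ 2 * ‖u‖ ^ 2 := by
    rw [← mul_pow]; exact pow_le_pow_left₀ (norm_nonneg _) (hbd u) 2
  have h3 : (0 : ℝ) < α / M ^ 2 := by positivity
  have h4 : RCLike.re (((α / M ^ 2 : ℝ) : ℂ) * inner ℂ u (B u)) =
      α / M ^ 2 * (inner ℂ u (B u)).re := Complex.re_ofReal_mul _ _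
  rw [h4, Complex.norm_real, Real.norm_of_nonneg h3.le, mul_pow]
  have h5 : α / M ^ 2 * (α * ‖u‖ ^ 2) ≤ α / M ^ 2 * (inner ℂ u (B u)).re :=
    mul_le_mul_of_nonneg_left h1 h3.le
  have h6 : (α / M ^ 2) ^ 2 * ‖B u‖ ^ 2 ≤ (α / M ^ 2) ^ 2 * (M ^ 2 * ‖u‖ ^ 2) :=
    mul_le_mul_of_nonneg_left h2 (by positivity)
  have h7 : (α / M ^ 2) ^ 2 * (M ^ 2 * ‖u‖ ^ 2) = α ^ 2 / M ^ 2 * ‖u‖ ^ 2 := by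
    field_simp
  have h8 : α / M ^ 2 * (α * ‖u‖ ^ 2) = α ^ 2 / M ^ 2 * ‖u‖ ^ 2 := by
    field_simp
  nlinarith

/-- The datum `f` only translates and the projection does not increase distances, so the factor of
`1 - ρB` survives. It depends on `α` and `M` alone, so one constant serves a whole family of
problems. -/
theorem exists_contracting_variationalStep {α M : ℝ} (hα : 0 < α) (hM : 0 < M) (hαM : α ≤ M) :
    ∃ k : ℝ≥0, ∀ (V : Submodule ℂ H) [V.HasOrthogonalProjection] (B : H →L[ℂ] H) (f : H),
      (∀ u, α * ‖u‖ ^ 2 ≤ (inner ℂ u (B u)).re) → (∀ u, ‖B u‖ ≤ M * ‖u‖) →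
      ContractingWith k (variationalStep V B f (α / M ^ 2)) := by
  have hk0 : 0 ≤ 1 - α ^ 2 / M ^ 2 := by
    rw [sub_nonneg, div_le_one (by positivity)]
    exact pow_le_pow_left₀ hα.le hαM 2
  refine ⟨(Real.sqrt (1 - α ^ 2 / M ^ 2)).toNNReal, fun V _ B f h1 h2 => ⟨?_, ?_⟩⟩
  · rw [Real.toNNReal_lt_one, Real.sqrt_lt' one_pos]
    have : 0 < α ^ 2 / M ^ 2 := by positivity
    linarith
  · refine LipschitzWith.of_dist_le_mul fun u v => ?_
    rw [Real.coe_toNNReal _ (Real.sqrt_nonneg _), dist_eq_norm, dist_eq_norm, variationalStep,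
      variationalStep, ← map_sub]
    refine (V.norm_starProjection_apply_le _).trans ?_
    have h3 : u - ((α / M ^ 2 : ℝ) : ℂ) • (B u - f) - (v - ((α / M ^ 2 : ℝ) : ℂ) • (B v - f)) =
        (u - v) - ((α / M ^ 2 : ℝ) : ℂ) • B (u - v) := by
      rw [map_sub]; module
    rw [h3]
    refine (Real.le_sqrt (norm_nonneg _) (by positivity)).2
      (norm_sub_smul_sq_le B hα hM h1 h2 (u - v)) |>.trans ?_
    rw [Real.sqrt_mul hk0, Real.sqrt_sq (norm_nonneg _)]

/-- A fixed point lies in the range of the projection, so the step reduces to saying that the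
projection of the residual `B u - f` vanishes. -/
theorem isFixedPt_variationalStep (V : Submodule ℂ H) [V.HasOrthogonalProjection] (B : H →L[ℂ] H)
    (f : H) {ρ : ℝ} (hρ : ρ ≠ 0) {u : H} (hu : variationalStep V B f ρ u = u) :
    u ∈ V ∧ ∀ v ∈ V, inner ℂ v (B u) = inner ℂ v f := by
  have huV : u ∈ V := by
    rw [← hu]; exact V.starProjection_apply_mem _
  refine ⟨huV, fun v hv => ?_⟩
  rw [variationalStep, map_sub, V.starProjection_eq_self_iff.2 huV, sub_eq_self, map_smul,
    smul_eq_zero] at hu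
  have h0 : V.starProjection (B u - f) = 0 := hu.resolve_left (by exact_mod_cast hρ)
  rw [← sub_eq_zero, ← inner_sub_right, ← V.starProjection_eq_self_iff.2 hv,
    V.inner_starProjection_left_eq_right, h0, inner_zero_right]

theorem variational_solution_unique {V : Submodule ℂ H}
    {B : H →L[ℂ] H} {α : ℝ} (hα : 0 < α)
    (hcoer : ∀ u, α * ‖u‖ ^ 2 ≤ (inner ℂ u (B u)).re) {f u u' : H}
    (hu : u ∈ V) (hu' : u' ∈ V) (h : ∀ v ∈ V, inner ℂ v (B u) = inner ℂ v f)
    (h' : ∀ v ∈ V, inner ℂ v (B u') = inner ℂ v f) : u = u' := by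
  have h1 : inner ℂ (u - u') (B (u - u')) = 0 := by
    rw [map_sub, inner_sub_right, h _ (V.sub_mem hu hu'), h' _ (V.sub_mem hu hu'), sub_self]
  have h2 := hcoer (u - u')
  rw [h1, Complex.zero_re] at h2
  have h3 : ‖u - u'‖ ^ 2 ≤ 0 := by nlinarith [sq_nonneg ‖u - u'‖]
  have h4 : ‖u - u'‖ = 0 := by nlinarith [norm_nonneg (u - u')]
  exact sub_eq_zero.1 (norm_eq_zero.1 h4)

theorem norm_variational_solution_le {V : Submodule ℂ H}
    {B : H →L[ℂ] H} {α : ℝ} (hα : 0 < α)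
    (hcoer : ∀ u, α * ‖u‖ ^ 2 ≤ (inner ℂ u (B u)).re) {f u : H}
    (hu : u ∈ V) (h : ∀ v ∈ V, inner ℂ v (B u) = inner ℂ v f) : ‖u‖ ≤ ‖f‖ / α := by
  have h1 := hcoer u
  rw [h u hu] at h1
  have h2 : (inner ℂ u f).re ≤ ‖u‖ * ‖f‖ :=
    (Complex.re_le_norm _).trans (norm_inner_le_norm u f)
  rw [le_div_iff₀ hα]
  rcases (norm_nonneg u).eq_or_lt with h0 | h0
  · rw [← h0, zero_mul]; exact norm_nonneg _
  · nlinarith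

/-- Orthonormal vectors are more than `1` apart, so balls of radius `1/2` around them are disjoint
open sets. -/
theorem _root_.Orthonormal.countable_of_separable [TopologicalSpace.SeparableSpace H] {ι : Type*}
    {b : ι → H} (hb : Orthonormal ℂ b) : Countable ι := by
  have hdist : ∀ i j, i ≠ j → 1 ≤ dist (b i) (b j) := by
    intro i j hij
    have h := norm_sub_sq (𝕜 := ℂ) (b i) (b j)
    rw [hb.2 hij, hb.1 i, hb.1 j] at h
    simp only [map_zero, mul_zero, sub_zero, one_pow] at h
    rw [dist_eq_norm]
    nlinarith [norm_nonneg (b i - b j)]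
  have hd : (Set.univ : Set ι).PairwiseDisjoint fun i => Metric.ball (b i) (1 / 2) := by
    intro i _ j _ hij
    refine Metric.ball_disjoint_ball ?_
    have := hdist i j hij
    linarith
  exact Set.countable_univ_iff.1 (hd.countable_of_isOpen (fun i _ => Metric.isOpen_ball)
    (fun i _ => ⟨b i, Metric.mem_ball_self (by norm_num)⟩))

variable [CompleteSpace H]

/-- The Lax-Milgram theorem on a closed subspace. -/
theorem exists_variational_solution (V : Submodule ℂ H) [V.HasOrthogonalProjection]
    (B : H →L[ℂ] H) {α : ℝ} (hα : 0 < α)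
    (hcoer : ∀ u, α * ‖u‖ ^ 2 ≤ (inner ℂ u (B u)).re) (f : H) :
    ∃ u ∈ V, ∀ v ∈ V, inner ℂ v (B u) = inner ℂ v f := by
  obtain ⟨k, hk⟩ := exists_contracting_variationalStep (H := H) hα
    (lt_of_lt_of_le hα (le_max_left α ‖B‖)) (le_max_left α ‖B‖)
  have hc := hk V B f hcoer fun u => (B.le_opNorm u).trans
    (mul_le_mul_of_nonneg_right (le_max_right _ _) (norm_nonneg _))
  have hpos : 0 < max α ‖B‖ := lt_of_lt_of_le hα (le_max_left α ‖B‖)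
  obtain ⟨h1, h2⟩ := isFixedPt_variationalStep V B f (by positivity) hc.fixedPoint_isFixedPt
  exact ⟨_, h1, h2⟩

/-! ### Measurable dependence on a parameter -/

/-- Weakly measurable functions with values in a separable Hilbert space are measurable. -/
theorem stronglyMeasurable_of_inner [TopologicalSpace.SeparableSpace H] {X : Type*}
    [MeasurableSpace X] {u : X → H} (h : ∀ p, Measurable fun x => inner ℂ p (u x)) :
    StronglyMeasurable u := by
  obtain ⟨w, b, -⟩ := exists_hilbertBasis ℂ H
  have : Countable w := b.orthonormal.countable_of_separable
  -- Finite partial sums of the Hilbert basis expansion are measurable; countability of `w` makes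
  -- `atTop` on `Finset w` countably generated.
  refine stronglyMeasurable_of_tendsto (u := (atTop : Filter (Finset w)))
    (f := fun s x => ∑ i ∈ s, inner ℂ (b i) (u x) • b i) (fun s => ?_) ?_
  · exact Finset.stronglyMeasurable_fun_sum s fun i _ =>
      (h (b i)).stronglyMeasurable.smul_const _
  · rw [tendsto_pi_nhds]
    intro x
    have := b.hasSum_repr (u x)
    simp_rw [b.repr_apply_apply] at this
    exact this

/-- The operators are only weakly measurable. Passing to the adjoint writes `⟪p, B x (u x)⟫` as the
inner product of two strongly measurable vectors. -/
theorem stronglyMeasurable_clm_apply [TopologicalSpace.SeparableSpace H] {X : Type*}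
    [MeasurableSpace X] {B : X → H →L[ℂ] H} (hB : ∀ p q, Measurable fun x => inner ℂ p (B x q))
    {u : X → H} (hu : StronglyMeasurable u) : StronglyMeasurable fun x => B x (u x) := by
  refine stronglyMeasurable_of_inner fun p => ?_
  have h1 : StronglyMeasurable fun x => (B x).adjoint p := by
    refine stronglyMeasurable_of_inner fun q => ?_
    simp_rw [ContinuousLinearMap.adjoint_inner_right]
    have h2 := Complex.continuous_conj.measurable.comp (hB p q)
    convert h2 using 2 with x
    exact (inner_conj_symm _ _).symm
  have h3 := (h1.inner (𝕜 := ℂ) hu).measurable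
  simp_rw [ContinuousLinearMap.adjoint_inner_left] at h3
  exact h3

/-- The solution of a coercive variational problem depends measurably on parameters. -/
theorem exists_measurable_variational_solution [TopologicalSpace.SeparableSpace H]
    {X : Type*} [MeasurableSpace X] (V : Submodule ℂ H) [V.HasOrthogonalProjection]
    {B : X → H →L[ℂ] H} (hB : ∀ p q, Measurable fun x => inner ℂ p (B x q))
    {f : X → H} (hf : StronglyMeasurable f) {α M : ℝ} (hα : 0 < α) (hαM : α ≤ M)
    (hcoer : ∀ x u, α * ‖u‖ ^ 2 ≤ (inner ℂ u (B x u)).re) (hbd : ∀ x u, ‖B x u‖ ≤ M * ‖u‖) :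
    ∃ u : X → H, StronglyMeasurable u ∧ ∀ x, u x ∈ V ∧
      ∀ v ∈ V, inner ℂ v (B x (u x)) = inner ℂ v (f x) := by
  have hM : 0 < M := hα.trans_le hαM
  obtain ⟨k, hk⟩ := exists_contracting_variationalStep (H := H) hα hM hαM
  have hc := fun x => hk V (B x) (f x) (hcoer x) (hbd x)
  refine ⟨fun x => (hc x).fixedPoint, ?_, fun x => isFixedPt_variationalStep V (B x) (f x)
    (by positivity) (hc x).fixedPoint_isFixedPt⟩
  -- All iterations start at `0`; each iterate is measurable in `x` by induction, and convergence is
  -- needed only pointwise in `x`.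
  refine stronglyMeasurable_of_tendsto (u := (atTop : Filter ℕ))
    (f := fun n x => (variationalStep V (B x) (f x) (α / M ^ 2))^[n] 0) (fun n => ?_) ?_
  · induction n with
    | zero => exact stronglyMeasurable_const
    | succ n ih =>
      simp_rw [Function.iterate_succ_apply']
      exact V.starProjection.continuous.comp_stronglyMeasurable
        (ih.sub (((stronglyMeasurable_clm_apply hB ih).sub hf).const_smul _))
  · rw [tendsto_pi_nhds]
    exact fun x => (hc x).tendsto_iterate_fixedPoint 0

end Variational

/-! ### Pointwise operators on `L²` and diagonal operators on products -/

theorem dotc_eq_inner (a b : C3) : dotc a b = inner ℂ b a := by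
  simp [dotc, PiLp.inner_apply]

section Pointwise

variable {X : Type*} [MeasurableSpace X] {μ : Measure X}
  {E : Type*} [NormedAddCommGroup E] [InnerProductSpace ℂ E]

theorem memLp_pointwise {T : X → E →L[ℂ] E} (hT : AEStronglyMeasurable T μ) {M : ℝ}
    (hM : ∀ᵐ x ∂μ, ‖T x‖ ≤ M) (u : Lp E 2 μ) : MemLp (fun x => T x (u x)) 2 μ := by
  refine MemLp.of_le_mul (g := u) (c := M) (Lp.memLp u)
    ((ContinuousLinearMap.id ℂ (E →L[ℂ] E)).aestronglyMeasurable_comp₂ hT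
      (Lp.aestronglyMeasurable u)) ?_
  filter_upwards [hM] with x hx
  exact (T x).le_of_opNorm_le hx _

/-- The operator `u ↦ (x ↦ T x (u x))` on `L²`. -/
noncomputable def pointwiseLp (T : X → E →L[ℂ] E) (hT : AEStronglyMeasurable T μ) (M : ℝ)
    (hM : ∀ᵐ x ∂μ, ‖T x‖ ≤ M) : Lp E 2 μ →L[ℂ] Lp E 2 μ :=
  LinearMap.mkContinuous
    { toFun := fun u => (memLp_pointwise hT hM u).toLp
      map_add' := fun u v => by
        rw [← MemLp.toLp_add]
        refine MemLp.toLp_congr _ _ ?_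
        filter_upwards [Lp.coeFn_add u v] with x hx
        rw [hx, Pi.add_apply, map_add]
        rfl
      map_smul' := fun a u => by
        rw [RingHom.id_apply, ← MemLp.toLp_const_smul]
        refine MemLp.toLp_congr _ _ ?_
        filter_upwards [Lp.coeFn_smul a u] with x hx
        rw [hx, Pi.smul_apply, map_smul]
        rfl } M fun u => by
      refine Lp.norm_le_mul_norm_of_ae_le_mul ?_
      filter_upwards [hM, (memLp_pointwise hT hM u).coeFn_toLp] with x hx h
      refine (congrArg norm h).trans_le ?_
      exact (T x).le_of_opNorm_le hx _

theorem coeFn_pointwiseLp (T : X → E →L[ℂ] E) (hT : AEStronglyMeasurable T μ) (M : ℝ)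
    (hM : ∀ᵐ x ∂μ, ‖T x‖ ≤ M) (u : Lp E 2 μ) :
    pointwiseLp T hT M hM u =ᵐ[μ] fun x => T x (u x) :=
  (memLp_pointwise hT hM u).coeFn_toLp

theorem inner_pointwiseLp (T : X → E →L[ℂ] E) (hT : AEStronglyMeasurable T μ) (M : ℝ)
    (hM : ∀ᵐ x ∂μ, ‖T x‖ ≤ M) (u v : Lp E 2 μ) :
    inner ℂ v (pointwiseLp T hT M hM u) = ∫ x, inner ℂ (v x) (T x (u x)) ∂μ := by
  rw [L2.inner_def]
  refine integral_congr_ae ?_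
  filter_upwards [coeFn_pointwiseLp T hT M hM u] with x hx
  rw [hx]

theorem norm_pointwiseLp_le (T : X → E →L[ℂ] E) (hT : AEStronglyMeasurable T μ) (M : ℝ)
    (hM : ∀ᵐ x ∂μ, ‖T x‖ ≤ M) (u : Lp E 2 μ) : ‖pointwiseLp T hT M hM u‖ ≤ M * ‖u‖ := by
  refine Lp.norm_le_mul_norm_of_ae_le_mul ?_
  filter_upwards [hM, coeFn_pointwiseLp T hT M hM u] with x hx h
  rw [h]
  exact (T x).le_of_opNorm_le hx _

theorem pointwiseLp_coercive (T : X → E →L[ℂ] E) (hT : AEStronglyMeasurable T μ) (M : ℝ)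
    (hM : ∀ᵐ x ∂μ, ‖T x‖ ≤ M) {α : ℝ}
    (hα : ∀ᵐ x ∂μ, ∀ ξ, α * ‖ξ‖ ^ 2 ≤ (inner ℂ ξ (T x ξ)).re) (u : Lp E 2 μ) :
    α * ‖u‖ ^ 2 ≤ (inner ℂ u (pointwiseLp T hT M hM u)).re := by
  have h1 : ‖u‖ ^ 2 = ∫ x, ‖u x‖ ^ 2 ∂μ := by
    rw [← inner_self_eq_norm_sq (𝕜 := ℂ), L2.inner_def]
    refine (integral_re (L2.integrable_inner u u)).symm.trans ?_
    refine integral_congr_ae (Eventually.of_forall fun x => ?_)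
    exact inner_self_eq_norm_sq (𝕜 := ℂ) _
  have hint : Integrable (fun x => inner ℂ (u x) (T x (u x))) μ := by
    refine (L2.integrable_inner (𝕜 := ℂ) u (pointwiseLp T hT M hM u)).congr ?_
    filter_upwards [coeFn_pointwiseLp T hT M hM u] with x hx
    rw [hx]
  rw [inner_pointwiseLp, h1, ← integral_const_mul]
  refine le_of_le_of_eq ?_ (integral_re (𝕜 := ℂ) hint)
  refine integral_mono_ae ?_ hint.re ?_
  · exact (Lp.memLp u).integrable_norm_pow (by norm_num) |>.const_mul _
  · filter_upwards [hα] with x hx using hx _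

end Pointwise

section Diagonal

variable {A B : Type*} [NormedAddCommGroup A] [InnerProductSpace ℂ A]
  [NormedAddCommGroup B] [InnerProductSpace ℂ B]

/-- The operator `(a, b) ↦ (S a, T b)` on the Hilbert sum of two spaces. -/
noncomputable def diagL2 (S : A →L[ℂ] A) (T : B →L[ℂ] B) :
    WithLp 2 (A × B) →L[ℂ] WithLp 2 (A × B) :=
  ((WithLp.prodContinuousLinearEquiv 2 ℂ A B).symm : A × B →L[ℂ] WithLp 2 (A × B)) ∘L
    (S.prodMap T) ∘L (WithLp.prodContinuousLinearEquiv 2 ℂ A B : WithLp 2 (A × B) →L[ℂ] A × B)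

theorem inner_diagL2 (S : A →L[ℂ] A) (T : B →L[ℂ] B) (p q : WithLp 2 (A × B)) :
    inner ℂ q (diagL2 S T p) = inner ℂ q.fst (S p.fst) + inner ℂ q.snd (T p.snd) := rfl

theorem diagL2_coercive {S : A →L[ℂ] A} {T : B →L[ℂ] B} {α β : ℝ}
    (hS : ∀ a, α * ‖a‖ ^ 2 ≤ (inner ℂ a (S a)).re)
    (hT : ∀ b, β * ‖b‖ ^ 2 ≤ (inner ℂ b (T b)).re) (p : WithLp 2 (A × B)) :
    min α β * ‖p‖ ^ 2 ≤ (inner ℂ p (diagL2 S T p)).re := by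
  rw [inner_diagL2, Complex.add_re, WithLp.prod_norm_sq_eq_of_L2, mul_add]
  refine add_le_add (le_trans ?_ (hS _)) (le_trans ?_ (hT _))
  · exact mul_le_mul_of_nonneg_right (min_le_left _ _) (sq_nonneg _)
  · exact mul_le_mul_of_nonneg_right (min_le_right _ _) (sq_nonneg _)

theorem norm_diagL2_le {S : A →L[ℂ] A} {T : B →L[ℂ] B} {M : ℝ} (hM : 0 ≤ M)
    (hS : ∀ a, ‖S a‖ ≤ M * ‖a‖) (hT : ∀ b, ‖T b‖ ≤ M * ‖b‖) (p : WithLp 2 (A × B)) :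
    ‖diagL2 S T p‖ ≤ M * ‖p‖ := by
  refine le_of_sq_le_sq ?_ (by positivity)
  rw [mul_pow, WithLp.prod_norm_sq_eq_of_L2, WithLp.prod_norm_sq_eq_of_L2, mul_add, ← mul_pow,
    ← mul_pow]
  exact add_le_add (pow_le_pow_left₀ (norm_nonneg _) (hS _) 2)
    (pow_le_pow_left₀ (norm_nonneg _) (hT _) 2)

end Diagonal

/-! ### Integrals over the unit cube -/

/-- The Lebesgue measure on `[0, 1]`. -/
noncomputable def unitI : Measure ℝ := volume.restrict (Set.Icc 0 1)

instance : IsProbabilityMeasure unitI := ⟨by simp [unitI]⟩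

theorem unitCube_eq_preimage (n : ℕ) : unitCube n =
    (WithLp.ofLp : EuclideanSpace ℝ (Fin n) → Fin n → ℝ) ⁻¹'
      (Set.univ.pi fun _ => Set.Icc (0 : ℝ) 1) := by
  ext y
  simp only [unitCube, Set.mem_ofPred_eq, Set.mem_preimage, Set.mem_univ_pi]

theorem isCompact_unitCube (n : ℕ) : IsCompact (unitCube n) := by
  rw [unitCube_eq_preimage]
  exact (EuclideanSpace.equiv (Fin n) ℝ).toHomeomorph.isCompact_preimage.2
    (isCompact_univ_pi fun _ => isCompact_Icc)

theorem measurableSet_unitCube (n : ℕ) : MeasurableSet (unitCube n) :=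
  (isCompact_unitCube n).isClosed.measurableSet

theorem measurePreserving_ofLp_cubeMeasure (n : ℕ) :
    MeasurePreserving (WithLp.ofLp : EuclideanSpace ℝ (Fin n) → Fin n → ℝ) (cubeMeasure n)
      (Measure.pi fun _ => unitI) := by
  have h := (PiLp.volume_preserving_ofLp (Fin n)).restrict_preimage
    (s := Set.univ.pi fun _ => Set.Icc (0 : ℝ) 1) (MeasurableSet.univ_pi fun _ => measurableSet_Icc)
  rw [volume_pi, Measure.restrict_pi_pi, ← unitCube_eq_preimage] at h
  exact h

instance isProbabilityMeasure_cubeMeasure (n : ℕ) : IsProbabilityMeasure (cubeMeasure n) := by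
  have h := measurePreserving_ofLp_cubeMeasure n
  refine ⟨?_⟩
  rw [← Set.preimage_univ (f := WithLp.ofLp), h.measure_preimage nullMeasurableSet_univ,
    measure_univ]

theorem lintegral_cubeMeasure (n : ℕ) {f : EuclideanSpace ℝ (Fin n) → ENNReal}
    (hf : Measurable f) :
    ∫⁻ y, f y ∂cubeMeasure n = ∫⁻ x : Fin n → ℝ, f (WithLp.toLp 2 x)
      ∂Measure.pi fun _ => unitI := by
  exact (measurePreserving_ofLp_cubeMeasure n).lintegral_comp
    (hf.comp (PiLp.volume_preserving_toLp (Fin n)).measurable)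

theorem lintegral_pi_succ {n : ℕ} {f : (Fin (n + 1) → ℝ) → ENNReal} (hf : Measurable f) :
    ∫⁻ x, f x ∂(Measure.pi fun _ => unitI) =
      ∫⁻ a, ∫⁻ x : Fin n → ℝ, f (Fin.cons a x) ∂(Measure.pi fun _ => unitI) ∂unitI := by
  have h := (measurePreserving_piFinSuccAbove (fun _ : Fin (n + 1) => unitI) 0).symm
  have hf' := hf.comp h.measurable
  rw [← h.lintegral_comp hf]
  refine (lintegral_prod _ hf'.aemeasurable).trans ?_
  simp [MeasurableEquiv.piFinSuccAbove, Fin.insertNthEquiv]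

theorem lintegral_pi_zero {f : (Fin 0 → ℝ) → ENNReal} (x : Fin 0 → ℝ) :
    ∫⁻ x, f x ∂(Measure.pi fun _ => unitI) = f x := by
  rw [Measure.pi_of_empty _ x, lintegral_dirac]

theorem measurable_vec3 : Measurable fun p : ℝ × ℝ × ℝ => (!₂[p.1, p.2.1, p.2.2] : E3) := by
  refine (PiLp.volume_preserving_toLp (Fin 3)).measurable.comp (measurable_pi_iff.2 fun i => ?_)
  fin_cases i <;> simp <;> fun_prop

theorem measurable_cons {n : ℕ} :
    Measurable fun p : ℝ × (Fin n → ℝ) => (Fin.cons p.1 p.2 : Fin (n + 1) → ℝ) := by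
  refine measurable_pi_iff.2 fun i => ?_
  refine Fin.cases ?_ (fun j => ?_) i
  · simpa using measurable_fst
  · simp only [Fin.cons_succ]; fun_prop

theorem lintegral_cube_three {f : E3 → ENNReal} (hf : Measurable f) :
    ∫⁻ y, f y ∂cubeMeasure 3 =
      ∫⁻ a, ∫⁻ b, ∫⁻ c, f !₂[a, b, c] ∂unitI ∂unitI ∂unitI := by
  have hf1 : Measurable fun x : Fin 3 → ℝ => f (WithLp.toLp 2 x) :=
    hf.comp (PiLp.volume_preserving_toLp (Fin 3)).measurable
  rw [lintegral_cubeMeasure 3 hf, lintegral_pi_succ hf1]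
  refine lintegral_congr fun a => ?_
  have hf2 := hf1.comp (measurable_cons.comp (measurable_prodMk_left (x := a)))
  refine (lintegral_pi_succ hf2).trans ?_
  refine lintegral_congr fun b => ?_
  have hf3 := hf2.comp (measurable_cons.comp (measurable_prodMk_left (x := b)))
  refine (lintegral_pi_succ hf3).trans ?_
  refine lintegral_congr fun c => ?_
  rw [lintegral_pi_zero ![]]
  rfl

theorem lintegral_cube_two {f : E2 → ENNReal} (hf : Measurable f) :
    ∫⁻ y, f y ∂cubeMeasure 2 = ∫⁻ a, ∫⁻ b, f !₂[a, b] ∂unitI ∂unitI := by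
  have hf1 : Measurable fun x : Fin 2 → ℝ => f (WithLp.toLp 2 x) :=
    hf.comp (PiLp.volume_preserving_toLp (Fin 2)).measurable
  rw [lintegral_cubeMeasure 2 hf, lintegral_pi_succ hf1]
  refine lintegral_congr fun a => ?_
  have hf2 := hf1.comp (measurable_cons.comp (measurable_prodMk_left (x := a)))
  refine (lintegral_pi_succ hf2).trans ?_
  refine lintegral_congr fun b => ?_
  rw [lintegral_pi_zero ![]]
  rfl

/-- The integral of a derivative of a periodic function over the unit cube vanishes. -/
theorem integral_partialD_eq_zero {n : ℕ} {φ : EuclideanSpace ℝ (Fin (n + 1)) → ℂ}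
    (hφ : IsSmooth φ) (hper : IsPeriodic φ) (i : Fin (n + 1)) :
    ∫ y, partialD i φ y ∂cubeMeasure (n + 1) = 0 := by
  have hcont : Continuous fun y => partialD i φ y :=
    (hφ.continuous_fderiv (by simp)).clm_apply continuous_const
  let T : (Fin (n + 1) → ℝ) →L[ℝ] EuclideanSpace ℝ (Fin (n + 1)) :=
    ((EuclideanSpace.equiv (Fin (n + 1)) ℝ).symm : (Fin (n + 1) → ℝ) →L[ℝ] _)
  have hT : ∀ x, T x = WithLp.toLp 2 x := fun x => rfl
  have hTi : ∀ j, T (Pi.single j 1) = EuclideanSpace.single j 1 := fun j => rfl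
  -- The divergence theorem for the field whose only nonzero component is `φ` in direction `i`.
  have key := integral_divergence_of_hasFDerivAt_off_countable' (0 : Fin (n + 1) → ℝ) 1
    (Pi.le_def.2 fun _ => zero_le_one)
    (fun j x => if j = i then φ (T x) else 0)
    (fun j x => if j = i then (fderiv ℝ φ (T x)).comp T else 0) ∅ Set.countable_empty
    (fun j => by
      by_cases h : j = i
      · simp only [h, if_true]
        exact (hφ.continuous.comp T.continuous).continuousOn
      · simp only [h, if_false]; exact continuousOn_const)
    (fun x _ j => by
      by_cases h : j = i
      · simp only [h, if_true]
        exact ((hφ.differentiable (by simp)).differentiableAt.hasFDerivAt).comp x T.hasFDerivAt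
      · simp only [h, if_false]; exact hasFDerivAt_const _ _)
  have hsum : ∀ x : Fin (n + 1) → ℝ, ∑ j, (if j = i then (fderiv ℝ φ (T x)).comp T else 0)
      (Pi.single j 1) = partialD i φ (T x) := by
    intro x
    rw [Finset.sum_eq_single i]
    · simp only [if_true]; rfl
    · intro j _ hj; simp [hj]
    · simp
  simp only [hsum] at key
  have hint : IntegrableOn (fun x => partialD i φ (T x)) (Set.Icc 0 1) :=
    (hcont.comp T.continuous).continuousOn.integrableOn_compact isCompact_Icc
  have key := key hint
  have h1 : ∫ y, partialD i φ y ∂cubeMeasure (n + 1) =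
      ∫ x in Set.Icc 0 1, partialD i φ (T x) := by
    have h2 : (volume.restrict (Set.Icc (0 : Fin (n + 1) → ℝ) 1)) =
        Measure.pi fun _ => unitI := by
      rw [← Set.pi_univ_Icc, volume_pi]
      exact Measure.restrict_pi_pi _ _
    rw [h2]
    exact ((measurePreserving_ofLp_cubeMeasure (n + 1)).integral_comp
      (MeasurableEquiv.toLp 2 (Fin (n + 1) → ℝ)).symm.measurableEmbedding
      (fun x => partialD i φ (T x)))
  rw [h1, key]
  -- The contributions of opposite faces cancel by periodicity.
  refine Finset.sum_eq_zero fun j _ => ?_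
  by_cases h : j = i
  · subst h
    simp only [if_true]
    rw [sub_eq_zero]
    refine integral_congr_ae (Eventually.of_forall fun x => ?_)
    have := hper j (T (j.insertNth 0 x))
    change φ (T (j.insertNth 1 x)) = φ (T (j.insertNth 0 x))
    rw [← this]
    congr 1
    ext k
    simp only [hT, PiLp.add_apply]
    refine Fin.succAboveCases j ?_ (fun k => ?_) k
    · simp
    · simp
  · simp [h]

/-! ### Poincaré and trace inequalities on the unit cube -/

theorem _root_.ENNReal.add_sq_le_two_mul (x y : ENNReal) : (x + y) ^ 2 ≤ 2 * (x ^ 2 + y ^ 2) := by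
  have h := ENNReal.rpow_add_le_mul_rpow_add_rpow x y (p := 2) (by norm_num)
  norm_num at h
  exact h

theorem sq_lintegral_le {X : Type*} [MeasurableSpace X] {μ : Measure X} [IsProbabilityMeasure μ]
    {f : X → ENNReal} (hf : AEMeasurable f μ) : (∫⁻ x, f x ∂μ) ^ 2 ≤ ∫⁻ x, f x ^ 2 ∂μ := by
  have h := ENNReal.lintegral_mul_le_Lp_mul_Lq μ (p := 2) (q := 2)
    (by rw [Real.holderConjugate_iff]; norm_num) hf (aemeasurable_const (b := (1 : ENNReal)))
  simp only [Pi.mul_apply, mul_one, ENNReal.one_rpow, lintegral_const, measure_univ] at h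
  refine (pow_le_pow_left' h 2).trans (le_of_eq ?_)
  rw [← ENNReal.rpow_natCast, ← ENNReal.rpow_mul]
  norm_num

/-- The fundamental theorem of calculus, followed by Cauchy-Schwarz on the probability space `[0,
1]`. -/
theorem enorm_sub_sq_le {g g' : ℝ → ℂ} (hg : ∀ x, HasDerivAt g (g' x) x) (hc : Continuous g')
    {s t : ℝ} (hs : s ∈ Set.Icc (0 : ℝ) 1) (ht : t ∈ Set.Icc (0 : ℝ) 1) :
    ‖g s - g t‖ₑ ^ 2 ≤ ∫⁻ x, ‖g' x‖ₑ ^ 2 ∂unitI := by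
  refine le_trans ?_ (sq_lintegral_le hc.enorm.measurable.aemeasurable)
  refine pow_le_pow_left' ?_ 2
  rw [← intervalIntegral.integral_eq_sub_of_hasDerivAt (a := t) (b := s) (fun x _ => hg x)
    (hc.intervalIntegrable _ _)]
  have h1 : ‖∫ x in t..s, g' x‖ₑ = ‖∫ x in Set.uIoc t s, g' x‖ₑ := by
    rw [← enorm_norm, intervalIntegral.norm_integral_eq_norm_integral_uIoc, enorm_norm]
  rw [h1]
  refine (enorm_integral_le_lintegral_enorm _).trans ?_
  refine lintegral_mono_set ?_
  exact Set.uIoc_subset_uIcc.trans (Set.uIcc_subset_Icc ht hs)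

theorem continuous_partialD {n : ℕ} {φ : EuclideanSpace ℝ (Fin n) → ℂ} (hφ : IsSmooth φ)
    (i : Fin n) : Continuous fun y => partialD i φ y :=
  (hφ.continuous_fderiv (by simp)).clm_apply continuous_const

theorem hasDerivAt_comp_line {n : ℕ} {φ : EuclideanSpace ℝ (Fin n) → ℂ} (hφ : IsSmooth φ)
    (i : Fin n) (y : EuclideanSpace ℝ (Fin n)) {l : ℝ → EuclideanSpace ℝ (Fin n)}
    (hl : ∀ t, l t = y + t • EuclideanSpace.single i 1) (t : ℝ) :
    HasDerivAt (fun t => φ (l t)) (partialD i φ (l t)) t := by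
  have h1 : HasDerivAt l (EuclideanSpace.single i 1) t := by
    rw [funext hl]
    simpa using ((hasDerivAt_id t).smul_const (EuclideanSpace.single i (1 : ℝ))).const_add y
  exact ((hφ.differentiable (by simp)).differentiableAt.hasFDerivAt).comp_hasDerivAt t h1

theorem enorm_sub_sq_le_line {n : ℕ} {φ : EuclideanSpace ℝ (Fin n) → ℂ} (hφ : IsSmooth φ)
    (i : Fin n) (y : EuclideanSpace ℝ (Fin n)) {l : ℝ → EuclideanSpace ℝ (Fin n)}
    (hl : ∀ t, l t = y + t • EuclideanSpace.single i 1) {s t : ℝ}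
    (hs : s ∈ Set.Icc (0 : ℝ) 1) (ht : t ∈ Set.Icc (0 : ℝ) 1) :
    ‖φ (l s) - φ (l t)‖ₑ ^ 2 ≤ ∫⁻ x, ‖partialD i φ (l x)‖ₑ ^ 2 ∂unitI := by
  refine enorm_sub_sq_le (fun x => hasDerivAt_comp_line hφ i y hl x) ?_ hs ht
  refine (continuous_partialD hφ i).comp ?_
  rw [funext hl]
  fun_prop

theorem vec3_line_zero (b c t : ℝ) :
    (!₂[t, b, c] : E3) = !₂[0, b, c] + t • EuclideanSpace.single 0 1 := by
  ext i; fin_cases i <;> simp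

theorem vec3_line_one (a c t : ℝ) :
    (!₂[a, t, c] : E3) = !₂[a, 0, c] + t • EuclideanSpace.single 1 1 := by
  ext i; fin_cases i <;> simp

theorem vec3_line_two (a b t : ℝ) :
    (!₂[a, b, t] : E3) = !₂[a, b, 0] + t • EuclideanSpace.single 2 1 := by
  ext i; fin_cases i <;> simp

theorem ae_unitI : ∀ᵐ t ∂unitI, t ∈ Set.Icc (0 : ℝ) 1 := ae_restrict_mem measurableSet_Icc

theorem measurable_comp_vec3 {h : E3 → ENNReal} (hh : Measurable h) {X : Type*}
    [MeasurableSpace X] {a b c : X → ℝ} (ha : Measurable a) (hb : Measurable b)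
    (hc : Measurable c) : Measurable fun x => h !₂[a x, b x, c x] :=
  hh.comp (measurable_vec3.comp (ha.prodMk (hb.prodMk hc)))

theorem lintegral_unitI_mono {f g : ℝ → ENNReal} (h : ∀ t ∈ Set.Icc (0 : ℝ) 1, f t ≤ g t) :
    ∫⁻ t, f t ∂unitI ≤ ∫⁻ t, g t ∂unitI :=
  lintegral_mono_ae (ae_unitI.mono h)

theorem lintegral_unitI_const (r : ENNReal) : ∫⁻ _, r ∂unitI = r := by simp

/-- On each vertical segment, the value at height `0` is compared with the value at height `t`, and
the estimate is averaged over `t`. -/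
theorem lintegral_enorm_trace_le {φ : E3 → ℂ} (hφ : IsSmooth φ) :
    ∫⁻ y, ‖φ (onSheet y)‖ₑ ^ 2 ∂cubeMeasure 2 ≤
      2 * (∫⁻ y, ‖φ y‖ₑ ^ 2 ∂cubeMeasure 3 + ∫⁻ y, ‖partialD 2 φ y‖ₑ ^ 2 ∂cubeMeasure 3) := by
  have hm : Measurable fun y => ‖φ y‖ₑ ^ 2 := hφ.continuous.enorm.measurable.pow_const 2
  have hm' : Measurable fun y => ‖partialD 2 φ y‖ₑ ^ 2 :=
    (continuous_partialD hφ 2).enorm.measurable.pow_const 2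
  have hs : Measurable fun y : E2 => ‖φ (onSheet y)‖ₑ ^ 2 := by
    refine hm.comp ((PiLp.volume_preserving_toLp (Fin 3)).measurable.comp ?_)
    refine measurable_pi_iff.2 fun i => ?_
    fin_cases i <;> simp <;> fun_prop
  rw [lintegral_cube_two hs, lintegral_cube_three hm, lintegral_cube_three hm',
    ← lintegral_add_left, ← lintegral_const_mul]
  · refine lintegral_mono fun a => ?_
    rw [← lintegral_add_left, ← lintegral_const_mul]
    · refine lintegral_mono fun b => ?_
      set D := ∫⁻ c, ‖partialD 2 φ !₂[a, b, c]‖ₑ ^ 2 ∂unitI with hD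
      have h1 : (onSheet !₂[a, b]) = !₂[a, b, 0] := by
        ext i; fin_cases i <;> simp [onSheet]
      have hm1 : Measurable fun c => ‖φ !₂[a, b, c]‖ₑ ^ 2 :=
        measurable_comp_vec3 hm measurable_const measurable_const measurable_id
      change ‖φ (onSheet !₂[a, b])‖ₑ ^ 2 ≤ _
      -- Quantities that do not depend on `t` are written as averages over `t`, so that a pointwise
      -- inequality in `t` suffices.
      rw [h1, ← lintegral_unitI_const (‖φ !₂[a, b, 0]‖ₑ ^ 2), ← lintegral_unitI_const D,
        ← lintegral_add_left hm1, ← lintegral_const_mul' 2 _ ENNReal.ofNat_ne_top]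
      refine lintegral_unitI_mono fun t ht => ?_
      have h2 := enorm_sub_sq_le_line hφ 2 _ (vec3_line_two a b)
        (Set.left_mem_Icc.2 zero_le_one) ht
      have h3 : φ !₂[a, b, 0] = φ !₂[a, b, t] + (φ !₂[a, b, 0] - φ !₂[a, b, t]) := by ring
      rw [h3]
      refine (pow_le_pow_left' (enorm_add_le _ _) 2).trans ?_
      refine (ENNReal.add_sq_le_two_mul _ _).trans ?_
      gcongr
    · exact ((measurable_comp_vec3 hm measurable_const measurable_fst
        measurable_snd).lintegral_prod_right').add (measurable_comp_vec3 hm' measurable_const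
          measurable_fst measurable_snd).lintegral_prod_right'
    · exact (measurable_comp_vec3 hm measurable_const measurable_fst
        measurable_snd).lintegral_prod_right'
  · refine Measurable.add ?_ ?_
    · exact (measurable_comp_vec3 hm (measurable_fst.comp measurable_fst)
        (measurable_snd.comp measurable_fst)
        measurable_snd).lintegral_prod_right'.lintegral_prod_right'
    · exact (measurable_comp_vec3 hm' (measurable_fst.comp measurable_fst)
        (measurable_snd.comp measurable_fst)
        measurable_snd).lintegral_prod_right'.lintegral_prod_right'
  · exact (measurable_comp_vec3 hm (measurable_fst.comp measurable_fst)
        (measurable_snd.comp measurable_fst)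
        measurable_snd).lintegral_prod_right'.lintegral_prod_right'

/-- The two points are joined by a path parallel to the axes, changing the third, then the second,
then the first coordinate. -/
theorem enorm_sub_sq_le_three {φ : E3 → ℂ} (hφ : IsSmooth φ) {a b c a' b' c' : ℝ}
    (ha : a ∈ Set.Icc (0 : ℝ) 1) (hb : b ∈ Set.Icc (0 : ℝ) 1) (hc : c ∈ Set.Icc (0 : ℝ) 1)
    (ha' : a' ∈ Set.Icc (0 : ℝ) 1) (hb' : b' ∈ Set.Icc (0 : ℝ) 1)
    (hc' : c' ∈ Set.Icc (0 : ℝ) 1) :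
    ‖φ !₂[a, b, c] - φ !₂[a', b', c']‖ₑ ^ 2 ≤
      2 * (∫⁻ t, ‖partialD 2 φ !₂[a, b, t]‖ₑ ^ 2 ∂unitI +
        2 * (∫⁻ t, ‖partialD 1 φ !₂[a, t, c']‖ₑ ^ 2 ∂unitI +
          ∫⁻ t, ‖partialD 0 φ !₂[t, b', c']‖ₑ ^ 2 ∂unitI)) := by
  have h1 : φ !₂[a, b, c] - φ !₂[a', b', c'] = (φ !₂[a, b, c] - φ !₂[a, b, c']) +
      ((φ !₂[a, b, c'] - φ !₂[a, b', c']) + (φ !₂[a, b', c'] - φ !₂[a', b', c'])) := by ring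
  rw [h1]
  refine (pow_le_pow_left' (enorm_add_le _ _) 2).trans ?_
  refine (ENNReal.add_sq_le_two_mul _ _).trans ?_
  gcongr
  · exact enorm_sub_sq_le_line hφ 2 _ (vec3_line_two a b) hc hc'
  · refine (pow_le_pow_left' (enorm_add_le _ _) 2).trans ?_
    refine (ENNReal.add_sq_le_two_mul _ _).trans ?_
    gcongr
    · exact enorm_sub_sq_le_line hφ 1 _ (vec3_line_one a c') hb hb'
    · exact enorm_sub_sq_le_line hφ 0 _ (vec3_line_zero b' c') ha ha'

/-- Each term depends on two of the six variables, and integrating a constant over `[0, 1]` changes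
nothing. -/
theorem lintegral_unitI_six {G2 G1 G0 : ℝ → ℝ → ENNReal}
    (hG2 : Measurable fun p : ℝ × ℝ => G2 p.1 p.2) (hG1 : Measurable fun p : ℝ × ℝ => G1 p.1 p.2)
    (hG0 : Measurable fun p : ℝ × ℝ => G0 p.1 p.2) :
    ∫⁻ a, ∫⁻ b, ∫⁻ _, ∫⁻ _, ∫⁻ b', ∫⁻ c', 2 * (G2 a b + 2 * (G1 a c' + G0 b' c'))
        ∂unitI ∂unitI ∂unitI ∂unitI ∂unitI ∂unitI =
      2 * (∫⁻ a, ∫⁻ b, G2 a b ∂unitI ∂unitI + 2 * (∫⁻ a, ∫⁻ b, G1 a b ∂unitI ∂unitI +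
        ∫⁻ a, ∫⁻ b, G0 a b ∂unitI ∂unitI)) := by
  simp only [lintegral_unitI_const]
  calc _ = ∫⁻ a, ∫⁻ b, ∫⁻ b', 2 * (G2 a b + 2 * (∫⁻ c, G1 a c ∂unitI + ∫⁻ c, G0 b' c ∂unitI))
        ∂unitI ∂unitI ∂unitI := by
        refine lintegral_congr fun a => lintegral_congr fun b => lintegral_congr fun b' => ?_
        have h1 : Measurable fun c => G1 a c := hG1.comp measurable_prodMk_left
        have h0 : Measurable fun c => G0 b' c := hG0.comp measurable_prodMk_left
        rw [lintegral_const_mul' 2 _ ENNReal.ofNat_ne_top,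
          lintegral_add_left measurable_const, lintegral_const_mul' 2 _ ENNReal.ofNat_ne_top,
          lintegral_add_left h1, lintegral_unitI_const]
    _ = ∫⁻ a, ∫⁻ b, 2 * (G2 a b + 2 * (∫⁻ c, G1 a c ∂unitI + ∫⁻ b, ∫⁻ c, G0 b c ∂unitI ∂unitI))
        ∂unitI ∂unitI := by
        refine lintegral_congr fun a => lintegral_congr fun b => ?_
        have h0 : Measurable fun b => ∫⁻ c, G0 b c ∂unitI := hG0.lintegral_prod_right'
        rw [lintegral_const_mul' 2 _ ENNReal.ofNat_ne_top,
          lintegral_add_left measurable_const, lintegral_const_mul' 2 _ ENNReal.ofNat_ne_top,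
          lintegral_add_left measurable_const, lintegral_unitI_const, lintegral_unitI_const]
    _ = ∫⁻ a, 2 * (∫⁻ b, G2 a b ∂unitI +
          2 * (∫⁻ c, G1 a c ∂unitI + ∫⁻ b, ∫⁻ c, G0 b c ∂unitI ∂unitI)) ∂unitI := by
        refine lintegral_congr fun a => ?_
        have h2 : Measurable fun b => G2 a b := hG2.comp measurable_prodMk_left
        rw [lintegral_const_mul' 2 _ ENNReal.ofNat_ne_top, lintegral_add_left h2,
          lintegral_unitI_const]
    _ = _ := by
        have h2 : Measurable fun a => ∫⁻ b, G2 a b ∂unitI := hG2.lintegral_prod_right'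
        have h1 : Measurable fun a => ∫⁻ b, G1 a b ∂unitI := hG1.lintegral_prod_right'
        rw [lintegral_const_mul' 2 _ ENNReal.ofNat_ne_top,
          lintegral_add_left h2, lintegral_const_mul' 2 _ ENNReal.ofNat_ne_top,
          lintegral_add_left h1, lintegral_unitI_const]

/-- Integrating the path estimate over both endpoints turns each line integral into an integral over
the whole cube, after Tonelli. -/
theorem lintegral_lintegral_enorm_sub_le {φ : E3 → ℂ} (hφ : IsSmooth φ) :
    ∫⁻ y, ∫⁻ z, ‖φ y - φ z‖ₑ ^ 2 ∂cubeMeasure 3 ∂cubeMeasure 3 ≤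
      2 * (∫⁻ y, ‖partialD 2 φ y‖ₑ ^ 2 ∂cubeMeasure 3 +
        2 * (∫⁻ y, ‖partialD 1 φ y‖ₑ ^ 2 ∂cubeMeasure 3 +
          ∫⁻ y, ‖partialD 0 φ y‖ₑ ^ 2 ∂cubeMeasure 3)) := by
  have hm : ∀ i, Measurable fun y => ‖partialD i φ y‖ₑ ^ 2 := fun i =>
    (continuous_partialD hφ i).enorm.measurable.pow_const 2
  have hd : Measurable fun p : E3 × E3 => ‖φ p.1 - φ p.2‖ₑ ^ 2 :=
    ((hφ.continuous.comp continuous_fst).sub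
      (hφ.continuous.comp continuous_snd)).enorm.measurable.pow_const 2
  have hI1 : ∫⁻ y, ‖partialD 1 φ y‖ₑ ^ 2 ∂cubeMeasure 3 =
      ∫⁻ a, ∫⁻ c, ∫⁻ t, ‖partialD 1 φ !₂[a, t, c]‖ₑ ^ 2 ∂unitI ∂unitI ∂unitI := by
    rw [lintegral_cube_three (hm 1)]
    refine lintegral_congr fun a => ?_
    exact lintegral_lintegral_swap (measurable_comp_vec3 (hm 1) measurable_const
      measurable_fst measurable_snd).aemeasurable
  have hI0 : ∫⁻ y, ‖partialD 0 φ y‖ₑ ^ 2 ∂cubeMeasure 3 =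
      ∫⁻ b, ∫⁻ c, ∫⁻ t, ‖partialD 0 φ !₂[t, b, c]‖ₑ ^ 2 ∂unitI ∂unitI ∂unitI := by
    rw [lintegral_cube_three (hm 0), lintegral_lintegral_swap]
    · refine lintegral_congr fun b => ?_
      exact lintegral_lintegral_swap (measurable_comp_vec3 (hm 0)
        measurable_fst measurable_const measurable_snd).aemeasurable
    · exact (measurable_comp_vec3 (hm 0) (measurable_fst.comp measurable_fst)
        (measurable_snd.comp measurable_fst)
        measurable_snd).lintegral_prod_right'.aemeasurable
  rw [lintegral_cube_three (hm 2), hI1, hI0, ← lintegral_unitI_six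
    (measurable_comp_vec3 (hm 2) (measurable_fst.comp measurable_fst)
      (measurable_snd.comp measurable_fst) measurable_snd).lintegral_prod_right'
    (measurable_comp_vec3 (hm 1) (measurable_fst.comp measurable_fst)
      measurable_snd (measurable_snd.comp measurable_fst)).lintegral_prod_right'
    (measurable_comp_vec3 (hm 0) measurable_snd (measurable_fst.comp measurable_fst)
      (measurable_snd.comp measurable_fst)).lintegral_prod_right']
  refine (lintegral_cube_three hd.lintegral_prod_right').trans_le ?_
  refine lintegral_unitI_mono fun a ha => lintegral_unitI_mono fun b hb =>
    lintegral_unitI_mono fun c hc => ?_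
  refine (lintegral_cube_three (hd.comp measurable_prodMk_left)).trans_le ?_
  refine lintegral_unitI_mono fun a' ha' =>
    lintegral_unitI_mono fun b' hb' => lintegral_unitI_mono fun c' hc' => ?_
  exact enorm_sub_sq_le_three hφ ha hb hc ha' hb' hc'

theorem enorm_partialD_le (φ : E3 → ℂ) (y : E3) (i : Fin 3) :
    ‖partialD i φ y‖ₑ ≤ ‖gradC φ y‖ₑ :=
  enorm_le_iff_norm_le.2 (PiLp.norm_apply_le (gradC φ y) i)

/-- Poincaré's inequality: `φ y` minus the mean is the average of `φ y - φ z` over `z`, so its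
square is at most the average of the squares. -/
theorem lintegral_enorm_sub_mean_le {φ : E3 → ℂ} (hφ : IsSmooth φ) :
    ∫⁻ y, ‖φ y - ∫ z, φ z ∂cubeMeasure 3‖ₑ ^ 2 ∂cubeMeasure 3 ≤
      10 * ∫⁻ y, ‖gradC φ y‖ₑ ^ 2 ∂cubeMeasure 3 := by
  have hint : Integrable φ (cubeMeasure 3) :=
    hφ.continuous.continuousOn.integrableOn_compact (isCompact_unitCube 3)
  calc _ ≤ ∫⁻ y, ∫⁻ z, ‖φ y - φ z‖ₑ ^ 2 ∂cubeMeasure 3 ∂cubeMeasure 3 := by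
        refine lintegral_mono fun y => ?_
        have h1 : φ y - ∫ z, φ z ∂cubeMeasure 3 = ∫ z, (φ y - φ z) ∂cubeMeasure 3 := by
          rw [integral_sub (integrable_const _) hint]
          simp
        rw [h1]
        refine (pow_le_pow_left' (enorm_integral_le_lintegral_enorm _) 2).trans ?_
        exact sq_lintegral_le
          (continuous_const.sub hφ.continuous).enorm.measurable.aemeasurable
    _ ≤ _ := lintegral_lintegral_enorm_sub_le hφ
    _ ≤ _ := by
        have h : ∀ i, ∫⁻ y, ‖partialD i φ y‖ₑ ^ 2 ∂cubeMeasure 3 ≤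
            ∫⁻ y, ‖gradC φ y‖ₑ ^ 2 ∂cubeMeasure 3 := fun i =>
          lintegral_mono fun y => pow_le_pow_left' (enorm_partialD_le φ y i) 2
        -- The constant is `10 = 2 (1 + 2 (1 + 1))`.
        refine (mul_le_mul_right (add_le_add (h 2) (mul_le_mul_right
          (add_le_add (h 1) (h 0)) 2)) 2).trans (le_of_eq ?_)
        ring

/-! ### Test functions in `L²` -/

section LpTools

variable {X : Type*} [MeasurableSpace X] {μ : Measure X}
  {E : Type*} [NormedAddCommGroup E]

theorem inner_toLp [InnerProductSpace ℂ E] {f : X → E} (hf : MemLp f 2 μ) (u : Lp E 2 μ) :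
    inner ℂ (hf.toLp f) u = ∫ x, inner ℂ (f x) (u x) ∂μ := by
  rw [L2.inner_def]
  refine integral_congr_ae ?_
  filter_upwards [hf.coeFn_toLp] with x hx
  rw [hx]

theorem sq_eLpNorm_two (f : X → E) : eLpNorm f 2 μ ^ 2 = ∫⁻ x, ‖f x‖ₑ ^ 2 ∂μ := by
  have h := eLpNorm_nnreal_pow_eq_lintegral (f := f) (μ := μ) (p := 2) two_ne_zero
  simpa using h

theorem norm_toLp_le_of_lintegral {F : Type*} [NormedAddCommGroup F] {f : X → E}
    (hf : MemLp f 2 μ) {Y : Type*} [MeasurableSpace Y] {ν : Measure Y} {g : Y → F}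
    (hg : MemLp g 2 ν) (r : ℝ≥0)
    (h : ∫⁻ x, ‖f x‖ₑ ^ 2 ∂μ ≤ (r : ENNReal) ^ 2 * ∫⁻ x, ‖g x‖ₑ ^ 2 ∂ν) :
    ‖hf.toLp f‖ ≤ r * ‖hg.toLp g‖ := by
  rw [← sq_eLpNorm_two, ← sq_eLpNorm_two, ← mul_pow] at h
  have h' : eLpNorm f 2 μ ≤ r * eLpNorm g 2 ν := (ENNReal.pow_le_pow_left_iff two_ne_zero).1 h
  rw [Lp.norm_toLp, Lp.norm_toLp]
  have h2 := ENNReal.toReal_mono (ENNReal.mul_ne_top ENNReal.coe_ne_top hg.eLpNorm_ne_top) h'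
  simpa using h2

end LpTools

theorem memLp_cube {n : ℕ} {F : Type*} [NormedAddCommGroup F]
    {f : EuclideanSpace ℝ (Fin n) → F} (hf : Continuous f) : MemLp f 2 (cubeMeasure n) := by
  obtain ⟨C, hC⟩ := (isCompact_unitCube n).exists_bound_of_continuousOn hf.continuousOn
  exact MemLp.of_bound hf.aestronglyMeasurable C
    ((ae_restrict_mem (measurableSet_unitCube n)).mono fun y hy => hC y hy)

/-! ### The space of the cell problem -/

/-- The smooth periodic functions. -/
def smoothPeriodic : Submodule ℂ (E3 → ℂ) where
  carrier := {φ | IsSmooth φ ∧ IsPeriodic φ}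
  add_mem' := fun {φ ψ} hφ hψ => ⟨hφ.1.add hψ.1, fun i y => by
    simp only [Pi.add_apply, hφ.2 i y, hψ.2 i y]⟩
  zero_mem' := ⟨contDiff_const, fun _ _ => rfl⟩
  smul_mem' := fun a φ hφ => ⟨contDiff_const.smul hφ.1, fun i y => by
    simp only [Pi.smul_apply, hφ.2 i y]⟩

theorem continuous_onSheet : Continuous onSheet := by
  refine (PiLp.continuous_toLp 2 _).comp (continuous_pi fun i => ?_)
  fin_cases i <;> simp <;> fun_prop

theorem continuous_gradC {φ : E3 → ℂ} (hφ : IsSmooth φ) : Continuous (gradC φ) :=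
  (PiLp.continuous_toLp 2 _).comp (continuous_pi fun i => continuous_partialD hφ i)

theorem partialD_add {n : ℕ} {F : Type*} [NormedAddCommGroup F] [NormedSpace ℝ F]
    {φ ψ : EuclideanSpace ℝ (Fin n) → F} (hφ : IsSmooth φ) (hψ : IsSmooth ψ) (i : Fin n)
    (y : EuclideanSpace ℝ (Fin n)) :
    partialD i (φ + ψ) y = partialD i φ y + partialD i ψ y := by
  rw [partialD, fderiv_add (hφ.differentiable (by simp)).differentiableAt
    (hψ.differentiable (by simp)).differentiableAt]
  rfl

theorem partialD_smul {n : ℕ} {F : Type*} [NormedAddCommGroup F] [NormedSpace ℂ F]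
    {φ : EuclideanSpace ℝ (Fin n) → F} (hφ : IsSmooth φ) (a : ℂ) (i : Fin n)
    (y : EuclideanSpace ℝ (Fin n)) : partialD i (a • φ) y = a • partialD i φ y := by
  rw [partialD, fderiv_const_smul (hφ.differentiable (by simp)).differentiableAt]
  rfl

theorem gradC_add {φ ψ : E3 → ℂ} (hφ : IsSmooth φ) (hψ : IsSmooth ψ) :
    gradC (φ + ψ) = gradC φ + gradC ψ := by
  ext y i
  exact partialD_add hφ hψ i y

theorem gradC_smul {φ : E3 → ℂ} (hφ : IsSmooth φ) (a : ℂ) :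
    gradC (a • φ) = a • gradC φ := by
  ext y i
  exact partialD_smul hφ a i y

theorem memLp_grad (φ : smoothPeriodic) : MemLp (gradC φ.1) 2 (cubeMeasure 3) :=
  memLp_cube (continuous_gradC φ.2.1)

theorem memLp_trace (φ : smoothPeriodic) : MemLp (φ.1 ∘ onSheet) 2 (cubeMeasure 2) :=
  memLp_cube (φ.2.1.continuous.comp continuous_onSheet)

theorem memLp_val (φ : smoothPeriodic) : MemLp φ.1 2 (cubeMeasure 3) :=
  memLp_cube φ.2.1.continuous

/-- Triples of a function, its gradient and its trace. -/
abbrev CellTriple : Type :=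
  Lp ℂ 2 (cubeMeasure 3) × Lp C3 2 (cubeMeasure 3) × Lp ℂ 2 (cubeMeasure 2)

/-- A smooth periodic function with its gradient and its trace. -/
noncomputable def cellJet : smoothPeriodic →ₗ[ℂ] CellTriple where
  toFun φ := ((memLp_val φ).toLp φ.1,
    (memLp_grad φ).toLp (gradC φ.1),
    (memLp_trace φ).toLp (φ.1 ∘ onSheet))
  map_add' φ ψ := by
    refine Prod.ext ?_ (Prod.ext ?_ ?_)
    · exact MemLp.toLp_add (memLp_val φ) (memLp_val ψ)
    · refine Eq.trans ?_ (MemLp.toLp_add (memLp_grad φ)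
        (memLp_grad ψ))
      exact MemLp.toLp_congr (memLp_grad (φ + ψ)) _ (Eventually.of_forall fun y =>
        congrFun (gradC_add φ.2.1 ψ.2.1) y)
    · exact MemLp.toLp_add (memLp_trace φ)
        (memLp_trace ψ)
  map_smul' a φ := by
    refine Prod.ext ?_ (Prod.ext ?_ ?_)
    · exact MemLp.toLp_const_smul a (memLp_val φ)
    · refine Eq.trans ?_ (MemLp.toLp_const_smul a (memLp_grad φ))
      exact MemLp.toLp_congr (memLp_grad (a • φ)) _ (Eventually.of_forall fun y =>
        congrFun (gradC_smul φ.2.1 a) y)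
    · exact MemLp.toLp_const_smul a (memLp_trace φ)

/-- The closure of the smooth periodic functions, with their gradients and traces. -/
noncomputable def cellTriples : Submodule ℂ CellTriple :=
  (LinearMap.range cellJet).topologicalClosure

theorem tendsto_toLp_iff {X : Type*} [MeasurableSpace X] {μ : Measure X} {E : Type*}
    [NormedAddCommGroup E] {f : ℕ → X → E} (hf : ∀ n, MemLp (f n) 2 μ) (u : Lp E 2 μ) :
    Tendsto (fun n => (hf n).toLp (f n)) atTop (𝓝 u) ↔
      Tendsto (fun n => eLpNorm (fun x => f n x - u x) 2 μ) atTop (𝓝 0) := by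
  have h := Lp.tendsto_Lp_iff_tendsto_eLpNorm'' (fi := atTop) f hf u (Lp.memLp u)
  rwa [Lp.toLp_coeFn] at h

/-- Closure points in a metric space are limits of sequences, and convergence of triples is
convergence of the components. Closedness and linearity thus come for free. -/
theorem hasGradientAndTrace_iff {u : Lp ℂ 2 (cubeMeasure 3)} {G : Lp C3 2 (cubeMeasure 3)}
    {τ : Lp ℂ 2 (cubeMeasure 2)} : HasGradientAndTrace u G τ ↔ (u, G, τ) ∈ cellTriples := by
  have key : ∀ φ : ℕ → smoothPeriodic, Tendsto (fun k => cellJet (φ k)) atTop (𝓝 (u, G, τ)) ↔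
      Tendsto (fun k => eLpNorm (fun y => (φ k).1 y - u y) 2 (cubeMeasure 3)) atTop (𝓝 0) ∧
      Tendsto (fun k => eLpNorm (fun y => gradC (φ k).1 y - G y) 2 (cubeMeasure 3)) atTop (𝓝 0) ∧
      Tendsto (fun k => eLpNorm (fun y => (φ k).1 (onSheet y) - τ y) 2 (cubeMeasure 2))
        atTop (𝓝 0) := by
    intro φ
    rw [Prod.tendsto_iff, Prod.tendsto_iff]
    exact and_congr (tendsto_toLp_iff (fun k => memLp_val (φ k)) u)
      (and_congr (tendsto_toLp_iff (fun k => memLp_grad (φ k)) G)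
        (tendsto_toLp_iff (fun k => memLp_trace (φ k)) τ))
  constructor
  · rintro ⟨φ, ⟨h1, h2, h3⟩, h4⟩
    exact mem_closure_of_tendsto ((key fun k => ⟨φ k, h1 k⟩).2 ⟨h2, h3, h4⟩)
      (Eventually.of_forall fun k => ⟨_, rfl⟩)
  · intro h
    obtain ⟨x, hx, hlim⟩ := mem_closure_iff_seq_limit.1 h
    choose φ hφ using hx
    obtain ⟨h2, h3, h4⟩ := (key φ).1 (by simpa only [hφ] using hlim)
    exact ⟨fun k => (φ k).1, ⟨fun k => (φ k).2, h2, h3⟩, h4⟩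

/-- The constant function one on the cube. -/
noncomputable def oneLp (n : ℕ) : Lp ℂ 2 (cubeMeasure n) :=
  (memLp_cube (continuous_const (y := (1 : ℂ)))).toLp fun _ => 1

theorem oneLp_mem_cellTriples : (oneLp 3, 0, oneLp 2) ∈ cellTriples := by
  let one : smoothPeriodic := ⟨fun _ => 1, contDiff_const, fun _ _ => rfl⟩
  refine Submodule.le_topologicalClosure _ ⟨one, ?_⟩
  refine Prod.ext rfl (Prod.ext ?_ rfl)
  refine (MemLp.toLp_congr (memLp_grad one) (MemLp.zero (ε := C3))
    (Eventually.of_forall fun y => ?_)).trans (MemLp.toLp_zero _)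
  ext i
  simp [gradC, partialD, one]

theorem cellJet_sub_mean (φ : smoothPeriodic) :
    (cellJet φ).1 - inner ℂ (oneLp 3) (cellJet φ).1 • oneLp 3 =
      (memLp_cube (φ.2.1.continuous.sub continuous_const)).toLp
        (fun y => φ.1 y - ∫ z, φ.1 z ∂cubeMeasure 3) ∧
    (cellJet φ).2.2 - inner ℂ (oneLp 3) (cellJet φ).1 • oneLp 2 =
      (memLp_cube ((φ.2.1.continuous.comp continuous_onSheet).sub continuous_const)).toLp
        (fun y => φ.1 (onSheet y) - ∫ z, φ.1 z ∂cubeMeasure 3) := by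
  have h : inner ℂ (oneLp 3) (cellJet φ).1 = ∫ z, φ.1 z ∂cubeMeasure 3 := by
    rw [oneLp, inner_toLp]
    refine integral_congr_ae ?_
    filter_upwards [(memLp_val φ).coeFn_toLp] with y hy
    simp [cellJet, hy]
  rw [h, oneLp, oneLp, ← MemLp.toLp_const_smul, ← MemLp.toLp_const_smul]
  constructor
  · refine (MemLp.toLp_sub (memLp_val φ) _).symm.trans
      (MemLp.toLp_congr _ _ (Eventually.of_forall fun y => ?_))
    simp
  · refine (MemLp.toLp_sub (memLp_trace φ) _).symm.trans
      (MemLp.toLp_congr _ _ (Eventually.of_forall fun y => ?_))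
    simp

/-- Both inequalities are closed conditions, so they need checking only for smooth periodic
functions. The mean over the cell, not over the sheet, is subtracted from the trace as well. -/
theorem norm_sub_mean_le {z : CellTriple} (hz : z ∈ cellTriples) :
    ‖z.1 - inner ℂ (oneLp 3) z.1 • oneLp 3‖ ≤ 4 * ‖z.2.1‖ ∧
    ‖z.2.2 - inner ℂ (oneLp 3) z.1 • oneLp 2‖ ≤ 5 * ‖z.2.1‖ := by
  have hcl : IsClosed {z : CellTriple | ‖z.1 - inner ℂ (oneLp 3) z.1 • oneLp 3‖ ≤ 4 * ‖z.2.1‖ ∧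
      ‖z.2.2 - inner ℂ (oneLp 3) z.1 • oneLp 2‖ ≤ 5 * ‖z.2.1‖} :=
    IsClosed.and (isClosed_le (by fun_prop) (by fun_prop))
      (isClosed_le (by fun_prop) (by fun_prop))
  refine closure_minimal ?_ hcl hz
  rintro _ ⟨φ, rfl⟩
  obtain ⟨h1, h2⟩ := cellJet_sub_mean φ
  have hP := lintegral_enorm_sub_mean_le φ.2.1
  set m := ∫ z, φ.1 z ∂cubeMeasure 3
  refine ⟨?_, ?_⟩
  · rw [h1]
    -- Poincaré's constant satisfies `10 ≤ 4²`; for the trace below, `2 (10 + 1) = 22 ≤ 5²`.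
    refine norm_toLp_le_of_lintegral (g := gradC φ.1) _ (memLp_grad φ) 4
      (hP.trans ?_)
    gcongr
    norm_num
  · rw [h2]
    refine norm_toLp_le_of_lintegral (g := gradC φ.1) _ (memLp_grad φ) 5 ?_
    have hs : IsSmooth fun y => φ.1 y - m := φ.2.1.sub contDiff_const
    refine (lintegral_enorm_trace_le hs).trans ?_
    have h3 : ∀ y, partialD 2 (fun y => φ.1 y - m) y = partialD 2 φ.1 y := by
      intro y
      rw [partialD, partialD, fderiv_sub_const]
    have h4 : ∫⁻ y, ‖partialD 2 (fun y => φ.1 y - m) y‖ₑ ^ 2 ∂cubeMeasure 3 ≤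
        ∫⁻ y, ‖gradC φ.1 y‖ₑ ^ 2 ∂cubeMeasure 3 :=
      lintegral_mono fun y => by
        simp only [h3]
        exact pow_le_pow_left' (enorm_partialD_le φ.1 y 2) 2
    calc _ ≤ 2 * (10 * ∫⁻ y, ‖gradC φ.1 y‖ₑ ^ 2 ∂cubeMeasure 3 +
          ∫⁻ y, ‖gradC φ.1 y‖ₑ ^ 2 ∂cubeMeasure 3) :=
          mul_le_mul_right (add_le_add hP h4) 2
      _ = 22 * ∫⁻ y, ‖gradC φ.1 y‖ₑ ^ 2 ∂cubeMeasure 3 := by ring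
      _ ≤ _ := by
          gcongr
          norm_num

/-- For smooth periodic functions this is the divergence theorem, and the condition is closed. It
makes gradients orthogonal to constant fields. -/
theorem integral_cellTriple_gradient {z : CellTriple} (hz : z ∈ cellTriples) (e : C3) :
    ∫ y, inner ℂ e (z.2.1 y) ∂cubeMeasure 3 = 0 := by
  have he : MemLp (fun _ : E3 => e) 2 (cubeMeasure 3) := memLp_cube continuous_const
  rw [← inner_toLp he]
  have hcl : IsClosed {z : CellTriple | inner ℂ (he.toLp fun _ => e) z.2.1 = 0} :=
    isClosed_eq (by fun_prop) continuous_const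
  refine closure_minimal ?_ hcl hz
  rintro _ ⟨φ, rfl⟩
  change inner ℂ (he.toLp fun _ => e) (cellJet φ).2.1 = 0
  rw [inner_toLp]
  have h1 : ∫ y, inner ℂ e ((cellJet φ).2.1 y) ∂cubeMeasure 3 =
      ∫ y, ∑ i, partialD i φ.1 y * starRingEnd ℂ (e i) ∂cubeMeasure 3 := by
    refine integral_congr_ae ?_
    filter_upwards [(memLp_grad φ).coeFn_toLp] with y hy
    have : (cellJet φ).2.1 y = gradC φ.1 y := hy
    rw [this, ← dotc_eq_inner]
    rfl
  rw [h1, integral_finsetSum]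
  · refine Finset.sum_eq_zero fun i _ => ?_
    rw [integral_mul_const, integral_partialD_eq_zero φ.2.1 φ.2.2, zero_mul]
  · intro i _
    exact ((continuous_partialD φ.2.1 i).continuousOn.integrableOn_compact
      (isCompact_unitCube 3)).mul_const _

/-! ### Weak gradients on the sheet and the closed space of gradient pairs -/

theorem continuous_conj_comp {X : Type*} [TopologicalSpace X] {f : X → ℂ} (hf : Continuous f) :
    Continuous fun x => starRingEnd ℂ (f x) :=
  Complex.continuous_conj.comp hf

theorem continuous_euclideanSingle {X : Type*} [TopologicalSpace X] {n : ℕ} {f : X → ℂ}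
    (hf : Continuous f)
    (i : Fin n) : Continuous fun x => (EuclideanSpace.single i (f x) : EuclideanSpace ℂ (Fin n)) :=
  (PiLp.continuous_toLp 2 _).comp ((_root_.continuous_single i).comp hf)

/-- The functional `(τ, t) ↦ ∫ τ ∂ᵢψ + ∫ tᵢ ψ` on the sheet. -/
noncomputable def sheetFunctional {ψ : E2 → ℂ} (hψ : IsSmooth ψ) (i : Fin 2) :
    Lp ℂ 2 (cubeMeasure 2) × Lp C2 2 (cubeMeasure 2) →L[ℂ] ℂ :=
  (innerSL ℂ ((memLp_cube (continuous_conj_comp (continuous_partialD hψ i))).toLp _)).coprod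
    (innerSL ℂ ((memLp_cube
      (continuous_euclideanSingle (continuous_conj_comp hψ.continuous) i)).toLp _))

theorem sheetFunctional_apply {ψ : E2 → ℂ} (hψ : IsSmooth ψ) (i : Fin 2)
    (p : Lp ℂ 2 (cubeMeasure 2) × Lp C2 2 (cubeMeasure 2)) :
    sheetFunctional hψ i p = ∫ y, p.1 y * partialD i ψ y ∂(cubeMeasure 2) +
      ∫ y, p.2 y i * ψ y ∂(cubeMeasure 2) := by
  rw [sheetFunctional, ContinuousLinearMap.coprod_apply, innerSL_apply_apply, innerSL_apply_apply,
    inner_toLp, inner_toLp]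
  simp [EuclideanSpace.inner_single_left, mul_comm]

/-- Functions on the sheet with their weak gradients. -/
noncomputable def sheetGradients :
    Submodule ℂ (Lp ℂ 2 (cubeMeasure 2) × Lp C2 2 (cubeMeasure 2)) :=
  ⨅ (ψ : {ψ : E2 → ℂ // IsSmooth ψ ∧ IsPeriodic ψ}), ⨅ i : Fin 2,
    LinearMap.ker (sheetFunctional ψ.2.1 i).toLinearMap

theorem isSheetGradient_iff {τ : Lp ℂ 2 (cubeMeasure 2)} {t : Lp C2 2 (cubeMeasure 2)} :
    IsSheetGradient τ t ↔ (τ, t) ∈ sheetGradients := by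
  simp only [sheetGradients, Submodule.mem_iInf, LinearMap.mem_ker,
    ContinuousLinearMap.coe_coe, sheetFunctional_apply, Subtype.forall, IsSheetGradient,
    eq_neg_iff_add_eq_zero]
  exact ⟨fun h ψ hψ i => h ψ hψ.1 hψ.2 i, fun h ψ h1 h2 i => h ψ ⟨h1, h2⟩ i⟩

theorem isClosed_sheetGradients :
    IsClosed (sheetGradients : Set (Lp ℂ 2 (cubeMeasure 2) × Lp C2 2 (cubeMeasure 2))) := by
  simp only [sheetGradients, Submodule.coe_iInf]
  exact isClosed_iInter fun ψ => isClosed_iInter fun i =>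
    (sheetFunctional ψ.2.1 i).isClosed_ker

theorem oneLp_mem_sheetGradients : (oneLp 2, 0) ∈ sheetGradients := by
  refine isSheetGradient_iff.1 fun ψ hψ hper i => ?_
  have h1 : ∫ y, oneLp 2 y * partialD i ψ y ∂cubeMeasure 2 =
      ∫ y, partialD i ψ y ∂cubeMeasure 2 := by
    refine integral_congr_ae ?_
    filter_upwards [(memLp_cube (n := 2) (continuous_const (y := (1 : ℂ)))).coeFn_toLp] with y hy
    rw [oneLp, hy, one_mul]
  have h2 : ∫ y, (0 : Lp C2 2 (cubeMeasure 2)) y i * ψ y ∂cubeMeasure 2 = 0 := by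
    refine (integral_congr_ae ?_).trans (integral_zero' _ _)
    filter_upwards with y
    simp
  rw [h1, h2, neg_zero, integral_partialD_eq_zero hψ hper]

/-- The cell functions of mean value zero, with gradient, trace and tangential gradient. -/
noncomputable def meanZeroCellFunctions : Submodule ℂ (CellTriple × Lp C2 2 (cubeMeasure 2)) :=
  cellTriples.comap (LinearMap.fst ℂ _ _) ⊓
    sheetGradients.comap (((LinearMap.snd ℂ _ _ ∘ₗ LinearMap.snd ℂ _ _) ∘ₗ
      LinearMap.fst ℂ CellTriple _).prod (LinearMap.snd ℂ _ _)) ⊓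
    LinearMap.ker ((innerSL ℂ (oneLp 3)).toLinearMap ∘ₗ LinearMap.fst ℂ _ _ ∘ₗ
      LinearMap.fst ℂ CellTriple (Lp C2 2 (cubeMeasure 2)))

theorem mem_meanZeroCellFunctions {z : CellTriple × Lp C2 2 (cubeMeasure 2)} :
    z ∈ meanZeroCellFunctions ↔ (z.1 ∈ cellTriples ∧ (z.1.2.2, z.2) ∈ sheetGradients) ∧
      inner ℂ (oneLp 3) z.1.1 = 0 := Iff.rfl

theorem isClosed_meanZeroCellFunctions : 
    IsClosed (meanZeroCellFunctions : Set (CellTriple × Lp C2 2 (cubeMeasure 2))) := by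
  have h1 : IsClosed {z : CellTriple × Lp C2 2 (cubeMeasure 2) | z.1 ∈ cellTriples} :=
    (Submodule.isClosed_topologicalClosure _).preimage continuous_fst
  have h2 : IsClosed {z : CellTriple × Lp C2 2 (cubeMeasure 2) |
      (z.1.2.2, z.2) ∈ sheetGradients} :=
    isClosed_sheetGradients.preimage (by fun_prop)
  have h3 : IsClosed {z : CellTriple × Lp C2 2 (cubeMeasure 2) | inner ℂ (oneLp 3) z.1.1 = 0} :=
    isClosed_eq (by fun_prop) continuous_const
  exact (h1.inter h2).inter h3

/-- Pairs of square integrable vector fields in the cell and on the sheet. -/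
abbrev CellPair : Type := WithLp 2 (Lp C3 2 (cubeMeasure 3) × Lp C2 2 (cubeMeasure 2))

/-- The gradient and the tangential gradient on the sheet. -/
noncomputable def gradientPair : CellTriple × Lp C2 2 (cubeMeasure 2) →L[ℂ] CellPair :=
  ((WithLp.prodContinuousLinearEquiv 2 ℂ (Lp C3 2 (cubeMeasure 3))
    (Lp C2 2 (cubeMeasure 2))).symm.toContinuousLinearMap) ∘L
    (((ContinuousLinearMap.fst ℂ _ _ ∘L ContinuousLinearMap.snd ℂ _ _) ∘L
      ContinuousLinearMap.fst ℂ CellTriple _).prod (ContinuousLinearMap.snd ℂ _ _))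

/-- The gradients of cell functions. -/
noncomputable def cellGradients : Submodule ℂ CellPair :=
  meanZeroCellFunctions.map gradientPair.toLinearMap

/-- Subtracting the mean changes neither gradient, so the normalisation loses no gradient pair. -/
theorem mem_cellGradients_iff {p : CellPair} :
    p ∈ cellGradients ↔ ∃ χ : CellFunction, χ.grad = p.fst ∧ χ.tgrad = p.snd := by
  constructor
  · rintro ⟨z, hz, rfl⟩
    obtain ⟨⟨h1, h2⟩, -⟩ := mem_meanZeroCellFunctions.1 hz
    exact ⟨⟨z.1.1, z.1.2.1, z.1.2.2, z.2, hasGradientAndTrace_iff.2 h1,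
      isSheetGradient_iff.2 h2⟩, rfl, rfl⟩
  · rintro ⟨χ, h1, h2⟩
    have h3 := hasGradientAndTrace_iff.1 χ.hasGradientAndTrace
    have h4 := isSheetGradient_iff.1 χ.isSheetGradient
    set m : ℂ := inner ℂ (oneLp 3) χ.val
    refine ⟨((χ.val, χ.grad, χ.trace) - m • (oneLp 3, 0, oneLp 2), χ.tgrad),
      mem_meanZeroCellFunctions.2 ⟨⟨?_, ?_⟩, ?_⟩, ?_⟩
    · exact cellTriples.sub_mem h3 (cellTriples.smul_mem m oneLp_mem_cellTriples)
    · have h5 := sheetGradients.sub_mem h4 (sheetGradients.smul_mem m oneLp_mem_sheetGradients)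
      simpa using h5
    · have h6 : inner ℂ (oneLp 3) (oneLp 3) = (1 : ℂ) := by
        rw [oneLp, inner_toLp]
        refine (integral_congr_ae (g := fun _ => (1 : ℂ)) ?_).trans (by simp)
        filter_upwards [(memLp_cube (n := 3) (continuous_const (y := (1 : ℂ)))).coeFn_toLp]
          with y hy
        rw [hy]
        simp
      change inner ℂ (oneLp 3) (χ.val - m • oneLp 3) = 0
      rw [inner_sub_right, inner_smul_right, h6, mul_one, sub_self]
    · change WithLp.toLp 2 (χ.grad - m • 0, χ.tgrad) = p
      rw [smul_zero, sub_zero, h1, h2]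
      rfl

/-- With mean zero, the Poincaré and trace bounds lose their constant terms. The left side is a
maximum norm, so `5` is the largest of the constants `4`, `1`, `5`, `1`. -/
theorem norm_le_gradientPair {z : CellTriple × Lp C2 2 (cubeMeasure 2)}
    (hz : z ∈ meanZeroCellFunctions) : ‖z‖ ≤ 5 * ‖gradientPair z‖ := by
  obtain ⟨⟨h1, -⟩, h3⟩ := mem_meanZeroCellFunctions.1 hz
  obtain ⟨h4, h5⟩ := norm_sub_mean_le h1
  rw [h3, zero_smul, sub_zero] at h4 h5
  have h6 : ‖z.1.2.1‖ ≤ ‖gradientPair z‖ := WithLp.norm_fst_le _ (gradientPair z)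
  have h7 : ‖z.2‖ ≤ ‖gradientPair z‖ := WithLp.norm_snd_le _ (gradientPair z)
  have h8 := norm_nonneg (gradientPair z)
  refine norm_prod_le_iff.2 ⟨norm_prod_le_iff.2 ⟨?_, norm_prod_le_iff.2 ⟨?_, ?_⟩⟩, ?_⟩ <;> linarith

/-- The space is the image of a complete space under a map bounded below; without the mean zero
condition, constants would lie in the kernel. -/
theorem isClosed_cellGradients : IsClosed (cellGradients : Set CellPair) := by
  have : CompleteSpace meanZeroCellFunctions :=
    isClosed_meanZeroCellFunctions.completeSpace_coe
  let T : meanZeroCellFunctions →L[ℂ] CellPair := gradientPair ∘L meanZeroCellFunctions.subtypeL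
  have hT : AntilipschitzWith 5 T :=
    T.antilipschitz_of_bound fun z => norm_le_gradientPair z.2
  have h := hT.isClosed_range T.uniformContinuous
  convert! h using 1
  ext p
  constructor
  · rintro ⟨z, hz, rfl⟩
    exact ⟨⟨z, hz⟩, rfl⟩
  · rintro ⟨z, rfl⟩
    exact ⟨z, z.2, rfl⟩

instance : CompleteSpace cellGradients := isClosed_cellGradients.completeSpace_coe

theorem integral_inner_cellGradients {p : CellPair} (hp : p ∈ cellGradients) (e : C3) :
    ∫ y, inner ℂ e (p.fst y) ∂cubeMeasure 3 = 0 := by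
  obtain ⟨z, hz, rfl⟩ := hp
  exact integral_cellTriple_gradient (mem_meanZeroCellFunctions.1 hz).1.1 e

/-! ### Multiplication operators -/

section Multiplication

variable {X : Type*} [MeasurableSpace X] {μ : Measure X}
  {E : Type*} [NormedAddCommGroup E] [InnerProductSpace ℂ E]

theorem norm_smul_id_le {m : X → ℂ} {M : ℝ} (hM : ∀ᵐ x ∂μ, ‖m x‖ ≤ M) :
    ∀ᵐ x ∂μ, ‖m x • ContinuousLinearMap.id ℂ E‖ ≤ M := by
  filter_upwards [hM] with x hx
  rw [norm_smul]
  exact (mul_le_of_le_one_right (norm_nonneg _) ContinuousLinearMap.norm_id_le).trans hx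

/-- Multiplication by a bounded function on `L²`. -/
noncomputable def mulLp (E : Type*) [NormedAddCommGroup E] [InnerProductSpace ℂ E] (m : X → ℂ)
    (hm : AEMeasurable m μ) (M : ℝ) (hM : ∀ᵐ x ∂μ, ‖m x‖ ≤ M) : Lp E 2 μ →L[ℂ] Lp E 2 μ :=
  pointwiseLp (fun x => m x • ContinuousLinearMap.id ℂ E)
    (hm.aestronglyMeasurable.smul_const _) M (norm_smul_id_le hM)

variable {m : X → ℂ} (hm : AEMeasurable m μ) {M : ℝ} (hM : ∀ᵐ x ∂μ, ‖m x‖ ≤ M)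

theorem inner_mulLp (u v : Lp E 2 μ) :
    inner ℂ v (mulLp E m hm M hM u) = ∫ x, m x * inner ℂ (v x) (u x) ∂μ := by
  rw [mulLp, inner_pointwiseLp]
  simp

theorem norm_mulLp_le (u : Lp E 2 μ) : ‖mulLp E m hm M hM u‖ ≤ M * ‖u‖ :=
  norm_pointwiseLp_le _ _ _ _ _

theorem mulLp_coercive {α : ℝ} (hα : ∀ᵐ x ∂μ, α ≤ (m x).re) (u : Lp E 2 μ) :
    α * ‖u‖ ^ 2 ≤ (inner ℂ u (mulLp E m hm M hM u)).re := by
  refine pointwiseLp_coercive _ _ _ _ ?_ u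
  filter_upwards [hα] with x hx ξ
  have h : inner ℂ ξ ((m x • ContinuousLinearMap.id ℂ E) ξ) = m x * ((‖ξ‖ ^ 2 : ℝ) : ℂ) := by
    simp [inner_self_eq_norm_sq_to_K]
  rw [h, Complex.re_mul_ofReal]
  exact mul_le_mul_of_nonneg_right hx (sq_nonneg _)

end Multiplication

/-! ### The cell problem as a variational problem -/

/-- Measurable coefficients of the cell problem with the bounds `c` and `C`. -/
structure Admissible (c C : ℝ) (e : E3 → ℂ) (s : E2 → ℂ) : Prop where
  measurable_cell : AEMeasurable e (cubeMeasure 3)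
  measurable_sheet : AEMeasurable s (cubeMeasure 2)
  bounds_cell : ∀ᵐ y ∂cubeMeasure 3, c ≤ (e y).im ∧ ‖e y‖ ≤ C
  bounds_sheet : ∀ᵐ y ∂cubeMeasure 2, c ≤ (s y).re ∧ ‖s y‖ ≤ C

section CellProblem

variable {ω c C : ℝ} {e : E3 → ℂ} {s : E2 → ℂ}

/-- The operator of the cell problem. -/
noncomputable def cellOperator (ω : ℝ) (h : Admissible c C e s) : CellPair →L[ℂ] CellPair :=
  diagL2
    -- The sign comes from moving the cell integral to the sheet side; then `Re (-iωε) = ω Im ε`.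
    (mulLp C3 (fun y => -(Complex.I * ω) * e y) (h.measurable_cell.const_mul _) (|ω| * C)
      (h.bounds_cell.mono fun y hy => by
        simpa using mul_le_mul_of_nonneg_left hy.2 (abs_nonneg ω)))
    (mulLp C2 s h.measurable_sheet C (h.bounds_sheet.mono fun _ hy => hy.2))

theorem inner_cellOperator (h : Admissible c C e s) (p q : CellPair) :
    inner ℂ q (cellOperator ω h p) =
      ∫ y, -(Complex.I * ω) * e y * inner ℂ (q.fst y) (p.fst y) ∂cubeMeasure 3 +
        ∫ y, s y * inner ℂ (q.snd y) (p.snd y) ∂cubeMeasure 2 := by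
  rw [cellOperator, inner_diagL2, inner_mulLp, inner_mulLp]

/-- The two parts are kept apart because the bound on the effective permittivity needs exactly `ωc`
on the cell, which the minimum of the two constants may lose. -/
theorem re_inner_cellOperator_ge (hω : 0 < ω) (h : Admissible c C e s) (p : CellPair) :
    ω * c * ‖p.fst‖ ^ 2 + c * ‖p.snd‖ ^ 2 ≤ (inner ℂ p (cellOperator ω h p)).re := by
  rw [cellOperator, inner_diagL2, Complex.add_re]
  refine add_le_add (mulLp_coercive _ _ (h.bounds_cell.mono fun y hy => ?_) _)
    (mulLp_coercive _ _ (h.bounds_sheet.mono fun y hy => hy.1) _)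
  simpa using mul_le_mul_of_nonneg_left hy.1 hω.le

theorem cellOperator_coercive (hω : 0 < ω) (h : Admissible c C e s) (p : CellPair) :
    min (ω * c) c * ‖p‖ ^ 2 ≤ (inner ℂ p (cellOperator ω h p)).re := by
  refine le_trans ?_ (re_inner_cellOperator_ge hω h p)
  rw [WithLp.prod_norm_sq_eq_of_L2, mul_add]
  exact add_le_add (mul_le_mul_of_nonneg_right (min_le_left _ _) (sq_nonneg _))
    (mul_le_mul_of_nonneg_right (min_le_right _ _) (sq_nonneg _))

theorem norm_cellOperator_le (hC : 0 ≤ C) (h : Admissible c C e s) (p : CellPair) :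
    ‖cellOperator ω h p‖ ≤ max (|ω| * C) C * ‖p‖ := by
  refine norm_diagL2_le (hC.trans (le_max_right _ _)) (fun a => ?_) (fun b => ?_) p
  · exact (norm_mulLp_le _ _ a).trans
      (mul_le_mul_of_nonneg_right (le_max_left _ _) (norm_nonneg _))
  · exact (norm_mulLp_le _ _ b).trans
      (mul_le_mul_of_nonneg_right (le_max_right _ _) (norm_nonneg _))

/-- The constant field `ξ` in the cell, with its tangential part on the sheet. -/
noncomputable def constPair : C3 →ₗ[ℂ] CellPair where
  toFun ξ := WithLp.toLp 2 (Lp.constL 2 (cubeMeasure 3) ℂ ξ,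
    Lp.constL 2 (cubeMeasure 2) ℂ (!₂[ξ 0, ξ 1] : C2))
  map_add' ξ η := by
    have h : (!₂[(ξ + η) 0, (ξ + η) 1] : C2) = !₂[ξ 0, ξ 1] + !₂[η 0, η 1] := by
      ext i; fin_cases i <;> simp
    rw [h, map_add, map_add]
    rfl
  map_smul' a ξ := by
    have h : (!₂[(a • ξ) 0, (a • ξ) 1] : C2) = a • !₂[ξ 0, ξ 1] := by
      ext i; fin_cases i <;> simp
    rw [h, map_smul, map_smul]
    rfl

theorem constPair_fst_ae (ξ : C3) : (constPair ξ).fst =ᵐ[cubeMeasure 3] fun _ => ξ :=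
  Lp.coeFn_const 2 (cubeMeasure 3) ξ

theorem constPair_snd_ae (ξ : C3) :
    (constPair ξ).snd =ᵐ[cubeMeasure 2] fun _ => !₂[ξ 0, ξ 1] :=
  Lp.coeFn_const 2 (cubeMeasure 2) _

/-- The gradients of a cell function. -/
noncomputable def CellFunction.pair (χ : CellFunction) : CellPair :=
  WithLp.toLp 2 (χ.grad, χ.tgrad)

theorem CellFunction.pair_mem (χ : CellFunction) : χ.pair ∈ cellGradients :=
  mem_cellGradients_iff.2 ⟨χ, rfl, rfl⟩

theorem exists_cellFunction_pair_eq {p : CellPair} (hp : p ∈ cellGradients) :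
    ∃ χ : CellFunction, χ.pair = p := by
  obtain ⟨χ, h1, h2⟩ := mem_cellGradients_iff.1 hp
  refine ⟨χ, ?_⟩
  rw [CellFunction.pair, h1, h2]
  rfl

theorem pair_add_constPair_fst_ae (χ : CellFunction) (j : Fin 3) :
    (χ.pair + constPair (unitVec j)).fst =ᵐ[cubeMeasure 3] cellField j χ := by
  have h : (χ.pair + constPair (unitVec j)).fst = χ.grad + (constPair (unitVec j)).fst := rfl
  rw [h]
  filter_upwards [Lp.coeFn_add χ.grad (constPair (unitVec j)).fst,
    constPair_fst_ae (unitVec j)] with y h1 h2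
  rw [h1, Pi.add_apply, h2, add_comm]
  rfl

theorem pair_add_constPair_snd_ae (χ : CellFunction) (j : Fin 3) :
    (fun y => tangVec ((χ.pair + constPair (unitVec j)).snd y))
      =ᵐ[cubeMeasure 2] sheetField j χ := by
  have h : (χ.pair + constPair (unitVec j)).snd = χ.tgrad + (constPair (unitVec j)).snd := rfl
  rw [h]
  filter_upwards [Lp.coeFn_add χ.tgrad (constPair (unitVec j)).snd,
    constPair_snd_ae (unitVec j)] with y h1 h2
  rw [h1, Pi.add_apply, h2]
  ext i
  fin_cases i <;> simp [tangVec, sheetField, projT, add_comm]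

theorem dotc_tangVec (a b : C2) : dotc (tangVec a) (tangVec b) = inner ℂ b a := by
  simp [dotc, tangVec, PiLp.inner_apply, Fin.sum_univ_three]

theorem inner_cellOperator_pair (h : Admissible c C e s) (j : Fin 3) (χ : CellFunction)
    (q : CellPair) :
    inner ℂ q (cellOperator ω h (χ.pair + constPair (unitVec j))) =
      -(∫ y, Complex.I * ω * e y * dotc (cellField j χ y) (q.fst y) ∂(cubeMeasure 3)) +
      ∫ y, s y * dotc (sheetField j χ y) (tangVec (q.snd y)) ∂(cubeMeasure 2) := by
  rw [inner_cellOperator, ← integral_neg]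
  congr 1
  · refine integral_congr_ae ?_
    filter_upwards [pair_add_constPair_fst_ae χ j] with y hy
    rw [hy, dotc_eq_inner]
    ring
  · refine integral_congr_ae ?_
    filter_upwards [pair_add_constPair_snd_ae χ j] with y hy
    rw [← hy, dotc_tangVec]

/-- Test functions enter only through their gradient pairs, so the cell problem is an orthogonality
relation in `CellPair`. -/
theorem isCorrector_iff (h : Admissible c C e s) (j : Fin 3) (χ : CellFunction) :
    IsCorrector ω e s j χ ↔ ∀ v ∈ cellGradients,
      inner ℂ v (cellOperator ω h (χ.pair + constPair (unitVec j))) = 0 := by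
  simp_rw [inner_cellOperator_pair, neg_add_eq_zero]
  constructor
  · intro H v hv
    obtain ⟨χ', rfl⟩ := exists_cellFunction_pair_eq hv
    exact H χ'
  · intro H v
    exact H v.pair v.pair_mem

/-- The entries are the cell form tested with constant fields; the scalars match because `(i/ω)(-iω)
= 1` and `i/ω = -1/(iω)`. -/
theorem effectiveColumn_eq (hω : ω ≠ 0) (h : Admissible c C e s) (j : Fin 3) (χ : CellFunction)
    (i : Fin 3) : effectiveColumn ω e s j χ i =
      Complex.I / ω * inner ℂ (constPair (unitVec i))
        (cellOperator ω h (χ.pair + constPair (unitVec j))) := by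
  have h1 : ∫ y, Complex.I * ω * e y * dotc (cellField j χ y) ((constPair (unitVec i)).fst y)
      ∂(cubeMeasure 3) = Complex.I * ω * ∫ y, e y * cellField j χ y i ∂(cubeMeasure 3) := by
    rw [← integral_const_mul]
    refine integral_congr_ae ?_
    filter_upwards [constPair_fst_ae (unitVec i)] with y hy
    rw [hy, dotc_eq_inner, unitVec, EuclideanSpace.inner_single_left]
    simp [mul_assoc]
  have h2 : ∫ y, s y * dotc (sheetField j χ y) (tangVec ((constPair (unitVec i)).snd y))
      ∂(cubeMeasure 2) = ∫ y, s y * sheetField j χ y i ∂(cubeMeasure 2) := by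
    refine integral_congr_ae ?_
    filter_upwards [constPair_snd_ae (unitVec i)] with y hy
    rw [hy]
    have h3 : dotc (sheetField j χ y) (tangVec !₂[unitVec i 0, unitVec i 1]) =
        sheetField j χ y i := by
      fin_cases i <;>
        simp [dotc, tangVec, unitVec, sheetField, projT, Fin.sum_univ_three]
    rw [h3]
  rw [inner_cellOperator_pair, h1, h2, effectiveColumn]
  have hω' : (ω : ℂ) ≠ 0 := by exact_mod_cast hω
  field_simp
  linear_combination (Complex.I * ω * (∫ y, e y * cellField j χ y i ∂(cubeMeasure 3)) -
    ∫ y, s y * sheetField j χ y i ∂(cubeMeasure 2)) * Complex.I_sq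

theorem inner_cellOperator_add_eq_zero_iff (h : Admissible c C e s) (p q v : CellPair) :
    inner ℂ v (cellOperator ω h (p + q)) = 0 ↔
      inner ℂ v (cellOperator ω h p) = inner ℂ v (-cellOperator ω h q) := by
  rw [map_add, inner_add_right, inner_neg_right, add_eq_zero_iff_eq_neg]

/-- Adding a constant to a corrector gives another one, so only the gradients can be unique; the
effective column sees nothing else. -/
theorem corrector_pair_unique (hω : 0 < ω) (hc : 0 < c) (h : Admissible c C e s) (j : Fin 3)
    {χ χ' : CellFunction} (hχ : IsCorrector ω e s j χ) (hχ' : IsCorrector ω e s j χ') :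
    χ.pair = χ'.pair := by
  rw [isCorrector_iff h] at hχ hχ'
  simp_rw [inner_cellOperator_add_eq_zero_iff] at hχ hχ'
  exact variational_solution_unique (lt_min (mul_pos hω hc) hc) (cellOperator_coercive hω h)
    χ.pair_mem χ'.pair_mem hχ hχ'

theorem effectiveColumn_unique (hω : 0 < ω) (hc : 0 < c) (h : Admissible c C e s) (j : Fin 3)
    {χ χ' : CellFunction} (hχ : IsCorrector ω e s j χ) (hχ' : IsCorrector ω e s j χ') (i : Fin 3) :
    effectiveColumn ω e s j χ i = effectiveColumn ω e s j χ' i := by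
  rw [effectiveColumn_eq hω.ne' h, effectiveColumn_eq hω.ne' h,
    corrector_pair_unique hω hc h j hχ hχ']

/-- Pythagoras: the gradient is orthogonal to the constant field, whose norm is `‖ξ‖` since the cell
has volume one. -/
theorem norm_sq_le_norm_add_constPair {p : CellPair} (hp : p ∈ cellGradients) (ξ : C3) :
    ‖ξ‖ ^ 2 ≤ ‖(p + constPair ξ).fst‖ ^ 2 := by
  have h0 : (p + constPair ξ).fst = p.fst + (constPair ξ).fst := rfl
  have h1 : inner ℂ (constPair ξ).fst p.fst = 0 := by
    rw [L2.inner_def, ← integral_inner_cellGradients hp ξ]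
    refine integral_congr_ae ?_
    filter_upwards [constPair_fst_ae ξ] with y hy
    rw [hy]
  have h2 : ‖(constPair ξ).fst‖ = ‖ξ‖ := by
    have := Lp.norm_const (p := 2) (μ := cubeMeasure 3) (c := ξ) (by norm_num)
    simp only [probReal_univ, Real.one_rpow, mul_one] at this
    exact this
  have h3 := norm_add_sq (𝕜 := ℂ) (constPair ξ).fst p.fst
  rw [h1, h2] at h3
  rw [h0, add_comm, h3]
  simp

theorem dotc_matVec_eq (A : Matrix (Fin 3) (Fin 3) ℂ) (ξ : C3) :
    dotc (matVec A ξ) ξ = ∑ i, starRingEnd ℂ (ξ i) * ∑ j, ξ j * A i j := by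
  simp only [dotc, matVec]
  refine Finset.sum_congr rfl fun i _ => ?_
  rw [mul_comm]
  simp only [mul_comm]

theorem sum_smul_unitVec (ξ : C3) : ∑ j, ξ j • unitVec j = ξ := by
  ext i
  fin_cases i <;> simp [unitVec, Fin.sum_univ_three]

/-- By linearity, `p = ∑ ξ_j ∇χ_j` solves the cell problem for `ξ`, and the quadratic form becomes
the full energy of `p + ξ`, whose real part is controlled. -/
theorem effective_coercive (hω : 0 < ω) (hc : 0 < c) (h : Admissible c C e s)
    {χ : Fin 3 → CellFunction} (hχ : ∀ j, IsCorrector ω e s j (χ j))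
    {A : Matrix (Fin 3) (Fin 3) ℂ} (hA : ∀ i j, A i j = effectiveColumn ω e s j (χ j) i)
    (ξ : C3) : c * ‖ξ‖ ^ 2 ≤ (dotc (matVec A ξ) ξ).im := by
  set p : CellPair := ∑ j, ξ j • (χ j).pair with hp
  have hpV : p ∈ cellGradients :=
    cellGradients.sum_mem fun j _ => cellGradients.smul_mem _ (χ j).pair_mem
  have hq : ∑ j, ξ j • ((χ j).pair + constPair (unitVec j)) = p + constPair ξ := by
    simp_rw [smul_add, Finset.sum_add_distrib]
    rw [← hp]
    congr 1
    simp_rw [← map_smul]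
    rw [← map_sum, sum_smul_unitVec]
  have h1 : dotc (matVec A ξ) ξ = Complex.I / ω *
      inner ℂ (constPair ξ) (cellOperator ω h (p + constPair ξ)) := by
    have h2 : ∀ q : CellPair, inner ℂ q (cellOperator ω h (p + constPair ξ)) =
        ∑ j, ξ j * inner ℂ q (cellOperator ω h ((χ j).pair + constPair (unitVec j))) := by
      intro q
      rw [← hq, map_sum, inner_sum]
      simp_rw [map_smul, inner_smul_right]
    have h6 : constPair ξ = ∑ i, ξ i • constPair (unitVec i) := by
      simp_rw [← map_smul]
      rw [← map_sum, sum_smul_unitVec]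
    have h7 : ∀ z, inner ℂ (constPair ξ) z =
        ∑ i, starRingEnd ℂ (ξ i) * inner ℂ (constPair (unitVec i)) z := by
      intro z
      rw [h6, sum_inner]
      simp_rw [inner_smul_left]
    rw [dotc_matVec_eq, h7, Finset.mul_sum]
    refine Finset.sum_congr rfl fun i _ => ?_
    rw [h2, Finset.mul_sum, Finset.mul_sum, Finset.mul_sum]
    refine Finset.sum_congr rfl fun j _ => ?_
    rw [hA, effectiveColumn_eq hω.ne' h]
    ring
  have h3 : inner ℂ p (cellOperator ω h (p + constPair ξ)) = 0 := by
    rw [← hq, map_sum, inner_sum]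
    refine Finset.sum_eq_zero fun j _ => ?_
    rw [map_smul, inner_smul_right, (isCorrector_iff h j (χ j)).1 (hχ j) p hpV, mul_zero]
  -- Since `p` is an admissible test pair, adding it in the left slot costs nothing.
  have h4 : dotc (matVec A ξ) ξ = Complex.I / ω *
      inner ℂ (p + constPair ξ) (cellOperator ω h (p + constPair ξ)) := by
    rw [inner_add_left, h3, zero_add, h1]
  have h5 : ∀ z : ℂ, (Complex.I / ω * z).im = z.re / ω := by
    intro z
    rw [div_mul_eq_mul_div, Complex.div_ofReal_im, Complex.I_mul_im]
  rw [h4, h5, le_div_iff₀ hω]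
  have h6 := re_inner_cellOperator_ge hω h (p + constPair ξ)
  have h7 := norm_sq_le_norm_add_constPair hpV ξ
  have h8 : 0 ≤ c * ‖(p + constPair ξ).snd‖ ^ 2 := by positivity
  have h9 := mul_le_mul_of_nonneg_left h7 (mul_pos hω hc).le
  linarith

end CellProblem

/-! ### Existence, uniqueness and measurability of the effective permittivity -/

theorem Admissible.congr {c C : ℝ} {e e' : E3 → ℂ} {s s' : E2 → ℂ} (h : Admissible c C e s)
    (he : e =ᵐ[cubeMeasure 3] e') (hs : s =ᵐ[cubeMeasure 2] s') : Admissible c C e' s' where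
  measurable_cell := h.measurable_cell.congr he
  measurable_sheet := h.measurable_sheet.congr hs
  bounds_cell := by
    filter_upwards [h.bounds_cell, he] with y h1 h2
    rwa [← h2]
  bounds_sheet := by
    filter_upwards [h.bounds_sheet, hs] with y h1 h2
    rwa [← h2]

theorem isCorrector_congr {ω : ℝ} {e e' : E3 → ℂ} {s s' : E2 → ℂ} (he : e =ᵐ[cubeMeasure 3] e')
    (hs : s =ᵐ[cubeMeasure 2] s') {j : Fin 3} {χ : CellFunction} (h : IsCorrector ω e s j χ) :
    IsCorrector ω e' s' j χ := by
  intro v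
  refine Eq.trans ?_ ((h v).trans ?_)
  · refine integral_congr_ae ?_
    filter_upwards [he] with y hy
    rw [hy]
  · refine integral_congr_ae ?_
    filter_upwards [hs] with y hy
    rw [hy]

theorem effectiveColumn_congr {ω : ℝ} {e e' : E3 → ℂ} {s s' : E2 → ℂ}
    (he : e =ᵐ[cubeMeasure 3] e') (hs : s =ᵐ[cubeMeasure 2] s') (j : Fin 3) (χ : CellFunction)
    (i : Fin 3) : effectiveColumn ω e s j χ i = effectiveColumn ω e' s' j χ i := by
  rw [effectiveColumn, effectiveColumn]
  congr 1
  · refine integral_congr_ae ?_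
    filter_upwards [he] with y hy
    rw [hy]
  · congr 1
    refine integral_congr_ae ?_
    filter_upwards [hs] with y hy
    rw [hy]

instance : TopologicalSpace.SeparableSpace (Lp C3 2 (cubeMeasure 3)) := by
  have : Fact ((2 : ENNReal) ≠ ⊤) := ⟨ENNReal.ofNat_ne_top⟩
  have : SecondCountableTopology (Lp C3 2 (cubeMeasure 3)) := Lp.SecondCountableTopology
  infer_instance

instance : TopologicalSpace.SeparableSpace (Lp C2 2 (cubeMeasure 2)) := by
  have : Fact ((2 : ENNReal) ≠ ⊤) := ⟨ENNReal.ofNat_ne_top⟩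
  have : SecondCountableTopology (Lp C2 2 (cubeMeasure 2)) := Lp.SecondCountableTopology
  infer_instance

instance : TopologicalSpace.SeparableSpace CellPair :=
  (WithLp.homeomorphProd 2 (Lp C3 2 (cubeMeasure 3))
    (Lp C2 2 (cubeMeasure 2))).symm.surjective.denseRange.separableSpace
    (WithLp.homeomorphProd 2 _ _).symm.continuous

theorem exists_measurable_effective {ω c C : ℝ} (hω : 0 < ω) (hc : 0 < c)
    {X : Type*} [MeasurableSpace X] {e : X → E3 → ℂ} {s : X → E2 → ℂ}
    (he : Measurable fun p : X × E3 => e p.1 p.2) (hs : Measurable fun p : X × E2 => s p.1 p.2)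
    (hbe : ∀ x y, c ≤ (e x y).im ∧ ‖e x y‖ ≤ C) (hbs : ∀ x y, c ≤ (s x y).re ∧ ‖s x y‖ ≤ C) :
    ∃ A : X → Matrix (Fin 3) (Fin 3) ℂ,
      (∀ x j, ∃ χ : CellFunction, IsCorrector ω (e x) (s x) j χ ∧
        ∀ i, A x i j = effectiveColumn ω (e x) (s x) j χ i) ∧
      (∀ i j, Measurable fun x => A x i j) ∧ ∃ M : ℝ, ∀ x i j, ‖A x i j‖ ≤ M := by
  -- A point of `X` is needed to read off `0 ≤ C`.
  rcases isEmpty_or_nonempty X with hX | ⟨⟨x₀⟩⟩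
  · exact ⟨fun _ => 0, fun x => hX.elim x, fun i j => measurable_const,
      0, fun x => hX.elim x⟩
  have hC : 0 ≤ C := (norm_nonneg _).trans (hbe x₀ 0).2
  have hadm : ∀ x, Admissible c C (e x) (s x) := fun x =>
    ⟨(he.comp measurable_prodMk_left).aemeasurable, (hs.comp measurable_prodMk_left).aemeasurable,
      Eventually.of_forall (hbe x), Eventually.of_forall (hbs x)⟩
  -- Weak measurability suffices: for fixed `p` and `q` these are parameter integrals of jointly
  -- measurable functions.
  have hB : ∀ p q, Measurable fun x => inner ℂ p (cellOperator ω (hadm x) q) := by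
    intro p q
    simp_rw [inner_cellOperator]
    refine Measurable.add ?_ ?_
    · refine StronglyMeasurable.measurable (StronglyMeasurable.integral_prod_right'
        (f := fun z : X × E3 => -(Complex.I * ω) * e z.1 z.2 * inner ℂ (p.fst z.2) (q.fst z.2)) ?_)
      exact (he.stronglyMeasurable.const_mul _).mul
        (((Lp.stronglyMeasurable p.fst).comp_measurable measurable_snd).inner
          ((Lp.stronglyMeasurable q.fst).comp_measurable measurable_snd))
    · refine StronglyMeasurable.measurable (StronglyMeasurable.integral_prod_right'
        (f := fun z : X × E2 => s z.1 z.2 * inner ℂ (p.snd z.2) (q.snd z.2)) ?_)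
      exact hs.stronglyMeasurable.mul
        (((Lp.stronglyMeasurable p.snd).comp_measurable measurable_snd).inner
          ((Lp.stronglyMeasurable q.snd).comp_measurable measurable_snd))
  set α := min (ω * c) c with hαdef
  have hα : 0 < α := lt_min (mul_pos hω hc) hc
  set M₀ := max (|ω| * C) C
  have hM₀ : 0 ≤ M₀ := hC.trans (le_max_right _ _)
  have hsol : ∀ j, ∃ u : X → CellPair, StronglyMeasurable u ∧ ∀ x, u x ∈ cellGradients ∧
      ∀ v ∈ cellGradients, inner ℂ v (cellOperator ω (hadm x) (u x)) =
        inner ℂ v (-cellOperator ω (hadm x) (constPair (unitVec j))) := fun j =>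
    exists_measurable_variational_solution cellGradients hB
      (stronglyMeasurable_clm_apply hB stronglyMeasurable_const).neg hα
      (le_max_left α M₀) (fun x => cellOperator_coercive hω (hadm x))
      (fun x p => (norm_cellOperator_le hC (hadm x) p).trans
        (mul_le_mul_of_nonneg_right (le_max_right _ _) (norm_nonneg _)))
  choose u hum huV hu using hsol
  refine ⟨fun x i j => Complex.I / ω * inner ℂ (constPair (unitVec i))
    (cellOperator ω (hadm x) (u j x + constPair (unitVec j))), fun x j => ?_, fun i j => ?_, ?_⟩
  · obtain ⟨χ, hχ⟩ := exists_cellFunction_pair_eq (huV j x)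
    refine ⟨χ, (isCorrector_iff (hadm x) j χ).2 fun v hv => ?_, fun i => ?_⟩
    · rw [inner_cellOperator_add_eq_zero_iff, hχ]
      exact hu j x v hv
    · rw [effectiveColumn_eq hω.ne' (hadm x), hχ]
  · exact ((stronglyMeasurable_const (b := constPair (unitVec i))).inner
      (stronglyMeasurable_clm_apply hB
        ((hum j).add stronglyMeasurable_const))).measurable.const_mul _
  · set N := ∑ i, ‖constPair (unitVec i)‖ with hN
    have hle : ∀ i, ‖constPair (unitVec i)‖ ≤ N := fun i =>
      Finset.single_le_sum (f := fun i => ‖constPair (unitVec i)‖)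
        (fun _ _ => norm_nonneg _) (Finset.mem_univ i)
    have hN0 : 0 ≤ N := (norm_nonneg _).trans (hle 0)
    -- `N` bounds the constant pairs, `M₀` the operators, and `M₀ * N / α` is the a priori bound on
    -- the corrector gradients.
    refine ⟨1 / ω * (N * (M₀ * (M₀ * N / α + N))), fun x i j => ?_⟩
    rw [norm_mul, norm_div, Complex.norm_I, Complex.norm_real, Real.norm_of_nonneg hω.le]
    have h1 : ‖cellOperator ω (hadm x) (constPair (unitVec j))‖ ≤ M₀ * N :=
      (norm_cellOperator_le hC (hadm x) _).trans (mul_le_mul_of_nonneg_left (hle j) hM₀)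
    have h2 : ‖u j x‖ ≤ M₀ * N / α := by
      have := norm_variational_solution_le hα (cellOperator_coercive hω (hadm x)) (huV j x)
        (hu j x)
      rw [norm_neg] at this
      exact this.trans (div_le_div_of_nonneg_right h1 hα.le)
    have h3 : ‖u j x + constPair (unitVec j)‖ ≤ M₀ * N / α + N :=
      (norm_add_le _ _).trans (add_le_add h2 (hle j))
    refine mul_le_mul_of_nonneg_left ((norm_inner_le_norm _ _).trans ?_) (by positivity)
    exact mul_le_mul (hle i) ((norm_cellOperator_le hC (hadm x) _).trans
      (mul_le_mul_of_nonneg_left h3 hM₀)) (norm_nonneg _) hN0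

theorem isOpen_layerDomain {S : Set E2} (hS : IsOpen S) (L : ℝ) : IsOpen (layerDomain S L) := by
  have h1 : Continuous fun x : E3 => (!₂[x 0, x 1] : E2) := by
    refine (PiLp.continuous_toLp 2 _).comp (continuous_pi fun i => ?_)
    fin_cases i <;> simp <;> fun_prop
  have h2 : Continuous fun x : E3 => x 2 := by fun_prop
  exact (hS.preimage h1).inter (isOpen_Ioo.preimage h2)

/-! ### Passage to coefficients that are measurable and bounded everywhere -/

section Coefficients

variable {Ω : Set E3} {ω c C : ℝ} {ε : E3 → E3 → ℂ} {σ : E3 → E2 → ℂ}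

/-- Bounded measurable coefficients agree almost everywhere with coefficients that are measurable
and satisfy the bounds everywhere. -/
theorem exists_measurable_coefficients (hΩ : MeasurableSet Ω) (hc : 0 < c)
    (hε_meas : AEMeasurable (fun p : E3 × E3 => ε p.1 p.2) ((volume.restrict Ω).prod volume))
    (hσ_cont : ContinuousOn (fun p : E3 × E2 => σ p.1 p.2) (Ω ×ˢ Set.univ))
    (hε : ∀ x ∈ Ω, ∀ y : E3, c ≤ (ε x y).im ∧ ‖ε x y‖ ≤ C)
    (hσ : ∀ x ∈ Ω, ∀ y : E2, c ≤ (σ x y).re ∧ ‖σ x y‖ ≤ C) :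
    ∃ (e : E3 → E3 → ℂ) (s : E3 → E2 → ℂ), Measurable (fun p : E3 × E3 => e p.1 p.2) ∧
      Measurable (fun p : E3 × E2 => s p.1 p.2) ∧
      (∀ x y, c ≤ (e x y).im ∧ ‖e x y‖ ≤ max C c) ∧
      (∀ x y, c ≤ (s x y).re ∧ ‖s x y‖ ≤ max C c) ∧
      ∀ᵐ x ∂volume.restrict Ω, e x =ᵐ[cubeMeasure 3] ε x ∧ s x =ᵐ[cubeMeasure 2] σ x := by
  classical
  set e₀ := hε_meas.mk
  have hm : Measurable e₀ := hε_meas.measurable_mk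
  -- Where the measurable version of `ε` violates the bounds it is reset to `c i`, and `σ` is reset
  -- to `c` outside `Ω`. These defaults have norm `c`, whence the bound `max C c`.
  refine ⟨fun x y =>
      if c ≤ (e₀ (x, y)).im ∧ ‖e₀ (x, y)‖ ≤ max C c then e₀ (x, y) else c * Complex.I,
    fun x y => if x ∈ Ω then σ x y else c, ?_, ?_, ?_, ?_, ?_⟩
  · refine Measurable.ite ?_ hm measurable_const
    exact (measurableSet_le measurable_const (Complex.measurable_im.comp hm)).inter
      (measurableSet_le hm.norm measurable_const)
  · have h1 : (fun p : E3 × E2 => if p.1 ∈ Ω then σ p.1 p.2 else (c : ℂ)) =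
        (Ω ×ˢ Set.univ : Set (E3 × E2)).piecewise (fun p => σ p.1 p.2) (fun _ => (c : ℂ)) := by
      ext p
      by_cases hp : p.1 ∈ Ω <;> simp [Set.piecewise, hp]
    rw [h1]
    exact hσ_cont.measurable_piecewise continuousOn_const (hΩ.prod MeasurableSet.univ)
  · intro x y
    dsimp only
    split_ifs with h
    · exact h
    · simp [abs_of_pos hc]
  · intro x y
    dsimp only
    split_ifs with h
    · exact ⟨(hσ x h y).1, (hσ x h y).2.trans (le_max_left _ _)⟩
    · simp [abs_of_pos hc]
  · filter_upwards [Measure.ae_ae_of_ae_prod hε_meas.ae_eq_mk, ae_restrict_mem hΩ] with x hx hxΩ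
    constructor
    · filter_upwards [ae_restrict_of_ae hx] with y hy
      have h2 : e₀ (x, y) = ε x y := hy.symm
      rw [h2, if_pos ⟨(hε x hxΩ y).1, (hε x hxΩ y).2.trans (le_max_left _ _)⟩]
    · filter_upwards with y
      rw [if_pos hxΩ]

variable (hΩ : MeasurableSet Ω) (hω : 0 < ω) (hc : 0 < c)
  (hε_meas : AEMeasurable (fun p : E3 × E3 => ε p.1 p.2) ((volume.restrict Ω).prod volume))
  (hσ_cont : ContinuousOn (fun p : E3 × E2 => σ p.1 p.2) (Ω ×ˢ Set.univ))
  (hε : ∀ x ∈ Ω, ∀ y : E3, c ≤ (ε x y).im ∧ ‖ε x y‖ ≤ C)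
  (hσ : ∀ x ∈ Ω, ∀ y : E2, c ≤ (σ x y).re ∧ ‖σ x y‖ ≤ C)

include hΩ hc hε_meas hσ_cont hε hσ

theorem ae_admissible : ∀ᵐ x ∂volume.restrict Ω, Admissible c (max C c) (ε x) (σ x) := by
  obtain ⟨e, s, he, hs, hbe, hbs, hae⟩ :=
    exists_measurable_coefficients hΩ hc hε_meas hσ_cont hε hσ
  filter_upwards [hae] with x hx
  exact Admissible.congr ⟨(he.comp measurable_prodMk_left).aemeasurable,
    (hs.comp measurable_prodMk_left).aemeasurable, Eventually.of_forall (hbe x),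
    Eventually.of_forall (hbs x)⟩ hx.1 hx.2

include hω

theorem exists_effectivePermittivity : ∃ εeff : E3 → Matrix (Fin 3) (Fin 3) ℂ,
    IsEffectivePermittivity Ω ω ε σ εeff ∧
    (∀ i j, Measurable (fun x => εeff x i j)) ∧ ∃ M : ℝ, ∀ x i j, ‖εeff x i j‖ ≤ M := by
  obtain ⟨e, s, he, hs, hbe, hbs, hae⟩ :=
    exists_measurable_coefficients hΩ hc hε_meas hσ_cont hε hσ
  obtain ⟨A, hA, hAm, hAb⟩ := exists_measurable_effective hω hc he hs hbe hbs
  refine ⟨A, ?_, hAm, hAb⟩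
  filter_upwards [hae] with x hx j
  obtain ⟨χ, h1, h2⟩ := hA x j
  exact ⟨χ, isCorrector_congr hx.1 hx.2 h1, fun i =>
    (h2 i).trans (effectiveColumn_congr hx.1 hx.2 j χ i)⟩

theorem effectivePermittivity_unique {εeff εeff' : E3 → Matrix (Fin 3) (Fin 3) ℂ}
    (h : IsEffectivePermittivity Ω ω ε σ εeff) (h' : IsEffectivePermittivity Ω ω ε σ εeff') :
    ∀ᵐ x ∂(volume.restrict Ω), εeff x = εeff' x := by
  filter_upwards [ae_admissible hΩ hc hε_meas hσ_cont hε hσ, h, h'] with x hadm hx hx'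
  ext i j
  obtain ⟨χ, h1, h2⟩ := hx j
  obtain ⟨χ', h1', h2'⟩ := hx' j
  rw [h2, h2', effectiveColumn_unique hω hc hadm j h1 h1']

theorem effectivePermittivity_coercive {εeff : E3 → Matrix (Fin 3) (Fin 3) ℂ}
    (h : IsEffectivePermittivity Ω ω ε σ εeff) :
    ∀ᵐ x ∂(volume.restrict Ω), ∀ ξ : C3, c * ‖ξ‖ ^ 2 ≤ (dotc (matVec (εeff x) ξ) ξ).im := by
  filter_upwards [ae_admissible hΩ hc hε_meas hσ_cont hε hσ, h] with x hadm hx ξ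
  choose χ hχ hχ' using hx
  exact effective_coercive hω hc hadm hχ (fun i j => hχ' j i) ξ

end Coefficients

/-! ### The outer unit normal -/

/-- Starting at `x` in direction `n' - n`, one enters `Ω` according to `n` and leaves it according
to `n'`. -/
theorem IsOuterNormalAt.unique {Ω : Set E3} {x n n' : E3} (h : IsOuterNormalAt Ω x n)
    (h' : IsOuterNormalAt Ω x n') : n = n' := by
  by_contra hne
  set k : ℝ := inner ℝ n n' with hk
  have hk1 : k < 1 := by
    refine lt_of_le_of_ne ?_ fun h1 => hne ?_
    · have := real_inner_le_norm n n'
      rwa [h.1, h'.1, one_mul] at this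
    · exact (inner_eq_one_iff_of_norm_eq_one h.1 h'.1).1 h1
  have hw1 : inner ℝ (n' - n) n = k - 1 := by
    rw [inner_sub_left, real_inner_self_eq_norm_sq, h.1, real_inner_comm]; norm_num [hk]
  have hw2 : inner ℝ (n' - n) n' = 1 - k := by
    rw [inner_sub_left, real_inner_self_eq_norm_sq, h'.1]; norm_num [hk]
  -- Small enough that the direction `n' - n` lies strictly inside both cones.
  set δ : ℝ := (1 - k) / (2 * (‖n' - n‖ + 1)) with hδ
  have hpos : 0 < ‖n' - n‖ + 1 := by positivity
  have hδ0 : 0 < δ := div_pos (by linarith) (by positivity)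
  have hδ1 : δ * ‖n' - n‖ < 1 - k := by
    rw [hδ, div_mul_eq_mul_div, div_lt_iff₀ (by positivity)]
    nlinarith [norm_nonneg (n' - n)]
  have hcont : Tendsto (fun τ : ℝ => x + τ • (n' - n)) (𝓝[>] 0) (𝓝 x) := by
    have : Continuous fun τ : ℝ => x + τ • (n' - n) := by fun_prop
    have h2 := this.tendsto 0
    simp only [zero_smul, add_zero] at h2
    exact h2.mono_left nhdsWithin_le_nhds
  have hev := (hcont.eventually ((h.2 δ hδ0).and (h'.2 δ hδ0))).and self_mem_nhdsWithin
  obtain ⟨τ, ⟨h1, h2⟩, hτ⟩ := hev.exists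
  have hτ0 : 0 < τ := hτ
  rw [add_sub_cancel_left, norm_smul, Real.norm_of_nonneg hτ0.le, real_inner_smul_left] at h1 h2
  rw [hw1] at h1
  rw [hw2] at h2
  have e1 : τ * (k - 1) < -(δ * (τ * ‖n' - n‖)) := by nlinarith
  have e2 : δ * (τ * ‖n' - n‖) < τ * (1 - k) := by nlinarith
  exact h2.2 e2 (h1.1 e1)

theorem outerNormal_eq {Ω : Set E3} {x n : E3} (h : IsOuterNormalAt Ω x n) :
    outerNormal Ω x = n := by
  have hex : ∃ n, IsOuterNormalAt Ω x n := ⟨n, h⟩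
  rw [outerNormal, dif_pos hex]
  exact hex.choose_spec.unique h

/-- The horizontal coordinates of a point of space. -/
noncomputable def horiz : E3 →L[ℝ] E2 :=
  LinearMap.toContinuousLinearMap
    { toFun := fun x => !₂[x 0, x 1]
      map_add' := fun x y => by ext i; fin_cases i <;> simp
      map_smul' := fun a x => by ext i; fin_cases i <;> simp }

@[simp] theorem horiz_apply_zero (x : E3) : horiz x 0 = x 0 := rfl
@[simp] theorem horiz_apply_one (x : E3) : horiz x 1 = x 1 := rfl

/-- The point of space with given horizontal and vertical coordinates. -/
noncomputable def spacePoint : E2 × ℝ →L[ℝ] E3 :=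
  LinearMap.toContinuousLinearMap
    { toFun := fun q => !₂[q.1 0, q.1 1, q.2]
      map_add' := fun x y => by ext i; fin_cases i <;> simp
      map_smul' := fun a x => by ext i; fin_cases i <;> simp }

theorem spacePoint_apply (q : E2 × ℝ) : spacePoint q = !₂[q.1 0, q.1 1, q.2] := rfl

theorem spacePoint_horiz (x : E3) : spacePoint (horiz x, x 2) = x := by
  rw [spacePoint_apply]
  ext i; fin_cases i <;> simp

theorem inner_spacePoint (x : E3) (q : E2) :
    inner ℝ x (spacePoint (q, 0)) = inner ℝ (horiz x) q := by
  simp [spacePoint_apply, PiLp.inner_apply, Fin.sum_univ_three]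

theorem norm_horiz_le (x : E3) : ‖horiz x‖ ≤ ‖x‖ := by
  rw [EuclideanSpace.norm_eq, EuclideanSpace.norm_eq]
  refine Real.sqrt_le_sqrt ?_
  simp only [Fin.sum_univ_two, Fin.sum_univ_three, horiz_apply_zero, horiz_apply_one]
  nlinarith [sq_nonneg ‖x 2‖]

theorem norm_spacePoint_zero (q : E2) : ‖spacePoint (q, 0)‖ = ‖q‖ := by
  rw [EuclideanSpace.norm_eq, EuclideanSpace.norm_eq]
  simp [spacePoint_apply, Fin.sum_univ_three]

theorem mem_layerDomain {S : Set E2} {L : ℝ} {x : E3} :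
    x ∈ layerDomain S L ↔ horiz x ∈ S ∧ x 2 ∈ Set.Ioo (-L) L := Iff.rfl

theorem continuous_coord (i : Fin 3) : Continuous fun x : E3 => x i := by fun_prop

/-- Over the open set `S` the cylinder is locally a half space; `κ` is the sign of the height, and
`κ y₃ > 0` keeps away from the opposite cap. -/
theorem isOuterNormalAt_cap {S : Set E2} (hS : IsOpen S) {L : ℝ} (hL : 0 < L) {x : E3}
    (hx : horiz x ∈ S) {κ : ℝ} (hκ : κ = 1 ∨ κ = -1) (hz : x 2 = κ * L) :
    IsOuterNormalAt (layerDomain S L) x (EuclideanSpace.single 2 κ) := by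
  have hinner : ∀ y : E3, inner ℝ y (EuclideanSpace.single 2 κ) = κ * y 2 := by
    intro y
    simp [EuclideanSpace.inner_single_right]
  refine ⟨by rcases hκ with rfl | rfl <;> simp, fun δ hδ => ?_⟩
  have h1 : ∀ᶠ y in 𝓝 x, horiz y ∈ S := horiz.continuous.continuousAt.eventually (hS.mem_nhds hx)
  have h2 : ∀ᶠ y : E3 in 𝓝 x, 0 < κ * y 2 := by
    refine ((continuous_coord 2).const_mul κ).continuousAt.eventually (lt_mem_nhds ?_)
    change 0 < κ * x 2
    rw [hz]
    rcases hκ with rfl | rfl <;> simpa using hL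
  filter_upwards [h1, h2] with y hy1 hy2
  have h0 : 0 ≤ δ * ‖y - x‖ := by positivity
  rw [hinner, PiLp.sub_apply, hz]
  constructor
  · intro h
    refine mem_layerDomain.2 ⟨hy1, ?_⟩
    rcases hκ with rfl | rfl <;> constructor <;> linarith
  · intro h hy
    obtain ⟨-, h3, h4⟩ := mem_layerDomain.1 hy
    rcases hκ with rfl | rfl <;> linarith

/-- Local coordinates in which `S` is the set above the graph of a Lipschitz function. -/
structure BoundaryChart (S : Set E2) (p : E2) where
  /-- direction of the abscissa -/
  e : E2
  /-- direction of the ordinate -/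
  n : E2
  /-- the function -/
  f : ℝ → ℝ
  /-- its Lipschitz constant -/
  K : ℝ≥0
  /-- width of the chart -/
  r : ℝ
  /-- height of the chart -/
  h : ℝ
  orthonormal : Orthonormal ℝ ![e, n]
  lipschitz : LipschitzWith K f
  r_pos : 0 < r
  h_pos : 0 < h
  mem_iff : ∀ s t : ℝ, |s| < r → |t| < h → (p + s • e + t • n ∈ S ↔ f s < t)

theorem HasLipschitzBoundary.nonempty_chart {S : Set E2} (hS : HasLipschitzBoundary S) {p : E2}
    (hp : p ∈ frontier S) : Nonempty (BoundaryChart S p) := by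
  obtain ⟨e, n, f, K, r, h, h1, h2, h3, h4, h5⟩ := hS p hp
  exact ⟨⟨e, n, f, K, r, h, h1, h2, h3, h4, h5⟩⟩

namespace BoundaryChart

variable {S : Set E2} {p : E2} (χ : BoundaryChart S p)

/-- The first coordinate in the chart. -/
noncomputable def abscissa (x : E2) : ℝ := inner ℝ χ.e (x - p)

/-- The second coordinate in the chart. -/
noncomputable def ordinate (x : E2) : ℝ := inner ℝ χ.n (x - p)

theorem continuous_abscissa : Continuous χ.abscissa := by
  unfold abscissa; fun_prop

theorem continuous_ordinate : Continuous χ.ordinate := by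
  unfold ordinate; fun_prop

theorem norm_e : ‖χ.e‖ = 1 := by simpa using χ.orthonormal.1 0

theorem norm_n : ‖χ.n‖ = 1 := by simpa using χ.orthonormal.1 1

theorem inner_e_n : inner ℝ χ.e χ.n = 0 := by
  simpa using χ.orthonormal.2 (show (0 : Fin 2) ≠ 1 by decide)

theorem eq_add (x : E2) : p + χ.abscissa x • χ.e + χ.ordinate x • χ.n = x := by
  have hcard : Fintype.card (Fin 2) = Module.finrank ℝ E2 := by simp
  let b := (basisOfOrthonormalOfCardEqFinrank χ.orthonormal hcard).toOrthonormalBasis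
    (by simpa using χ.orthonormal)
  have hb : ∀ i, b i = ![χ.e, χ.n] i := fun i => by simp [b]
  have h := b.sum_repr' (x - p)
  rw [Fin.sum_univ_two, hb, hb] at h
  simp only [Matrix.cons_val_zero, Matrix.cons_val_one] at h
  rw [abscissa, ordinate, add_assoc, h]
  abel

/-- The points of the plane that are covered by the chart. -/
def box : Set E2 := {x | |χ.abscissa x| < χ.r ∧ |χ.ordinate x| < χ.h}

theorem isOpen_box : IsOpen χ.box :=
  (isOpen_lt χ.continuous_abscissa.abs continuous_const).inter
    (isOpen_lt χ.continuous_ordinate.abs continuous_const)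

theorem mem_box_self : p ∈ χ.box := by
  simp [box, abscissa, ordinate, χ.r_pos, χ.h_pos]

theorem mem_iff_of_mem_box {x : E2} (hx : x ∈ χ.box) :
    x ∈ S ↔ χ.f (χ.abscissa x) < χ.ordinate x := by
  have h := χ.mem_iff _ _ hx.1 hx.2
  rwa [χ.eq_add] at h

/-- Strictly below the graph a whole neighbourhood misses `S`, and strictly above it a whole
neighbourhood lies in `S`. -/
theorem ordinate_eq_of_mem_frontier {x : E2} (hx : x ∈ χ.box) (hf : x ∈ frontier S) :
    χ.ordinate x = χ.f (χ.abscissa x) := by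
  have hc1 : Continuous fun y => χ.f (χ.abscissa y) :=
    χ.lipschitz.continuous.comp χ.continuous_abscissa
  have hbox := χ.isOpen_box.mem_nhds hx
  rcases lt_trichotomy (χ.ordinate x) (χ.f (χ.abscissa x)) with h | h | h
  · exfalso
    have h1 : ∀ᶠ y in 𝓝 x, y ∉ S := by
      filter_upwards [hbox, (isOpen_lt χ.continuous_ordinate hc1).mem_nhds h] with y hy1 hy2
      rw [χ.mem_iff_of_mem_box hy1]
      exact not_lt.2 (le_of_lt hy2)
    obtain ⟨y, hy1, hy2⟩ := ((mem_closure_iff_frequently.1 hf.1).and_eventually h1).exists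
    exact hy2 hy1
  · exact h
  · exfalso
    refine hf.2 (mem_interior_iff_mem_nhds.2 ?_)
    filter_upwards [hbox, (isOpen_lt hc1 χ.continuous_ordinate).mem_nhds h] with y hy1 hy2
    exact (χ.mem_iff_of_mem_box hy1).2 hy2

/-- The unit normal to the graph, as a function of the slope. -/
noncomputable def slopeNormal (m : ℝ) : E3 :=
  (Real.sqrt (1 + m ^ 2))⁻¹ • spacePoint (m • χ.e - χ.n, 0)

theorem norm_slopeNormal (m : ℝ) : ‖χ.slopeNormal m‖ = 1 := by
  have h1 : ‖m • χ.e - χ.n‖ ^ 2 = 1 + m ^ 2 := by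
    rw [norm_sub_sq_real, norm_smul, χ.norm_e, χ.norm_n, real_inner_smul_left, χ.inner_e_n]
    simp only [Real.norm_eq_abs, mul_one, sq_abs]
    ring
  have h2 : ‖m • χ.e - χ.n‖ = Real.sqrt (1 + m ^ 2) := by
    rw [← h1, Real.sqrt_sq (norm_nonneg _)]
  have h3 : 0 < Real.sqrt (1 + m ^ 2) := Real.sqrt_pos.2 (by positivity)
  rw [slopeNormal, norm_smul, norm_spacePoint_zero, h2, norm_inv, Real.norm_of_nonneg h3.le,
    inv_mul_cancel₀ h3.ne']

theorem inner_slopeNormal (m : ℝ) (x y : E3) :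
    inner ℝ (y - x) (χ.slopeNormal m) = (Real.sqrt (1 + m ^ 2))⁻¹ *
      (m * (χ.abscissa (horiz y) - χ.abscissa (horiz x)) -
        (χ.ordinate (horiz y) - χ.ordinate (horiz x))) := by
  rw [slopeNormal, real_inner_smul_right, inner_spacePoint, map_sub, inner_sub_right,
    real_inner_smul_right, abscissa, abscissa, ordinate, ordinate, ← inner_sub_right,
    ← inner_sub_right, sub_sub_sub_cancel_right, real_inner_comm, real_inner_comm χ.n]

theorem abs_abscissa_sub_le (x y : E3) :
    |χ.abscissa (horiz y) - χ.abscissa (horiz x)| ≤ ‖y - x‖ := by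
  rw [abscissa, abscissa, ← inner_sub_right, sub_sub_sub_cancel_right, ← map_sub]
  refine (abs_real_inner_le_norm _ _).trans ?_
  rw [χ.norm_e, one_mul]
  exact norm_horiz_le _

/-- Differentiability at the single abscissa replaces the graph by its tangent up to `δ‖y - x‖`,
exactly the tolerance in the definition; the normalising root is at least `1` and only helps. -/
theorem isOuterNormalAt_side {L : ℝ} {x : E3} (hx : horiz x ∈ χ.box)
    (hgraph : χ.ordinate (horiz x) = χ.f (χ.abscissa (horiz x)))
    (hdiff : DifferentiableAt ℝ χ.f (χ.abscissa (horiz x))) (hz : x 2 ∈ Set.Ioo (-L) L) :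
    IsOuterNormalAt (layerDomain S L) x
      (χ.slopeNormal (deriv χ.f (χ.abscissa (horiz x)))) := by
  refine ⟨χ.norm_slopeNormal _, fun δ hδ => ?_⟩
  set m := deriv χ.f (χ.abscissa (horiz x)) with hm
  have h1 : ∀ᶠ y in 𝓝 x, horiz y ∈ χ.box :=
    horiz.continuous.continuousAt.eventually (χ.isOpen_box.mem_nhds hx)
  have h2 : ∀ᶠ y : E3 in 𝓝 x, y 2 ∈ Set.Ioo (-L) L :=
    (continuous_coord 2).continuousAt.eventually (isOpen_Ioo.mem_nhds hz)
  have h3 : ∀ᶠ y : E3 in 𝓝 x, ‖χ.f (χ.abscissa (horiz y)) - χ.f (χ.abscissa (horiz x)) -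
      (χ.abscissa (horiz y) - χ.abscissa (horiz x)) • m‖ ≤
      δ * ‖χ.abscissa (horiz y) - χ.abscissa (horiz x)‖ := by
    have hd := (hasDerivAt_iff_isLittleO.1 hdiff.hasDerivAt).def hδ
    exact (χ.continuous_abscissa.comp horiz.continuous).continuousAt.eventually hd
  filter_upwards [h1, h2, h3] with y hy1 hy2 hy3
  have hD : 1 ≤ Real.sqrt (1 + m ^ 2) := by
    rw [Real.one_le_sqrt]; nlinarith [sq_nonneg m]
  have hD0 : 0 < Real.sqrt (1 + m ^ 2) := by linarith
  have ha := χ.abs_abscissa_sub_le x y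
  rw [χ.inner_slopeNormal]
  rw [smul_eq_mul, Real.norm_eq_abs, Real.norm_eq_abs] at hy3
  have hmem := χ.mem_iff_of_mem_box hy1
  set Δ := χ.abscissa (horiz y) - χ.abscissa (horiz x)
  obtain ⟨hy4, hy5⟩ := abs_le.1 hy3
  have hn : 0 ≤ ‖y - x‖ := norm_nonneg _
  have hb1 : δ * |Δ| ≤ δ * ‖y - x‖ := mul_le_mul_of_nonneg_left ha hδ.le
  have hb2 : δ * ‖y - x‖ ≤ δ * ‖y - x‖ * Real.sqrt (1 + m ^ 2) :=
    le_mul_of_one_le_right (by positivity) hD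
  constructor
  · intro h
    rw [inv_mul_eq_div, div_lt_iff₀ hD0] at h
    refine mem_layerDomain.2 ⟨hmem.2 ?_, hy2⟩
    rw [hgraph] at h
    linarith
  · intro h hy
    rw [inv_mul_eq_div, lt_div_iff₀ hD0] at h
    have h6 := hmem.1 (mem_layerDomain.1 hy).1
    rw [hgraph] at h
    linarith

end BoundaryChart

/-! ### The surface measure of the boundary of the cylinder -/

/-- A Lipschitz map enlarges two-dimensional Hausdorff measure by at most `K²`. On `ℝ × ℝ` that
measure is Lebesgue measure, and `a` is the factor between the two normalisations. -/
theorem euclideanHausdorffMeasure_image_le {g : ℝ × ℝ → E3} {K : ℝ≥0} (hg : LipschitzWith K g) :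
    ∃ k : ℝ≥0, ∀ A : Set (ℝ × ℝ), (μHE[2] : Measure E3) (g '' A) ≤ k * volume A := by
  set a := Measure.addHaarScalarFactor (volume : Measure (EuclideanSpace ℝ (Fin 2))) μH[(2 : ℕ)]
  refine ⟨a * K ^ 2, fun A => ?_⟩
  have h := hg.hausdorffMeasure_image_le (d := 2) (by norm_num) A
  rw [hausdorffMeasure_prod_real] at h
  rw [Measure.euclideanHausdorffMeasure_def, Measure.smul_apply, ENNReal.smul_def, smul_eq_mul,
    ENNReal.coe_mul, mul_assoc]
  refine mul_le_mul_right ?_ _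
  norm_num at h ⊢
  exact h

theorem euclideanHausdorffMeasure_image_eq_zero {g : ℝ × ℝ → E3} {K : ℝ≥0}
    (hg : LipschitzWith K g) {A : Set (ℝ × ℝ)} (hA : volume A = 0) :
    (μHE[2] : Measure E3) (g '' A) = 0 := by
  obtain ⟨k, hk⟩ := euclideanHausdorffMeasure_image_le hg
  have := hk A
  rw [hA, mul_zero] at this
  exact le_antisymm this bot_le

theorem euclideanHausdorffMeasure_image_lt_top {g : ℝ × ℝ → E3} {K : ℝ≥0}
    (hg : LipschitzWith K g) {A : Set (ℝ × ℝ)} (hA : volume A < ⊤) :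
    (μHE[2] : Measure E3) (g '' A) < ⊤ := by
  obtain ⟨k, hk⟩ := euclideanHausdorffMeasure_image_le hg
  exact (hk A).trans_lt (ENNReal.mul_lt_top ENNReal.coe_lt_top hA)

/-- The points above `S` at height `z`. -/
def capSet (S : Set E2) (z : ℝ) : Set E3 := {x | horiz x ∈ S ∧ x 2 = z}

theorem measure_capSet_lt_top {S : Set E2} (hS : Bornology.IsBounded S) (z : ℝ) :
    (μHE[2] : Measure E3) (capSet S z) < ⊤ := by
  obtain ⟨R, hR⟩ := hS.exists_norm_le
  set T : ℝ × ℝ →L[ℝ] E2 × ℝ := LinearMap.toContinuousLinearMap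
    { toFun := fun w => (!₂[w.1, w.2], 0)
      map_add' := fun x y => by ext i <;> [(fin_cases i <;> simp); simp]
      map_smul' := fun a x => by ext i <;> [(fin_cases i <;> simp); simp] } with hT
  set g : ℝ × ℝ → E3 := fun w => spacePoint (T w) + spacePoint (0, z)
  have hg : LipschitzWith ‖spacePoint ∘L T‖₊ g := by
    refine LipschitzWith.of_dist_le_mul fun x y => ?_
    rw [dist_add_right]
    exact (spacePoint ∘L T).lipschitz.dist_le_mul x y
  have hsub : capSet S z ⊆ g '' (Set.Icc (-R) R ×ˢ Set.Icc (-R) R) := by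
    rintro x ⟨hx, hz⟩
    have h1 := hR _ hx
    refine ⟨(x 0, x 1), ⟨?_, ?_⟩, ?_⟩
    · exact abs_le.1 ((PiLp.norm_apply_le (horiz x) 0).trans h1)
    · exact abs_le.1 ((PiLp.norm_apply_le (horiz x) 1).trans h1)
    · simp only [g]
      rw [← map_add, ← hz, ← spacePoint_horiz x]
      congr 1
      ext i
      · fin_cases i <;> simp [hT, spacePoint_apply]
      · simp [hT, spacePoint_apply]
  refine (measure_mono hsub).trans_lt (euclideanHausdorffMeasure_image_lt_top hg ?_)
  rw [Measure.volume_eq_prod, Measure.prod_prod]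
  exact ENNReal.mul_lt_top measure_Icc_lt_top measure_Icc_lt_top

theorem measurableSet_capSet {S : Set E2} (hS : IsOpen S) (z : ℝ) : MeasurableSet (capSet S z) :=
  (hS.measurableSet.preimage horiz.continuous.measurable).inter
    (isClosed_eq (continuous_coord 2) continuous_const).measurableSet

namespace BoundaryChart

variable {S : Set E2} {p : E2} (χ : BoundaryChart S p)

/-- The part of the lateral boundary covered by a chart. -/
def sideSet (L : ℝ) : Set E3 :=
  {x | horiz x ∈ χ.box ∧ χ.ordinate (horiz x) = χ.f (χ.abscissa (horiz x)) ∧ x 2 ∈ Set.Icc (-L) L}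

/-- The part of the lateral boundary covered by a chart where there is a normal. -/
def regularSet (L : ℝ) : Set E3 :=
  {x | horiz x ∈ χ.box ∧ χ.ordinate (horiz x) = χ.f (χ.abscissa (horiz x)) ∧
    DifferentiableAt ℝ χ.f (χ.abscissa (horiz x)) ∧ x 2 ∈ Set.Ioo (-L) L}

/-- The parametrization of the lateral boundary. -/
noncomputable def param (w : ℝ × ℝ) : E3 :=
  spacePoint (p + w.1 • χ.e + χ.f w.1 • χ.n, w.2)

theorem exists_lipschitz_param : ∃ K : ℝ≥0, LipschitzWith K χ.param := by
  have h1 : LipschitzWith ‖ContinuousLinearMap.toSpanSingleton ℝ χ.e‖₊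
      (fun s : ℝ => s • χ.e) := (ContinuousLinearMap.toSpanSingleton ℝ χ.e).lipschitz
  have h2 : LipschitzWith ‖ContinuousLinearMap.toSpanSingleton ℝ χ.n‖₊
      (fun s : ℝ => s • χ.n) := (ContinuousLinearMap.toSpanSingleton ℝ χ.n).lipschitz
  have h3 := ((LipschitzWith.const p).add h1).add (h2.comp χ.lipschitz)
  exact ⟨_, spacePoint.lipschitz.comp ((h3.comp LipschitzWith.prod_fst).prodMk
    LipschitzWith.prod_snd)⟩

theorem param_eq {L : ℝ} {x : E3} (hx : x ∈ χ.sideSet L) :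
    χ.param (χ.abscissa (horiz x), x 2) = x := by
  rw [param]
  simp only
  rw [← hx.2.1, χ.eq_add, spacePoint_horiz]

theorem measure_sideSet_lt_top (L : ℝ) : (μHE[2] : Measure E3) (χ.sideSet L) < ⊤ := by
  obtain ⟨K, hK⟩ := χ.exists_lipschitz_param
  have hsub : χ.sideSet L ⊆ χ.param '' (Set.Icc (-χ.r) χ.r ×ˢ Set.Icc (-L) L) := fun x hx =>
    ⟨_, ⟨abs_le.1 hx.1.1.le, hx.2.2⟩, χ.param_eq hx⟩
  refine (measure_mono hsub).trans_lt (euclideanHausdorffMeasure_image_lt_top hK ?_)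
  rw [Measure.volume_eq_prod, Measure.prod_prod]
  exact ENNReal.mul_lt_top measure_Icc_lt_top measure_Icc_lt_top

/-- The bad parameters are the abscissae where `f` is not differentiable, null by Rademacher's
theorem, and the two edges at height `±L`. Lipschitz images of planar null sets are null. -/
theorem measure_sideSet_sdiff_regularSet (L : ℝ) :
    (μHE[2] : Measure E3) (χ.sideSet L \ χ.regularSet L) = 0 := by
  obtain ⟨K, hK⟩ := χ.exists_lipschitz_param
  have hsub : χ.sideSet L \ χ.regularSet L ⊆ χ.param ''
      (({s | ¬ DifferentiableAt ℝ χ.f s} ×ˢ Set.univ) ∪ (Set.univ ×ˢ {-L, L})) := by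
    rintro x ⟨hx, hn⟩
    refine ⟨_, ?_, χ.param_eq hx⟩
    by_contra hcon
    simp only [Set.mem_union, Set.mem_prod, Set.mem_univ, and_true, true_and, not_or,
      Set.mem_insert_iff, Set.mem_singleton_iff] at hcon
    refine hn ⟨hx.1, hx.2.1, not_not.1 hcon.1, ?_, ?_⟩
    · exact lt_of_le_of_ne hx.2.2.1 (Ne.symm hcon.2.1)
    · exact lt_of_le_of_ne hx.2.2.2 hcon.2.2
  refine measure_mono_null hsub (euclideanHausdorffMeasure_image_eq_zero hK ?_)
  have h1 : volume {s | ¬ DifferentiableAt ℝ χ.f s} = 0 := χ.lipschitz.ae_differentiableAt_real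
  have h2 : volume ({-L, L} : Set ℝ) = 0 := (Set.toFinite _).measure_zero _
  refine measure_union_null ?_ ?_
  · rw [Measure.volume_eq_prod, Measure.prod_prod, h1, zero_mul]
  · rw [Measure.volume_eq_prod, Measure.prod_prod, h2, mul_zero]

theorem outerNormal_eq_of_mem_regularSet {L : ℝ} {x : E3} (hx : x ∈ χ.regularSet L) :
    outerNormal (layerDomain S L) x =
      χ.slopeNormal (deriv χ.f (χ.abscissa (horiz x))) :=
  outerNormal_eq (χ.isOuterNormalAt_side hx.1 hx.2.1 hx.2.2.1 hx.2.2.2)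

theorem measurable_abscissa_horiz : Measurable fun x : E3 => χ.abscissa (horiz x) :=
  (χ.continuous_abscissa.comp horiz.continuous).measurable

theorem measurableSet_regularSet (L : ℝ) : MeasurableSet (χ.regularSet L) := by
  refine (χ.isOpen_box.measurableSet.preimage horiz.continuous.measurable).inter
    (MeasurableSet.inter ?_ (MeasurableSet.inter ?_ ?_))
  · exact (isClosed_eq (χ.continuous_ordinate.comp horiz.continuous)
      (χ.lipschitz.continuous.comp
        (χ.continuous_abscissa.comp horiz.continuous))).measurableSet
  · exact (measurableSet_of_differentiableAt ℝ χ.f).preimage χ.measurable_abscissa_horiz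
  · exact measurableSet_Ioo.preimage (continuous_coord 2).measurable

theorem continuous_slopeNormal : Continuous χ.slopeNormal := by
  have h1 : ∀ m : ℝ, Real.sqrt (1 + m ^ 2) ≠ 0 := fun m =>
    (Real.sqrt_pos.2 (by positivity)).ne'
  have h2 : Continuous fun m : ℝ => Real.sqrt (1 + m ^ 2) := by fun_prop
  refine (h2.inv₀ h1).smul (spacePoint.continuous.comp ?_)
  fun_prop

/-- On the regular set the normal, defined by choice, equals an explicit function of the measurable
derivative of `f`. -/
theorem aemeasurable_outerNormal (L : ℝ) (μ : Measure E3) :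
    AEMeasurable (outerNormal (layerDomain S L)) (μ.restrict (χ.regularSet L)) := by
  have h : Measurable fun x : E3 => χ.slopeNormal (deriv χ.f (χ.abscissa (horiz x))) :=
    χ.continuous_slopeNormal.measurable.comp
      ((measurable_deriv χ.f).comp χ.measurable_abscissa_horiz)
  refine h.aemeasurable.congr ?_
  filter_upwards [ae_restrict_mem (χ.measurableSet_regularSet L)] with x hx
  rw [χ.outerNormal_eq_of_mem_regularSet hx]

end BoundaryChart

/-! ### Covering the boundary by two caps and finitely many charts -/

section Boundary

variable {S : Set E2} {L : ℝ}

/-- Finitely many charts cover the lateral boundary. -/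
theorem exists_finset_charts (hS_bdd : Bornology.IsBounded S) (hS_lip : HasLipschitzBoundary S) :
    ∃ (t : Finset (frontier S)) (χ : ∀ p : frontier S, BoundaryChart S p),
      frontier S ⊆ ⋃ p ∈ t, (χ p).box := by
  have hc : IsCompact (frontier S) :=
    Metric.isCompact_of_isClosed_isBounded isClosed_frontier
      (hS_bdd.closure.subset frontier_subset_closure)
  let χ : ∀ p : frontier S, BoundaryChart S p := fun p => (hS_lip.nonempty_chart p.2).some
  obtain ⟨t, ht⟩ := hc.elim_finite_subcover (fun p : frontier S => (χ p).box)
    (fun p => (χ p).isOpen_box)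
    (fun p hp => Set.mem_iUnion.2 ⟨⟨p, hp⟩, (χ ⟨p, hp⟩).mem_box_self⟩)
  exact ⟨t, χ, ht⟩

/-- A boundary point above `S` must have height `±L`; any other projects to the boundary of `S`. The
edges fall into the closed side sets. -/
theorem frontier_layerDomain_subset (hS_open : IsOpen S) {t : Finset (frontier S)}
    {χ : ∀ p : frontier S, BoundaryChart S p} (ht : frontier S ⊆ ⋃ p ∈ t, (χ p).box) :
    frontier (layerDomain S L) ⊆
      (capSet S (1 * L) ∪ capSet S (-1 * L)) ∪ ⋃ p ∈ t, (χ p).sideSet L := by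
  intro x hx
  have hcl : layerDomain S L ⊆ {x | horiz x ∈ closure S ∧ x 2 ∈ Set.Icc (-L) L} := fun y hy =>
    ⟨subset_closure (mem_layerDomain.1 hy).1, Set.Ioo_subset_Icc_self (mem_layerDomain.1 hy).2⟩
  have hclosed : IsClosed {x : E3 | horiz x ∈ closure S ∧ x 2 ∈ Set.Icc (-L) L} :=
    (isClosed_closure.preimage horiz.continuous).inter
      (isClosed_Icc.preimage (continuous_coord 2))
  obtain ⟨h1, h2⟩ := closure_minimal hcl hclosed hx.1
  have h3 : x ∉ layerDomain S L := by
    have := hx.2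
    rwa [(isOpen_layerDomain hS_open L).interior_eq] at this
  by_cases hxS : horiz x ∈ S
  · left
    rcases h2.1.eq_or_lt with h4 | h4
    · right
      exact ⟨hxS, by linarith⟩
    · rcases h2.2.eq_or_lt with h5 | h5
      · left
        exact ⟨hxS, by linarith⟩
      · exact absurd (mem_layerDomain.2 ⟨hxS, h4, h5⟩) h3
  · right
    have hf : horiz x ∈ frontier S := ⟨h1, by rwa [hS_open.interior_eq]⟩
    obtain ⟨p, hp, hbox⟩ := Set.mem_iUnion₂.1 (ht hf)
    exact Set.mem_iUnion₂.2 ⟨p, hp, hbox, (χ p).ordinate_eq_of_mem_frontier hbox hf, h2⟩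

theorem isFiniteMeasure_surfaceMeasure (hS_open : IsOpen S) (hS_bdd : Bornology.IsBounded S)
    (hS_lip : HasLipschitzBoundary S) : IsFiniteMeasure (surfaceMeasure (layerDomain S L)) := by
  obtain ⟨t, χ, ht⟩ := exists_finset_charts hS_bdd hS_lip
  refine ⟨?_⟩
  rw [surfaceMeasure, Measure.restrict_apply_univ]
  refine (measure_mono (frontier_layerDomain_subset hS_open ht)).trans_lt ?_
  refine measure_union_lt_top (measure_union_lt_top (measure_capSet_lt_top hS_bdd _)
    (measure_capSet_lt_top hS_bdd _)) ?_
  exact (measure_biUnion_finset_le t _).trans_lt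
    (ENNReal.sum_lt_top.2 fun p _ => (χ p).measure_sideSet_lt_top L)

theorem exists_regular_cover (hS_open : IsOpen S) (hS_bdd : Bornology.IsBounded S)
    (hS_lip : HasLipschitzBoundary S) :
    ∃ (t : Finset (frontier S)) (χ : ∀ p : frontier S, BoundaryChart S p),
      ∀ᵐ x ∂surfaceMeasure (layerDomain S L),
        x ∈ (capSet S (1 * L) ∪ capSet S (-1 * L)) ∪ ⋃ p ∈ t, (χ p).regularSet L := by
  obtain ⟨t, χ, ht⟩ := exists_finset_charts hS_bdd hS_lip
  refine ⟨t, χ, ?_⟩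
  have h1 : ∀ᵐ x ∂(μHE[2] : Measure E3), ∀ p ∈ t, x ∉ (χ p).sideSet L \ (χ p).regularSet L :=
    (Finset.eventually_all t).2 fun p _ =>
      measure_eq_zero_iff_ae_notMem.1 ((χ p).measure_sideSet_sdiff_regularSet L)
  filter_upwards [ae_restrict_of_ae h1, ae_restrict_mem isClosed_frontier.measurableSet]
    with x hx hxf
  rcases frontier_layerDomain_subset hS_open ht hxf with h | h
  · exact Or.inl h
  · right
    obtain ⟨p, hp, hside⟩ := Set.mem_iUnion₂.1 h
    refine Set.mem_iUnion₂.2 ⟨p, hp, ?_⟩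
    by_contra hn
    exact hx p hp ⟨hside, hn⟩

theorem outerNormal_eq_of_mem_capSet (hS_open : IsOpen S) (hL : 0 < L) {κ : ℝ}
    (hκ : κ = 1 ∨ κ = -1) {x : E3} (hx : x ∈ capSet S (κ * L)) :
    outerNormal (layerDomain S L) x = EuclideanSpace.single 2 κ :=
  outerNormal_eq (isOuterNormalAt_cap hS_open hL hx.1 hκ hx.2)

theorem ae_norm_outerNormal (hS_open : IsOpen S) (hS_bdd : Bornology.IsBounded S)
    (hS_lip : HasLipschitzBoundary S) (hL : 0 < L) :
    ∀ᵐ x ∂surfaceMeasure (layerDomain S L), ‖outerNormal (layerDomain S L) x‖ = 1 := by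
  obtain ⟨t, χ, h⟩ := exists_regular_cover (L := L) hS_open hS_bdd hS_lip
  filter_upwards [h] with x hx
  rcases hx with (hx | hx) | hx
  · rw [outerNormal_eq_of_mem_capSet hS_open hL (Or.inl rfl) hx]
    simp
  · rw [outerNormal_eq_of_mem_capSet hS_open hL (Or.inr rfl) hx]
    simp
  · obtain ⟨p, -, hreg⟩ := Set.mem_iUnion₂.1 hx
    rw [(χ p).outerNormal_eq_of_mem_regularSet hreg, (χ p).norm_slopeNormal]

theorem aemeasurable_outerNormal (hS_open : IsOpen S) (hS_bdd : Bornology.IsBounded S)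
    (hS_lip : HasLipschitzBoundary S) (hL : 0 < L) :
    AEMeasurable (outerNormal (layerDomain S L)) (surfaceMeasure (layerDomain S L)) := by
  obtain ⟨t, χ, h⟩ := exists_regular_cover (L := L) hS_open hS_bdd hS_lip
  rw [← Measure.restrict_eq_self_of_ae_mem h]
  have hcap : ∀ κ : ℝ, κ = 1 ∨ κ = -1 → AEMeasurable (outerNormal (layerDomain S L))
      ((surfaceMeasure (layerDomain S L)).restrict (capSet S (κ * L))) := by
    intro κ hκ
    refine (aemeasurable_const (b := EuclideanSpace.single 2 κ)).congr ?_
    filter_upwards [ae_restrict_mem (measurableSet_capSet hS_open _)] with x hx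
    rw [outerNormal_eq_of_mem_capSet hS_open hL hκ hx]
  refine aemeasurable_union_iff.2 ⟨aemeasurable_union_iff.2
    ⟨hcap 1 (Or.inl rfl), hcap (-1) (Or.inr rfl)⟩, ?_⟩
  have hU : (⋃ p ∈ t, (χ p).regularSet L) = ⋃ p : t, (χ p).regularSet L :=
    Set.biUnion_eq_iUnion (t : Set (frontier S)) fun p _ => (χ p).regularSet L
  rw [hU]
  exact aemeasurable_iUnion_iff.2 fun p => (χ p).aemeasurable_outerNormal L _

end Boundary

/-! ### Weak curls and tangential traces -/

/-- Smooth vector fields with compact support. -/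
abbrev TestField : Type := {φ : E3 → C3 // IsSmooth φ ∧ HasCompactSupport φ}

theorem continuous_curlC {φ : E3 → C3} (hφ : IsSmooth φ) : Continuous (curlC φ) := by
  have h : ∀ i k, Continuous fun x => partialD i φ x k := fun i k =>
    (EuclideanSpace.proj (𝕜 := ℂ) k).continuous.comp
      ((hφ.continuous_fderiv (by simp)).clm_apply continuous_const)
  refine (PiLp.continuous_toLp 2 _).comp (continuous_pi fun i => ?_)
  fin_cases i
  · exact (h 1 2).sub (h 2 1)
  · exact (h 2 0).sub (h 0 2)
  · exact (h 0 1).sub (h 1 0)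

theorem hasCompactSupport_curlC {φ : E3 → C3} (hφ : HasCompactSupport φ) :
    HasCompactSupport (curlC φ) := by
  refine (hφ.fderiv (𝕜 := ℝ)).mono ?_
  intro x hx h0
  refine hx ?_
  have h0 : fderiv ℝ φ x = 0 := h0
  ext i
  fin_cases i <;> simp [curlC, partialD, h0]

section TestFields

variable {μ : Measure E3}

theorem TestField.memLp [IsFiniteMeasureOnCompacts μ] (φ : TestField) : MemLp φ.1 2 μ :=
  φ.2.1.continuous.memLp_of_hasCompactSupport φ.2.2

theorem TestField.memLp_curl [IsFiniteMeasureOnCompacts μ] (φ : TestField) :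
    MemLp (curlC φ.1) 2 μ :=
  (continuous_curlC φ.2.1).memLp_of_hasCompactSupport (hasCompactSupport_curlC φ.2.2)

/-- The test field `g eᵢ`. -/
noncomputable def TestField.single (i : Fin 3) {g : E3 → ℝ}
    (hg : ContDiff ℝ ((⊤ : ℕ∞) : WithTop ℕ∞) g) (hg' : HasCompactSupport g) : TestField :=
  ⟨fun x => g x • unitVec i, hg.smul contDiff_const, hg'.smul_right⟩

theorem integral_dotc_eq_inner {f : E3 → C3} (hf : MemLp f 2 μ) (u : Lp C3 2 μ) :
    ∫ x, dotc (u x) (f x) ∂μ = inner ℂ (hf.toLp f) u := by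
  rw [inner_toLp]
  simp_rw [dotc_eq_inner]

theorem integrable_dotc {f : E3 → C3} (hf : MemLp f 2 μ) (u : Lp C3 2 μ) :
    Integrable (fun x => dotc (u x) (f x)) μ := by
  refine (L2.integrable_inner (𝕜 := ℂ) (hf.toLp f) u).congr ?_
  filter_upwards [hf.coeFn_toLp] with x hx
  rw [hx, dotc_eq_inner]

end TestFields

/-- The functional `(u, w) ↦ ∫ w · φ̄ - u · curl φ̄`. -/
noncomputable def curlFunctional (Ω : Set E3) (φ : TestField) (u w : L2Field Ω) : ℂ :=
  inner ℂ ((φ.memLp (μ := volume.restrict Ω)).toLp φ.1) w -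
    inner ℂ ((φ.memLp_curl (μ := volume.restrict Ω)).toLp (curlC φ.1)) u

theorem isWeakCurl_iff {Ω : Set E3} {u w : L2Field Ω} : IsWeakCurl Ω u w ↔
    ∀ φ : TestField, tsupport φ.1 ⊆ Ω → curlFunctional Ω φ u w = 0 := by
  simp only [curlFunctional, ← integral_dotc_eq_inner, sub_eq_zero]
  exact ⟨fun h φ hφ => h φ.1 φ.2.1 φ.2.2 hφ, fun h φ h1 h2 h3 => h ⟨φ, h1, h2⟩ h3⟩

theorem dotc_smul_unitVec (a : C3) (g : ℝ) (i : Fin 3) : dotc a (g • unitVec i) = g • a i := by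
  fin_cases i <;> simp [dotc, unitVec, Fin.sum_univ_three, mul_comm]

/-- The fundamental lemma of the calculus of variations in each component, with test fields `g e_i`.
Hence the chosen `weakCurl` is the curl. -/
theorem IsWeakCurl.unique {Ω : Set E3} (hΩ : IsOpen Ω) {u w w' : L2Field Ω}
    (h : IsWeakCurl Ω u w) (h' : IsWeakCurl Ω u w') : w = w' := by
  rw [isWeakCurl_iff] at h h'
  set d := w - w' with hd
  have h0 : ∀ φ : TestField, tsupport φ.1 ⊆ Ω → ∫ x in Ω, dotc (d x) (φ.1 x) = 0 := by
    intro φ hφ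
    have h1 := h φ hφ
    have h2 := h' φ hφ
    rw [curlFunctional] at h1 h2
    rw [integral_dotc_eq_inner φ.memLp, hd, inner_sub_right]
    linear_combination h1 - h2
  have hcomp : ∀ i, ∀ᵐ x ∂volume.restrict Ω, d x i = 0 := by
    intro i
    have hint : LocallyIntegrable (fun x => d x i) (volume.restrict Ω) := by
      have h1 : MemLp (fun x => d x i) 2 (volume.restrict Ω) :=
        (Lp.memLp d).of_le ((EuclideanSpace.proj (𝕜 := ℂ) i).continuous.comp_aestronglyMeasurable
          (Lp.aestronglyMeasurable d)) (Eventually.of_forall fun x => PiLp.norm_apply_le (d x) i)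
      exact h1.locallyIntegrable (by norm_num)
    have h1 := hΩ.ae_eq_zero_of_integral_contDiff_smul_eq_zero
      (hint.locallyIntegrableOn Ω) fun g hg hg' hg'' => ?_
    · filter_upwards [h1, ae_restrict_mem hΩ.measurableSet] with x hx hxΩ using hx hxΩ
    · have h2 := h0 (TestField.single i hg hg')
        ((tsupport_smul_subset_left g fun _ => unitVec i).trans hg'')
      simp only [TestField.single, dotc_smul_unitVec] at h2
      exact h2
  have hz : d = 0 := by
    refine (Lp.eq_zero_iff_ae_eq_zero).2 ?_
    filter_upwards [hcomp 0, hcomp 1, hcomp 2] with x h0 h1 h2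
    ext i
    fin_cases i
    exacts [h0, h1, h2]
  exact sub_eq_zero.1 hz

theorem weakCurl_eq {Ω : Set E3} (hΩ : IsOpen Ω) {u w : L2Field Ω} (h : IsWeakCurl Ω u w) :
    weakCurl Ω u = w := by
  have hex : ∃ w, IsWeakCurl Ω u w := ⟨w, h⟩
  rw [weakCurl, dif_pos hex]
  exact hex.choose_spec.unique hΩ h

theorem continuous_crossReal : Continuous fun p : C3 × E3 => crossReal p.1 p.2 := by
  refine (PiLp.continuous_toLp 2 _).comp (continuous_pi fun i => ?_)
  fin_cases i <;> simp <;> fun_prop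

/-- A regular boundary: it has finite area and a measurable unit normal almost everywhere. -/
structure RegularBoundary (Ω : Set E3) : Prop where
  finite : IsFiniteMeasure (surfaceMeasure Ω)
  norm_normal : ∀ᵐ x ∂surfaceMeasure Ω, ‖outerNormal Ω x‖ = 1
  measurable_normal : AEMeasurable (outerNormal Ω) (surfaceMeasure Ω)

/-! ### Uniqueness of the tangential trace -/

section Trace

variable {Ω : Set E3} (hB : RegularBoundary Ω)

include hB

theorem memLp_cross {φ : E3 → C3} (hφ : Continuous φ) {C : ℝ} (hC : ∀ x, ‖φ x‖ ≤ C) :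
    MemLp (fun x => crossReal (φ x) (outerNormal Ω x)) 2 (surfaceMeasure Ω) := by
  have := hB.finite
  obtain ⟨M, hM⟩ := ((isCompact_closedBall (0 : C3) C).prod
    (isCompact_closedBall (0 : E3) 1)).exists_bound_of_continuousOn
      continuous_crossReal.continuousOn
  have hpair : AEStronglyMeasurable (fun x => (φ x, outerNormal Ω x)) (surfaceMeasure Ω) :=
    hφ.aestronglyMeasurable.prodMk hB.measurable_normal.aestronglyMeasurable
  have hmeas := continuous_crossReal.comp_aestronglyMeasurable hpair
  refine MemLp.of_bound hmeas M ?_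
  filter_upwards [hB.norm_normal] with x hx
  refine hM (φ x, outerNormal Ω x) (Set.mk_mem_prod ?_ ?_)
  · rw [mem_closedBall_zero_iff]
    exact hC x
  · rw [mem_closedBall_zero_iff]
    exact hx.le

theorem TestField.memLp_crossReal (φ : TestField) :
    MemLp (fun x => crossReal (φ.1 x) (outerNormal Ω x)) 2 (surfaceMeasure Ω) := by
  obtain ⟨C, hC⟩ := φ.2.2.exists_bound_of_continuous φ.2.1.continuous
  exact memLp_cross hB φ.2.1.continuous hC

theorem isTangentialTrace_iff {u : L2Field Ω} {t : L2Boundary Ω} : IsTangentialTrace Ω u t ↔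
    (∀ᵐ x ∂(surfaceMeasure Ω), ∑ i, t x i * (outerNormal Ω x i : ℂ) = 0) ∧
    ∀ φ : TestField, curlFunctional Ω φ u (weakCurl Ω u) =
      inner ℂ ((φ.memLp_crossReal hB).toLp _) t := by
  have := hB.finite
  have h1 : ∀ φ : TestField, ∫ x in Ω, (dotc (weakCurl Ω u x) (φ.1 x) - dotc (u x) (curlC φ.1 x)) =
      curlFunctional Ω φ u (weakCurl Ω u) := by
    intro φ
    rw [integral_sub (integrable_dotc φ.memLp _) (integrable_dotc φ.memLp_curl _),
      integral_dotc_eq_inner φ.memLp, integral_dotc_eq_inner φ.memLp_curl, curlFunctional]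
  refine and_congr_right fun _ => ?_
  constructor
  · intro h φ
    rw [← h1, h φ.1 φ.2.1 φ.2.2, integral_dotc_eq_inner (φ.memLp_crossReal hB)]
  · intro h φ h2 h3
    rw [h1 ⟨φ, h2, h3⟩, h, ← integral_dotc_eq_inner]

/-- Green's formula with `φ = g e_i` forces `ν × d = 0` for the difference `d`, and tangentiality
gives `d · ν = 0`. Both are needed, because the formula does not see normal components. -/
theorem IsTangentialTrace.unique {u : L2Field Ω} {t t' : L2Boundary Ω}
    (h : IsTangentialTrace Ω u t) (h' : IsTangentialTrace Ω u t') : t = t' := by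
  have := hB.finite
  rw [isTangentialTrace_iff hB] at h h'
  set d := t - t' with hd
  have h0 : ∀ φ : TestField, ∫ x, dotc (d x) (crossReal (φ.1 x) (outerNormal Ω x))
      ∂surfaceMeasure Ω = 0 := by
    intro φ
    rw [integral_dotc_eq_inner (φ.memLp_crossReal hB), hd, inner_sub_right, ← h.2, ← h'.2,
      sub_self]
  have hcomp : ∀ i, ∀ᵐ x ∂surfaceMeasure Ω,
      dotc (d x) (crossReal (unitVec i) (outerNormal Ω x)) = 0 := by
    intro i
    have hint : Integrable (fun x => dotc (d x) (crossReal (unitVec i) (outerNormal Ω x)))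
        (surfaceMeasure Ω) :=
      integrable_dotc (memLp_cross hB continuous_const fun _ => le_rfl) d
    refine ae_eq_zero_of_integral_contDiff_smul_eq_zero hint.locallyIntegrable
      fun g hg hg' => ?_
    rw [← h0 (TestField.single i hg hg')]
    refine integral_congr_ae (Eventually.of_forall fun x => ?_)
    fin_cases i <;>
      simp [TestField.single, dotc, crossReal, unitVec, Fin.sum_univ_three] <;> ring
  have htan : ∀ᵐ x ∂surfaceMeasure Ω, ∑ i, d x i * (outerNormal Ω x i : ℂ) = 0 := by
    filter_upwards [h.1, h'.1, Lp.coeFn_sub t t'] with x h1 h2 h3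
    rw [hd, h3]
    simp only [Pi.sub_apply, PiLp.sub_apply, sub_mul, Finset.sum_sub_distrib, h1, h2, sub_self]
  have hz : d = 0 := by
    refine (Lp.eq_zero_iff_ae_eq_zero).2 ?_
    filter_upwards [hcomp 0, hcomp 1, hcomp 2, htan, hB.norm_normal] with x h0 h1 h2 h3 h4
    have h5 : (outerNormal Ω x 0 : ℂ) ^ 2 + (outerNormal Ω x 1 : ℂ) ^ 2 +
        (outerNormal Ω x 2 : ℂ) ^ 2 = 1 := by
      have h6 := EuclideanSpace.norm_sq_eq (outerNormal Ω x)
      rw [h4, Fin.sum_univ_three] at h6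
      simp only [Real.norm_eq_abs, sq_abs] at h6
      exact_mod_cast h6.symm.trans (one_pow 2)
    simp [dotc, crossReal, unitVec, Fin.sum_univ_three] at h0 h1 h2 h3
    set a := d x 0
    set b := d x 1
    set c := d x 2
    set n0 : ℂ := (outerNormal Ω x 0 : ℂ)
    set n1 : ℂ := (outerNormal Ω x 1 : ℂ)
    set n2 : ℂ := (outerNormal Ω x 2 : ℂ)
    -- The three cases are the components of `d = (ν × d) × ν + (d · ν) ν`, valid since `|ν| = 1`.
    ext i
    fin_cases i
    · change a = 0
      linear_combination (-a) * h5 + n2 * h1 - n1 * h2 + n0 * h3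
    · change b = 0
      linear_combination (-b) * h5 - n2 * h0 + n0 * h2 + n1 * h3
    · change c = 0
      linear_combination (-c) * h5 + n1 * h0 - n0 * h1 + n2 * h3
  exact sub_eq_zero.1 hz

theorem tangentialTrace_eq {u : L2Field Ω} {t : L2Boundary Ω} (h : IsTangentialTrace Ω u t) :
    tangentialTrace Ω u = t := by
  have hex : ∃ t, IsTangentialTrace Ω u t := ⟨t, h⟩
  rw [tangentialTrace, dif_pos hex]
  exact hex.choose_spec.unique hB h

end Trace

/-! ### Matrices as operators -/

/-- The continuous linear map `ξ ↦ A ξ`. -/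
noncomputable def matCLM (A : Matrix (Fin 3) (Fin 3) ℂ) : C3 →L[ℂ] C3 :=
  ∑ i, ∑ j, A i j • (EuclideanSpace.proj (𝕜 := ℂ) j).smulRight (unitVec i)

theorem matCLM_apply (A : Matrix (Fin 3) (Fin 3) ℂ) (ξ : C3) : matCLM A ξ = matVec A ξ := by
  ext k
  fin_cases k <;> simp [matCLM, matVec, unitVec, Fin.sum_univ_three]

theorem exists_norm_matCLM_le (M : ℝ) : ∃ N : ℝ, 0 < N ∧ ∀ A : Matrix (Fin 3) (Fin 3) ℂ,
    (∀ i j, ‖A i j‖ ≤ M) → ‖matCLM A‖ ≤ N := by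
  set F : Fin 3 → Fin 3 → C3 →L[ℂ] C3 := fun i j =>
    (EuclideanSpace.proj (𝕜 := ℂ) j).smulRight (unitVec i)
  refine ⟨max 1 (∑ i, ∑ j, M * ‖F i j‖), lt_max_of_lt_left one_pos, fun A hA =>
    le_max_of_le_right ?_⟩
  refine norm_sum_le_of_le _ fun i _ => norm_sum_le_of_le _ fun j _ => ?_
  rw [norm_smul]
  exact mul_le_mul_of_nonneg_right (hA i j) (norm_nonneg _)

theorem aestronglyMeasurable_matCLM {X : Type*} [MeasurableSpace X] {μ : Measure X}
    {A : X → Matrix (Fin 3) (Fin 3) ℂ} (hA : ∀ i j, AEMeasurable (fun x => A x i j) μ) :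
    AEStronglyMeasurable (fun x => matCLM (A x)) μ :=
  Finset.aestronglyMeasurable_fun_sum _ fun i _ => Finset.aestronglyMeasurable_fun_sum _ fun j _ =>
    (hA i j).aestronglyMeasurable.smul_const _

/-! ### The space `X⁰` as a closed subspace of a product -/

/-- Triples of a field in `Ω`, its curl and its tangential trace. -/
abbrev XTriple (Ω : Set E3) : Type :=
  WithLp 2 (L2Field Ω × WithLp 2 (L2Field Ω × L2Boundary Ω))

/-- The functional `curlFunctional` as a continuous functional of the triple. -/
noncomputable def curlCLM (Ω : Set E3) (φ : TestField) : XTriple Ω →L[ℂ] ℂ :=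
  innerSL ℂ ((φ.memLp (μ := volume.restrict Ω)).toLp φ.1) ∘L WithLp.fstL 2 ℂ _ _ ∘L
      WithLp.sndL 2 ℂ _ _ -
    innerSL ℂ ((φ.memLp_curl (μ := volume.restrict Ω)).toLp (curlC φ.1)) ∘L WithLp.fstL 2 ℂ _ _

/-- Tangentiality becomes the kernel of a bounded operator, hence a closed condition: the matrix has
all three rows equal to `ν`. -/
theorem exists_normalCLM {Ω : Set E3} (hB : RegularBoundary Ω) :
    ∃ T : L2Boundary Ω →L[ℂ] L2Boundary Ω, ∀ t, T t = 0 ↔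
      ∀ᵐ x ∂surfaceMeasure Ω, ∑ i, t x i * (outerNormal Ω x i : ℂ) = 0 := by
  set A : E3 → Matrix (Fin 3) (Fin 3) ℂ := fun x _ j => (outerNormal Ω x j : ℂ)
  have hA : ∀ i j, AEMeasurable (fun x => A x i j) (surfaceMeasure Ω) := fun i j =>
    Complex.measurable_ofReal.comp_aemeasurable
      ((EuclideanSpace.proj (𝕜 := ℝ) j).continuous.measurable.comp_aemeasurable
        hB.measurable_normal)
  obtain ⟨N, -, hN⟩ := exists_norm_matCLM_le 1
  have hbd : ∀ᵐ x ∂surfaceMeasure Ω, ‖matCLM (A x)‖ ≤ N := by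
    filter_upwards [hB.norm_normal] with x hx
    refine hN _ fun i j => ?_
    rw [Complex.norm_real, ← hx]
    exact PiLp.norm_apply_le _ j
  refine ⟨pointwiseLp _ (aestronglyMeasurable_matCLM hA) N hbd, fun t => ?_⟩
  rw [Lp.eq_zero_iff_ae_eq_zero]
  have h := coeFn_pointwiseLp _ (aestronglyMeasurable_matCLM hA) N hbd t
  have h0 : ∀ x, matCLM (A x) (t x) = 0 ↔ ∑ i, t x i * (outerNormal Ω x i : ℂ) = 0 := by
    intro x
    have h1 : ∀ i, matCLM (A x) (t x) i = ∑ i, t x i * (outerNormal Ω x i : ℂ) := fun i => by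
      rw [matCLM_apply]
      change ∑ j, (outerNormal Ω x j : ℂ) * t x j = _
      exact Finset.sum_congr rfl fun j _ => mul_comm _ _
    constructor
    · intro h2
      rw [← h1 0, h2]
      rfl
    · intro h2
      ext i
      rw [h1, h2]
      rfl
  constructor
  · intro h2
    filter_upwards [h, h2] with x hx hx2
    rw [← h0, ← hx, hx2]
    rfl
  · intro h2
    filter_upwards [h, h2] with x hx hx2
    rw [hx, (h0 x).2 hx2]
    rfl

/-- Green's formula is imposed with the second component of the triple in place of `weakCurl`. All
conditions are then kernels of continuous maps, and uniqueness of the curl identifies the two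
afterwards. -/
theorem exists_maxwellSpace {Ω : Set E3} (hΩ : IsOpen Ω) (hB : RegularBoundary Ω) :
    ∃ V : Submodule ℂ (XTriple Ω), IsClosed (V : Set (XTriple Ω)) ∧ ∀ p, p ∈ V ↔
      IsWeakCurl Ω p.fst p.snd.fst ∧ IsTangentialTrace Ω p.fst p.snd.snd := by
  obtain ⟨T, hT⟩ := exists_normalCLM hB
  set l₁ : {φ : TestField // tsupport φ.1 ⊆ Ω} → XTriple Ω →L[ℂ] ℂ := fun φ => curlCLM Ω φ.1
  set l₂ : TestField → XTriple Ω →L[ℂ] ℂ := fun φ => curlCLM Ω φ -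
    innerSL ℂ ((φ.memLp_crossReal hB).toLp _) ∘L WithLp.sndL 2 ℂ _ _ ∘L WithLp.sndL 2 ℂ _ _
  set l₃ : XTriple Ω →L[ℂ] L2Boundary Ω := T ∘L WithLp.sndL 2 ℂ _ _ ∘L WithLp.sndL 2 ℂ _ _
  refine ⟨(⨅ φ, (l₁ φ).ker) ⊓ ((⨅ φ, (l₂ φ).ker) ⊓ l₃.ker), ?_, fun p => ?_⟩
  · simp only [Submodule.coe_inf, Submodule.coe_iInf]
    exact (isClosed_iInter fun φ => (l₁ φ).isClosed_ker).inter
      ((isClosed_iInter fun φ => (l₂ φ).isClosed_ker).inter l₃.isClosed_ker)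
  · simp only [Submodule.mem_inf, Submodule.mem_iInf, LinearMap.mem_ker]
    have e1 : (∀ φ, l₁ φ p = 0) ↔ IsWeakCurl Ω p.fst p.snd.fst := by
      rw [isWeakCurl_iff]
      exact ⟨fun h φ hφ => h ⟨φ, hφ⟩, fun h φ => h φ.1 φ.2⟩
    have e2 : l₃ p = 0 ↔ ∀ᵐ x ∂surfaceMeasure Ω,
        ∑ i, p.snd.snd x i * (outerNormal Ω x i : ℂ) = 0 := hT p.snd.snd
    have e3 : (∀ φ, l₂ φ p = 0) ↔ ∀ φ : TestField, curlFunctional Ω φ p.fst p.snd.fst =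
        inner ℂ ((φ.memLp_crossReal hB).toLp _) p.snd.snd :=
      forall_congr' fun φ => sub_eq_zero
    refine (and_congr e1 (and_congr e3 e2)).trans (and_congr_right fun h => ?_)
    rw [isTangentialTrace_iff hB, weakCurl_eq hΩ h, and_comm]

/-! ### The homogenized problem -/

/-- The triple of a field, its weak curl and its tangential trace. -/
noncomputable def maxwellTriple (Ω : Set E3) (u : L2Field Ω) : XTriple Ω :=
  WithLp.toLp 2 (u, WithLp.toLp 2 (weakCurl Ω u, tangentialTrace Ω u))

theorem mem_X0_iff_exists {Ω : Set E3} (hΩ : IsOpen Ω) (hB : RegularBoundary Ω)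
    {V : Submodule ℂ (XTriple Ω)} (hV : ∀ p, p ∈ V ↔
      IsWeakCurl Ω p.fst p.snd.fst ∧ IsTangentialTrace Ω p.fst p.snd.snd) :
    (∀ p ∈ V, p.fst ∈ X0 Ω ∧ maxwellTriple Ω p.fst = p) ∧
      ∀ u ∈ X0 Ω, maxwellTriple Ω u ∈ V := by
  constructor
  · intro p hp
    obtain ⟨h1, h2⟩ := (hV p).1 hp
    refine ⟨⟨⟨_, h1⟩, _, h2⟩, ?_⟩
    rw [maxwellTriple, weakCurl_eq hΩ h1, tangentialTrace_eq hB h2]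
    rfl
  · rintro u ⟨⟨w, hw⟩, t, ht⟩
    rw [hV]
    change IsWeakCurl Ω u (weakCurl Ω u) ∧ IsTangentialTrace Ω u (tangentialTrace Ω u)
    rw [weakCurl_eq hΩ hw, tangentialTrace_eq hB ht]
    exact ⟨hw, ht⟩

theorem const_mul_a0_eq_inner {Ω : Set E3} {A : E3 → Matrix (Fin 3) (Fin 3) ℂ}
    (κ : ℂ) (ω mu lam : ℝ)
    (hT : AEStronglyMeasurable (fun x => (κ * -(ω : ℂ) ^ 2) • matCLM (A x)) (volume.restrict Ω))
    (N : ℝ) (hN : ∀ᵐ x ∂volume.restrict Ω, ‖(κ * -(ω : ℂ) ^ 2) • matCLM (A x)‖ ≤ N)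
    (u v : L2Field Ω) :
    inner ℂ (maxwellTriple Ω v) (diagL2 (pointwiseLp _ hT N hN)
      (diagL2 ((κ * (1 / (mu : ℂ))) • ContinuousLinearMap.id ℂ (L2Field Ω))
        ((κ * -(Complex.I * ω * lam)) • ContinuousLinearMap.id ℂ (L2Boundary Ω)))
      (maxwellTriple Ω u)) = κ * a0 Ω ω mu lam A u v := by
  rw [inner_diagL2, inner_diagL2, inner_pointwiseLp, a0]
  simp only [integral_const_mul, dotc_eq_inner, ← L2.inner_def, _root_.smul_apply,
    inner_smul_right, matCLM_apply]
  change κ * -(ω : ℂ) ^ 2 * (∫ x in Ω, inner ℂ (v x) (matVec (A x) (u x))) +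
    (κ * (1 / (mu : ℂ)) * inner ℂ (weakCurl Ω v) (weakCurl Ω u) +
    κ * -(Complex.I * ω * lam) * inner ℂ (tangentialTrace Ω v) (tangentialTrace Ω u)) = _
  ring

theorem smul_id_coercive {E : Type*} [NormedAddCommGroup E] [InnerProductSpace ℂ E] (a : ℂ)
    (u : E) : a.re * ‖u‖ ^ 2 ≤ (inner ℂ u ((a • ContinuousLinearMap.id ℂ E) u)).re := by
  rw [_root_.smul_apply, ContinuousLinearMap.id_apply, inner_smul_right,
    inner_self_eq_norm_sq_to_K]
  exact (Complex.re_mul_ofReal a (‖u‖ ^ 2)).symm.trans (by push_cast; rfl) |>.le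

theorem a0_congr {Ω : Set E3} {ω mu lam : ℝ} {A A' : E3 → Matrix (Fin 3) (Fin 3) ℂ}
    (h : ∀ᵐ x ∂volume.restrict Ω, A x = A' x) (u v : L2Field Ω) :
    a0 Ω ω mu lam A u v = a0 Ω ω mu lam A' u v := by
  rw [a0, a0]
  congr 2
  refine integral_congr_ae ?_
  filter_upwards [h] with x hx
  rw [hx]

/-- The time-harmonic Maxwell problem with impedance boundary condition and a bounded permittivity
with positive imaginary part is uniquely solvable. -/
theorem existsUnique_maxwell {Ω : Set E3} (hΩ : IsOpen Ω) (hB : RegularBoundary Ω)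
    {ω mu lam c M : ℝ} (hω : 0 < ω) (hmu : 0 < mu) (hlam : 0 < lam) (hc : 0 < c)
    {A : E3 → Matrix (Fin 3) (Fin 3) ℂ} (hA : ∀ i j, Measurable fun x => A x i j)
    (hM : ∀ x i j, ‖A x i j‖ ≤ M)
    (hcoer : ∀ᵐ x ∂volume.restrict Ω, ∀ ξ : C3, c * ‖ξ‖ ^ 2 ≤ (dotc (matVec (A x) ξ) ξ).im)
    (J : L2Field Ω) :
    ∃! E : L2Field Ω, E ∈ X0 Ω ∧ ∀ Ψ ∈ X0 Ω,
      a0 Ω ω mu lam A E Ψ = ∫ x in Ω, Complex.I * ω * dotc (J x) (Ψ x) := by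
  obtain ⟨N, hN0, hN⟩ := exists_norm_matCLM_le M
  obtain ⟨V, hVc, hV⟩ := exists_maxwellSpace hΩ hB
  obtain ⟨hVX, hXV⟩ := mem_X0_iff_exists hΩ hB hV
  have : CompleteSpace V := hVc.completeSpace_coe
  -- As `N` bounds the matrices, the `δ` part costs at most half of the coercivity constant `c`.
  set δ : ℝ := c / (2 * N)
  have hδ : 0 < δ := by positivity
  -- The factor `i` makes the permittivity and impedance terms positive but the curl term imaginary;
  -- `δ` restores `δ/μ` in front of the curl.
  set κ : ℂ := δ + Complex.I
  have hκ : κ ≠ 0 := fun h => by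
    have := congrArg Complex.im h
    simp [κ] at this
  have hT : AEStronglyMeasurable (fun x => (κ * -(ω : ℂ) ^ 2) • matCLM (A x))
      (volume.restrict Ω) :=
    (aestronglyMeasurable_matCLM fun i j => (hA i j).aemeasurable).fun_const_smul _
  have hTN : ∀ᵐ x ∂volume.restrict Ω, ‖(κ * -(ω : ℂ) ^ 2) • matCLM (A x)‖ ≤
      ‖κ * -(ω : ℂ) ^ 2‖ * N := Eventually.of_forall fun x => by
    rw [norm_smul]
    exact mul_le_mul_of_nonneg_left (hN _ (hM x)) (norm_nonneg _)
  set B : XTriple Ω →L[ℂ] XTriple Ω := diagL2 (pointwiseLp _ hT _ hTN)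
      (diagL2 ((κ * (1 / (mu : ℂ))) • ContinuousLinearMap.id ℂ (L2Field Ω))
        ((κ * -(Complex.I * ω * lam)) • ContinuousLinearMap.id ℂ (L2Boundary Ω))) with hBdef
  have hBa : ∀ u v, inner ℂ (maxwellTriple Ω v) (B (maxwellTriple Ω u)) =
      κ * a0 Ω ω mu lam A u v := const_mul_a0_eq_inner κ ω mu lam hT _ hTN
  have hpt : ∀ᵐ x ∂volume.restrict Ω, ∀ ξ : C3, ω ^ 2 * (c / 2) * ‖ξ‖ ^ 2 ≤
      (inner ℂ ξ (((κ * -(ω : ℂ) ^ 2) • matCLM (A x)) ξ)).re := by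
    filter_upwards [hcoer] with x hx ξ
    have h1 := hx ξ
    rw [dotc_eq_inner, ← matCLM_apply] at h1
    rw [_root_.smul_apply, inner_smul_right]
    have h2 : (inner ℂ ξ (matCLM (A x) ξ)).re ≤ N * ‖ξ‖ ^ 2 := by
      refine (Complex.re_le_norm _).trans ((norm_inner_le_norm _ _).trans ?_)
      have h3 := (matCLM (A x)).le_of_opNorm_le (hN _ (hM x)) ξ
      calc ‖ξ‖ * ‖matCLM (A x) ξ‖ ≤ ‖ξ‖ * (N * ‖ξ‖) :=
            mul_le_mul_of_nonneg_left h3 (norm_nonneg _)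
        _ = N * ‖ξ‖ ^ 2 := by ring
    set z := inner ℂ ξ (matCLM (A x) ξ)
    have h4 : (κ * -(ω : ℂ) ^ 2 * z).re = ω ^ 2 * (z.im - δ * z.re) := by
      rw [← Complex.ofReal_pow, mul_neg, neg_mul, mul_assoc, Complex.neg_re, mul_comm, mul_assoc,
        Complex.re_ofReal_mul]
      simp [κ]
      ring
    rw [h4, mul_assoc]
    refine mul_le_mul_of_nonneg_left ?_ (sq_nonneg ω)
    have h5 : δ * z.re ≤ c / 2 * ‖ξ‖ ^ 2 := by
      calc δ * z.re ≤ δ * (N * ‖ξ‖ ^ 2) := mul_le_mul_of_nonneg_left h2 hδ.le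
        _ = c / 2 * ‖ξ‖ ^ 2 := by
          simp only [δ]
          field_simp
    linarith
  have hre1 : (κ * (1 / (mu : ℂ))).re = δ / mu := by
    rw [mul_one_div, Complex.div_ofReal_re]
    simp [κ]
  have hre2 : (κ * -(Complex.I * ω * lam)).re = ω * lam := by
    simp [κ]
  have hBc := diagL2_coercive (pointwiseLp_coercive _ hT _ hTN hpt)
    (diagL2_coercive (smul_id_coercive (E := L2Field Ω) (κ * (1 / (mu : ℂ))))
      (smul_id_coercive (E := L2Boundary Ω) (κ * -(Complex.I * ω * lam))))
  rw [hre1, hre2] at hBc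
  have hα : 0 < min (ω ^ 2 * (c / 2)) (min (δ / mu) (ω * lam)) :=
    lt_min (by positivity) (lt_min (by positivity) (by positivity))
  -- The source carries the same factor `κ`, which cancels in `hiff`.
  set f : XTriple Ω := WithLp.toLp 2 ((κ * (Complex.I * ω)) • J, 0)
  have hf : ∀ v, inner ℂ (maxwellTriple Ω v) f =
      κ * ∫ x in Ω, Complex.I * ω * dotc (J x) (v x) := by
    intro v
    rw [integral_const_mul, WithLp.prod_inner_apply]
    simp only [dotc_eq_inner, ← L2.inner_def]
    change inner ℂ v ((κ * (Complex.I * ω)) • J) + inner ℂ _ 0 = _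
    rw [inner_zero_right, add_zero, inner_smul_right, mul_assoc]
  have hiff : ∀ u, (∀ p ∈ V, inner ℂ p (B (maxwellTriple Ω u)) = inner ℂ p f) ↔
      ∀ Ψ ∈ X0 Ω, a0 Ω ω mu lam A u Ψ = ∫ x in Ω, Complex.I * ω * dotc (J x) (Ψ x) := by
    intro u
    constructor
    · intro h Ψ hΨ
      have h1 := h _ (hXV Ψ hΨ)
      rw [hBa, hf] at h1
      exact mul_left_cancel₀ hκ h1
    · intro h p hp
      obtain ⟨h1, h2⟩ := hVX p hp
      rw [← h2, hBa, hf, h _ h1]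
  obtain ⟨p, hp, hps⟩ := exists_variational_solution V B hα hBc f
  obtain ⟨hpX, hpe⟩ := hVX p hp
  refine ⟨p.fst, ⟨hpX, (hiff _).1 (by rwa [hpe])⟩, ?_⟩
  rintro E ⟨hE, hEs⟩
  have h := variational_solution_unique hα hBc (hXV E hE) hp ((hiff E).2 hEs) hps
  rw [← h]
  rfl

end PlasmonicMaxwell

theorem theorem3
    (S : Set E2) (hS_open : IsOpen S) (hS_bdd : Bornology.IsBounded S)
    (hS_lip : HasLipschitzBoundary S)
    (L : ℝ) (hL : 0 < L)
    (ω mu lam : ℝ) (hω : 0 < ω) (hmu : 0 < mu) (hlam : 0 < lam)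
    (ε : E3 → E3 → ℂ) (σ : E3 → E2 → ℂ)
    (hε_meas : AEMeasurable (fun p : E3 × E3 => ε p.1 p.2)
      ((volume.restrict (layerDomain S L)).prod volume))
    (hε_per : ∀ x ∈ layerDomain S L, IsPeriodic (ε x))
    (hσ_per : ∀ x ∈ layerDomain S L, IsPeriodic (σ x))
    (K : ℝ≥0)
    (hσ_lip : LipschitzOnWith K (fun p : E3 × E2 => σ p.1 p.2) (layerDomain S L ×ˢ Set.univ))
    (c C : ℝ) (hc : 0 < c)
    (hε : ∀ x ∈ layerDomain S L, ∀ y : E3, c ≤ (ε x y).im ∧ ‖ε x y‖ ≤ C)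
    (hσ : ∀ x ∈ layerDomain S L, ∀ y : E2, c ≤ (σ x y).re ∧ ‖σ x y‖ ≤ C) :
    -- the effective permittivity exists, is measurable and bounded,
    (∃ εeff : E3 → Matrix (Fin 3) (Fin 3) ℂ,
      IsEffectivePermittivity (layerDomain S L) ω ε σ εeff ∧
      (∀ i j, Measurable (fun x => εeff x i j)) ∧ ∃ M : ℝ, ∀ x i j, ‖εeff x i j‖ ≤ M) ∧
    -- it is unique up to null sets,
    (∀ εeff εeff' : E3 → Matrix (Fin 3) (Fin 3) ℂ,
      IsEffectivePermittivity (layerDomain S L) ω ε σ εeff →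
      IsEffectivePermittivity (layerDomain S L) ω ε σ εeff' →
      ∀ᵐ x ∂(volume.restrict (layerDomain S L)), εeff x = εeff' x) ∧
    -- and with it the homogenized problem is uniquely solvable.
    ∀ εeff : E3 → Matrix (Fin 3) (Fin 3) ℂ,
      IsEffectivePermittivity (layerDomain S L) ω ε σ εeff →
      (∀ᵐ x ∂(volume.restrict (layerDomain S L)), ∀ ξ : C3,
        c * ‖ξ‖ ^ 2 ≤ (dotc (matVec (εeff x) ξ) ξ).im) ∧
      ∀ J : L2Field (layerDomain S L),
        ∃! E : L2Field (layerDomain S L), E ∈ X0 (layerDomain S L) ∧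
          ∀ Ψ ∈ X0 (layerDomain S L),
            a0 (layerDomain S L) ω mu lam εeff E Ψ =
              ∫ x in layerDomain S L, Complex.I * ω * dotc (J x) (Ψ x) := by
  have hΩ := isOpen_layerDomain hS_open L
  have hm := hΩ.measurableSet
  have hσ_cont := hσ_lip.continuousOn
  have hB : RegularBoundary (layerDomain S L) :=
    ⟨isFiniteMeasure_surfaceMeasure hS_open hS_bdd hS_lip,
      ae_norm_outerNormal hS_open hS_bdd hS_lip hL,
      aemeasurable_outerNormal hS_open hS_bdd hS_lip hL⟩
  refine ⟨exists_effectivePermittivity hm hω hc hε_meas hσ_cont hε hσ,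
    fun _ _ h h' => effectivePermittivity_unique hm hω hc hε_meas hσ_cont hε hσ h h',
    fun εeff h => ⟨effectivePermittivity_coercive hm hω hc hε_meas hσ_cont hε hσ h,
      fun J => ?_⟩⟩
  -- The given field need not be measurable or bounded everywhere; it is replaced by the
  -- representative `A`, which leaves the form unchanged.
  obtain ⟨A, hA, hAm, M, hM⟩ := exists_effectivePermittivity hm hω hc hε_meas hσ_cont hε hσ
  have hae := effectivePermittivity_unique hm hω hc hε_meas hσ_cont hε hσ h hA
  simp_rw [a0_congr hae]
  exact existsUnique_maxwell hΩ hB hω hmu hlam hc hAm hM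
    (effectivePermittivity_coercive hm hω hc hε_meas hσ_cont hε hσ hA) J
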